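/- Let $\mathbb S^1=\mathbb R/2\pi\mathbb Z$ and $\mathbb T^2=\mathbb S^1\times\mathbb S^1$ with coordinates $(\theta,\varphi)$. View $\mathbb S^3$ as the join $\mathbb S^1*\mathbb S^1$, i.e. the quotient of $\mathbb S^1\times\mathbb S^1\times[0,1]$ by $(\theta,\varphi,0)\sim(\theta',\varphi,0)$ and $(\theta,\varphi,1)\sim(\theta,\varphi',1)$; write $[\theta,\varphi,\tau]$ for the class of $(\theta,\varphi,\tau)$. **Links.** A rectangular diagram of a link is a finite set $R\subset\mathbb T^2$ such that every meridian $\{\theta\}\times\mathbb S^1$ and every longitude $\mathbb S^1\times\{\varphi\}$ contains either no or exactly two points of $R$; two points of $R$ on a common meridian (longitude) form a vertical (horizontal) edge. For $v=(\theta,\varphi)$ let $\widehat v=\{[\theta,\varphi,\tau]:\tau\in[0,1]\}$, and let $\widehat R=\bigcup_{v\in R}\widehat v$ be the associated link. **Surfaces.** For $x,y\in\mathbb S^1$ let $[x;y]$ be the closed arc from $x$ to $y$ in the positive direction. A rectangle is $r=[\theta_1;\theta_2]\times[\varphi_1;\varphi_2]\subset\mathbb T^2$ with $\theta_1\ne\theta_2$,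 $\varphi_1\neq\varphi_2$; its vertices are the four points $(\theta_i,\varphi_j)$. Two rectangles are compatible if their intersection is empty, or is contained in the set of vertices of each of them, or is a rectangle containing no vertex of either of them. A rectangular diagram of a quasi-surface is a countable collection $\Pi$ of pairwise compatible rectangles such that the set of all $\theta_1,\theta_2$ and the set of all $\varphi_1,\varphi_2$ of rectangles in $\Pi$ are discrete subsets of $\mathbb S^1$ and any $x\in\mathbb S^1$ is among the $\theta_1,\theta_2,\varphi_1,\varphi_2$ of only finitely many rectangles of $\Pi$. It is a rectangular diagram of a surface if the set of points that are vertices of exactly one rectangle of $\Pi$ is a (possibly empty) rectangular diagram of a link. For a rectangle $r$ let $h_r$ be the unique bounded continuous function on $r$ minus its vertices that is harmonic in the interior, equal to $0$ on the open sides $(\theta_1;\theta_2)\times\{\varphi_j\}$ and to $1$ on the open sides $\{\theta_i\}\times(\varphi_1;\varphi_2)$. Let $\zeta(x)=\frac2\pi\arctan\sqrt{\tan(\pi x/2)}$ for $0\le x<1$, $\zeta(1)=1$. The tile $\widehat r$ is the closure in $\mathbb S^3$ of $\{[\theta,\varphi,\zeta(h_r(\theta,\varphi))]\}$, where $(\theta,\varphi)$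 runs over $r$ minus its vertices. Put $\widehat\Pi=\bigcup_{r\in\Pi}\widehat r$. **Proposition.** Let $R$ be a non-empty rectangular diagram of a link, and let $d$ be the smallest distance in $\mathbb S^1$ between two distinct (equivalently, two neighbouring) meridians containing vertices of $R$ or two distinct longitudes containing vertices of $R$. Let $\mathfrak v$ (respectively, $\mathfrak h$) be the bijection $R\to R$ exchanging the two vertices of each vertical (respectively, horizontal) edge. Then for any $t\in(0,d/2)$ the collection $$\Omega_t(R)=\bigcup_{v=(\theta_v,\varphi_v)\in R}\bigl\{[\theta_v+t;\theta_{\mathfrak h(v)}-t]\times[\varphi_v-t;\varphi_v+t],\ [\theta_v-t;\theta_v+t]\times[\varphi_v+t;\varphi_{\mathfrak v(v)}-t]\bigr\}$$ is a rectangular diagram of a surface. Moreover, the set $$N_t(R)=\widehat R\cup\bigcup_{0<s<t}\widehat\Omega_s(R)$$ is an open tubular neighbourhood of $\widehat R$ with boundary $\widehat\Omega_t(R)$: it is open in $\mathbb S^3$, its topological boundary is $\widehat\Omega_t(R)$, and there is a topological embedding $e:\widehat R\times D^2\to\mathbb S^3$, where $D^2$ is the closed unit disc, such that $e(x,0)=x$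 for all $x\in\widehat R$, $e(\widehat R\times\operatorname{int}D^2)=N_t(R)$ and $e(\widehat R\times\partial D^2)=\widehat\Omega_t(R)$. -/

import Mathlib

open Set Topology
open scoped Real

noncomputable section

namespace RectDiagram

/-! ### The torus and the three-sphere as a join of two circles -/

/-- The circle `ℝ / 2πℤ`. -/
abbrev S1 : Type := AddCircle (2 * π)

instance instFactTwoPiPos : Fact (0 < 2 * π) := ⟨Real.two_pi_pos⟩

/-- The two-torus; the first coordinate is `θ`, the second one is `φ`. -/
abbrev Torus : Type := S1 × S1

/-- The identifications defining the join of two circles: points `(θ, φ, τ)`, `(θ', φ', τ')` are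
identified when `τ = τ'` and `θ = θ'` (unless `τ = 0`) and `φ = φ'` (unless `τ = 1`). So at `τ = 0`
the coordinate `θ` is forgotten, and at `τ = 1` the coordinate `φ` is forgotten. -/
def joinSetoid : Setoid (S1 × S1 × unitInterval) where
  r p q := p.2.2 = q.2.2 ∧ (p.1 = q.1 ∨ p.2.2 = 0) ∧ (p.2.1 = q.2.1 ∨ p.2.2 = 1)
  iseqv :=
    { refl := fun _ => ⟨rfl, Or.inl rfl, Or.inl rfl⟩
      symm := fun {p q} h => ⟨h.1.symm, h.2.1.imp Eq.symm (fun e => h.1 ▸ e),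
        h.2.2.imp Eq.symm (fun e => h.1 ▸ e)⟩
      trans := fun {p q s} h k => by
        obtain ⟨h1, h2, h3⟩ := h
        obtain ⟨k1, k2, k3⟩ := k
        refine ⟨h1.trans k1, ?_, ?_⟩
        · rcases h2 with h2 | h2
          · rcases k2 with k2 | k2
            · exact Or.inl (h2.trans k2)
            · exact Or.inr (h1.trans k2)
          · exact Or.inr h2
        · rcases h3 with h3 | h3
          · rcases k3 with k3 | k3
            · exact Or.inl (h3.trans k3)
            · exact Or.inr (h1.trans k3)
          · exact Or.inr h3 }

/-- The three-sphere as the join of two circles, with the quotient topology. -/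
def S3 : Type := Quotient joinSetoid

instance instTopologicalSpaceS3 : TopologicalSpace S3 :=
  inferInstanceAs (TopologicalSpace (Quotient joinSetoid))

/-- The point `[θ, φ, τ]` of the three-sphere. -/
def S3.mk (θ φ : S1) (τ : unitInterval) : S3 := Quotient.mk joinSetoid (θ, φ, τ)

/-- The arc `v̂ = {[θ, φ, τ] : τ ∈ [0, 1]}` associated with a point `v = (θ, φ)` of the torus. -/
def hatPoint (v : Torus) : Set S3 := range (S3.mk v.1 v.2)

/-! ### Rectangular diagrams of links -/

/-- A rectangular diagram of a link: a finite set of points of the torus such that every meridian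
`{θ} × S¹` and every longitude `S¹ × {φ}` contains either none or exactly two of them. -/
structure IsLinkDiagram (R : Set Torus) : Prop where
  finite : R.Finite
  meridian : ∀ θ : S1, {v ∈ R | v.1 = θ}.encard = 0 ∨ {v ∈ R | v.1 = θ}.encard = 2
  longitude : ∀ φ : S1, {v ∈ R | v.2 = φ}.encard = 0 ∨ {v ∈ R | v.2 = φ}.encard = 2

/-- `{v, w}` is a vertical edge of `R`. -/
def IsVerticalEdge (R : Set Torus) (v w : Torus) : Prop :=
  v ∈ R ∧ w ∈ R ∧ v ≠ w ∧ v.1 = w.1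

/-- `{v, w}` is a horizontal edge of `R`. -/
def IsHorizontalEdge (R : Set Torus) (v w : Torus) : Prop :=
  v ∈ R ∧ w ∈ R ∧ v ≠ w ∧ v.2 = w.2

/-- The associated link `R̂`, a subset of the three-sphere. -/
def hatLink (R : Set Torus) : Set S3 := ⋃ v ∈ R, hatPoint v

/-- The set of distances between two distinct meridians containing points of `R` and between two
distinct longitudes containing points of `R`, in the arc-length metric of `ℝ / 2πℤ`. (Its least
element is attained at two neighbouring meridians or at two neighbouring longitudes.) -/
def edgeDistances (R : Set Torus) : Set ℝ :=
  {δ | ∃ v ∈ R, ∃ w ∈ R, v.1 ≠ w.1 ∧ δ = dist v.1 w.1} ∪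
    {δ | ∃ v ∈ R, ∃ w ∈ R, v.2 ≠ w.2 ∧ δ = dist v.2 w.2}

/-! ### Rectangles -/

/-- The length in `[0, 2π)` of the arc going from `x` to `y` in the positive direction. -/
def arcLength (x y : S1) : ℝ := (AddCircle.equivIco (2 * π) 0 (y - x) : ℝ)

/-- The closed arc `[x; y]` going from `x` to `y` in the positive direction. -/
def arc (x y : S1) : Set S1 := (fun s : ℝ => x + (s : S1)) '' Icc 0 (arcLength x y)

/-- The data `θ₋, θ₊, φ₋, φ₊` of a rectangle `[θ₋; θ₊] × [φ₋; φ₊]`. -/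
@[ext]
structure Rectangle where
  θm : S1
  θp : S1
  φm : S1
  φp : S1

namespace Rectangle

/-- The requirement that `[θ₋; θ₊] × [φ₋; φ₊]` is a genuine rectangle. -/
def IsProper (r : Rectangle) : Prop := r.θm ≠ r.θp ∧ r.φm ≠ r.φp

/-- The subset `[θ₋; θ₊] × [φ₋; φ₊]` of the torus. -/
def toSet (r : Rectangle) : Set Torus := arc r.θm r.θp ×ˢ arc r.φm r.φp

/-- The set of vertices of a rectangle. -/
def vertices (r : Rectangle) : Set Torus :=
  {(r.θm, r.φm), (r.θm, r.φp), (r.θp, r.φm), (r.θp, r.φp)}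

/-- Compatibility of two rectangles. -/
def Compatible (r₁ r₂ : Rectangle) : Prop :=
  r₁.toSet ∩ r₂.toSet = ∅ ∨
  r₁.toSet ∩ r₂.toSet ⊆ r₁.vertices ∩ r₂.vertices ∨
  ∃ r : Rectangle, r.IsProper ∧ r₁.toSet ∩ r₂.toSet = r.toSet ∧
    Disjoint r.toSet (r₁.vertices ∪ r₂.vertices)

end Rectangle

/-! ### Rectangular diagrams of (quasi-)surfaces -/

/-- `Θ(Π)`. -/
def thetaSet (P : Set Rectangle) : Set S1 := ⋃ r ∈ P, {r.θm, r.θp}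

/-- `Φ(Π)`. -/
def phiSet (P : Set Rectangle) : Set S1 := ⋃ r ∈ P, {r.φm, r.φp}

/-- A rectangular diagram of a quasi-surface. -/
structure IsQuasiSurfaceDiagram (P : Set Rectangle) : Prop where
  proper : ∀ r ∈ P, r.IsProper
  countable : P.Countable
  compatible : P.Pairwise Rectangle.Compatible
  discrete_theta : DiscreteTopology (thetaSet P)
  discrete_phi : DiscreteTopology (phiSet P)
  locallyFinite : ∀ x : S1,
    {r ∈ P | x ∈ ({r.θm, r.θp, r.φm, r.φp} : Set S1)}.Finite

/-- The boundary of a diagram: the set of all free vertices, that is, of all the points that are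
vertices of exactly one rectangle of the diagram. -/
def diagramBoundary (P : Set Rectangle) : Set Torus :=
  {v | ∃! r : Rectangle, r ∈ P ∧ v ∈ r.vertices}

/-- A rectangular diagram of a surface. -/
structure IsSurfaceDiagram (P : Set Rectangle) : Prop where
  quasi : IsQuasiSurfaceDiagram P
  boundary : IsLinkDiagram (diagramBoundary P)

/-! ### Tiles and the associated surface -/

/-- The closed planar rectangle `[0, a] × [0, b]` (inside `ℂ = ℝ²`) without its four vertices. -/
def puncturedRect (a b : ℝ) : Set ℂ :=
  {z | z.re ∈ Icc 0 a ∧ z.im ∈ Icc 0 b ∧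
    ¬ ((z.re = 0 ∨ z.re = a) ∧ (z.im = 0 ∨ z.im = b))}

/-- `h` is a bounded function on `[0, a] × [0, b]` without the four vertices, harmonic in the
interior, continuous up to the open sides, equal to `0` on the open horizontal sides and to `1`
on the open vertical sides. -/
structure IsTileHarmonic (a b : ℝ) (h : ℂ → ℝ) : Prop where
  harmonic : InnerProductSpace.HarmonicOnNhd h {z | z.re ∈ Ioo 0 a ∧ z.im ∈ Ioo 0 b}
  continuousOn : ContinuousOn h (puncturedRect a b)
  bounded : ∃ C : ℝ, ∀ z ∈ puncturedRect a b, |h z| ≤ C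
  horizontal : ∀ z : ℂ, z.re ∈ Ioo 0 a → (z.im = 0 ∨ z.im = b) → h z = 0
  vertical : ∀ z : ℂ, (z.re = 0 ∨ z.re = a) → z.im ∈ Ioo 0 b → h z = 1

/-- The harmonic function of the planar rectangle `[0, a] × [0, b]`. On `puncturedRect a b` it is
determined uniquely by the properties listed in `IsTileHarmonic`. -/
def tileHarmonic (a b : ℝ) : ℂ → ℝ := Classical.epsilon (IsTileHarmonic a b)

open Classical in
/-- `ζ(x) = (2/π) arctan √(tan (π x / 2))`, extended by continuity by `ζ(1) = 1`. -/
def zetaReal (x : ℝ) : ℝ :=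
  if x = 1 then 1 else 2 / π * Real.arctan (Real.sqrt (Real.tan (π * x / 2)))

theorem zetaReal_mem (x : ℝ) : zetaReal x ∈ unitInterval := by
  unfold zetaReal
  split_ifs with h
  · exact ⟨zero_le_one, le_refl _⟩
  · have h0 : 0 ≤ Real.arctan (Real.sqrt (Real.tan (π * x / 2))) :=
      Real.arctan_nonneg.2 (Real.sqrt_nonneg _)
    have h1 := (Real.arctan_lt_pi_div_two (Real.sqrt (Real.tan (π * x / 2)))).le
    have hpi := Real.pi_pos
    refine ⟨by positivity, ?_⟩
    calc 2 / π * Real.arctan (Real.sqrt (Real.tan (π * x / 2)))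
        ≤ 2 / π * (π / 2) := by gcongr
      _ = 1 := by field_simp

/-- `ζ` as a map to the unit interval. -/
def zeta (x : ℝ) : unitInterval := ⟨zetaReal x, zetaReal_mem x⟩

/-- The tile `r̂`: the closure in the three-sphere of the image of the graph of `ζ ∘ h_r` over the
rectangle `r` without its vertices, where the point `z = x + i y` of the planar rectangle
represents the point `(θ₋ + x, φ₋ + y)` of `r`. -/
def tile (r : Rectangle) : Set S3 :=
  closure ((fun z : ℂ => S3.mk (r.θm + ((z.re : ℝ) : S1)) (r.φm + ((z.im : ℝ) : S1))
      (zeta (tileHarmonic (arcLength r.θm r.θp) (arcLength r.φm r.φp) z))) ''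
    puncturedRect (arcLength r.θm r.θp) (arcLength r.φm r.φp))

/-- The (quasi-)surface `Π̂` associated with a diagram. -/
def hatSurface (P : Set Rectangle) : Set S3 := ⋃ r ∈ P, tile r

/-! ### Tubular neighbourhoods -/

/-- `N` is an open tubular neighbourhood of `L` bounded by `F`: the set `N` is open, `F` is its
topological boundary, and there is a topological embedding of `L × D²`, where `D²` is the closed
unit disc, that takes every `(x, 0)` to `x`, the product of `L` and the open disc onto `N`, and the
product of `L` and the boundary circle onto `F`. -/
structure IsTubularNeighborhood {X : Type*} [TopologicalSpace X] (L N F : Set X) : Prop where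
  isOpen : IsOpen N
  frontier_eq : frontier N = F
  exists_embedding : ∃ e : L × Metric.closedBall (0 : ℂ) 1 → X, IsEmbedding e ∧
    (∀ p, (p.2 : ℂ) = 0 → e p = p.1) ∧
    e '' {p | ‖(p.2 : ℂ)‖ < 1} = N ∧
    e '' {p | ‖(p.2 : ℂ)‖ = 1} = F

/-! ### The tube around a link -/

/-- The collection `Ω_t(R)` of rectangles, where `𝔳` and `𝔥` exchange the vertices in each vertical
and in each horizontal edge, respectively. -/
def tubeDiagram (R : Set Torus) (𝔳 𝔥 : R → R) (t : ℝ) : Set Rectangle :=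
  ⋃ v : R,
    { ⟨v.1.1 + (t : S1), (𝔥 v).1.1 - (t : S1), v.1.2 - (t : S1), v.1.2 + (t : S1)⟩,
      ⟨v.1.1 - (t : S1), v.1.1 + (t : S1), v.1.2 + (t : S1), (𝔳 v).1.2 - (t : S1)⟩ }

/-- `N_t(R)`: the union of the link and of the surfaces associated with `Ω_s(R)`, `0 < s < t`. -/
def tube (R : Set Torus) (𝔳 𝔥 : R → R) (t : ℝ) : Set S3 :=
  hatLink R ∪ ⋃ s ∈ Ioo 0 t, hatSurface (tubeDiagram R 𝔳 𝔥 s)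

end RectDiagram

end

open RectDiagram

/-!
A tile of `Ω_s` along a horizontal edge of length `L` is the graph of a height `edgeHeight L s x y`,
where `x` runs along the edge and `y` across it; the tiles along vertical edges are obtained by
exchanging the two circles of the join, which turns the height `τ` into `1 - τ`
(`rectHarmonic_swap`, `zetaReal_one_sub`). The tube is open and is a union of solid tori because
the tiles of different radii are nested and those around different edges stay apart. Both facts
come from comparing harmonic functions of rectangles.

The harmonic function of a rectangle is the alternating sum of the functions
`2 / π * arg (sinh (π x / b) + i sin (π y / b))` of half-strips (`rectHarmonic`). It is the only one
with the prescribed boundary values, since the logarithm is a barrier at the corners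
(`nonneg_of_nonneg_on_sides`). The same minimum principle shows that the height decreases from a
short side of the tile to the middle of the edge (`edgeHeight_strictAnti`), that it increases with
the radius (`edgeHeight_strictMono`), and that a tile along a horizontal edge passes below any tile
along a vertical edge that it crosses (`edgeHeight_crossing`).

For the embedding, every tile is cut in two at the middle of its edge, and its corners are blown up
to segments, which are the parts of the tile over its vertices. The half-tiles of all radii
`0 ≤ s ≤ t` over a half-edge form a compact set (`InTri`, `isCompact_triSet`). On it there are the
position in the join (`EdgeData.pos`) and *block coordinates* `(i, σ, z₁, z₂)`
(`EdgeData.block`): a point on the arc of the link over the vertex `i` and a point of the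
transversal disc, with `|z₁| + |z₂| = s`. Two points of half-tiles have the same position exactly
when their block coordinates are glued by `EdgeData.BlockRel`, which reflects the disc in one axis
at the end `σ = 0` of an arc and in the other axis at the end `σ = 1`
(`EdgeData.joinEq_iff_blockRel`). These reflections are removed by colouring the vertices in two
colours that alternate along the link (`exists_coloring`) and by reflecting and rotating the discs
over the vertices of one colour (`twist`), so that block coordinates become points of the product
of the link and the round disc (`EdgeData.frame_eq_iff`). Both maps are thus quotient maps of the
same compact space onto their images with the same fibres, which gives the embedding
(`EdgeData.exists_embedding`); it takes the circles of radius `s / t` to the surface of radius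
`s`.

The open tube is open because its preimage in the product of the circles and the interval is the
union of the open regions lying below the tiles of radius `t` along horizontal edges and above the
tiles along vertical ones (`EdgeData.isOpen_shell`). The closures in the definition of the tiles
produce exactly the segments over the vertices (`EdgeData.closure_image_tileGraph`). Finally, every
vertex of a rectangle of `Ω_t` belongs to one rectangle of each kind, so that the diagram has empty
boundary (`EdgeData.diagramBoundary_diagram`).
-/

noncomputable section

namespace RectDiagram

/-! ### A minimum principle on rectangles without their corners -/

/-- A harmonic function is constant near a local minimum: it is locally the real part of a
holomorphic `F`, and `‖exp (-F)‖` obeys the maximum modulus principle. -/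
theorem eventually_eq_of_isLocalMin_of_harmonicAt {u : ℂ → ℝ} {c : ℂ}
    (hu : InnerProductSpace.HarmonicAt u c) (hc : IsLocalMin u c) : ∀ᶠ y in 𝓝 c, u y = u c := by
  obtain ⟨ε, hε, hball⟩ := Metric.isOpen_iff.1
    (InnerProductSpace.isOpen_setOfPred_harmonicAt (f := u)) c hu
  obtain ⟨F, hF, hFu⟩ := InnerProductSpace.HarmonicOnNhd.exists_analyticOnNhd_ball_re_eq
    (f := u) (z := c) (R := ε) (fun y hy => hball hy)
  have hnorm : ∀ y ∈ Metric.ball c ε, ‖Complex.exp (-F y)‖ = Real.exp (-u y) := by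
    intro y hy
    have := hFu hy
    simp only at this
    rw [Complex.norm_exp, Complex.neg_re, this]
  have hmem : ∀ᶠ y in 𝓝 c, y ∈ Metric.ball c ε := Metric.ball_mem_nhds c hε
  have hd : ∀ᶠ z in 𝓝 c, DifferentiableAt ℂ (fun z => Complex.exp (-F z)) z := by
    filter_upwards [hmem] with z hz
    exact ((hF z hz).differentiableAt.neg).cexp
  have hmax : IsLocalMax (norm ∘ fun z => Complex.exp (-F z)) c := by
    filter_upwards [hmem, hc] with z hz hz'
    simp only [Function.comp_apply, hnorm z hz, hnorm c (Metric.mem_ball_self hε)]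
    exact Real.exp_le_exp.2 (neg_le_neg hz')
  filter_upwards [hmem, Complex.norm_eventually_eq_of_isLocalMax hd hmax] with z hz hz'
  rw [hnorm z hz, hnorm c (Metric.mem_ball_self hε), Real.exp_eq_exp] at hz'
  linarith

/-- The strong minimum principle. -/
theorem eqOn_of_isPreconnected_of_isMinOn_harmonic {u : ℂ → ℝ} {U : Set ℂ} {c : ℂ}
    (hU : IsPreconnected U) (ho : IsOpen U) (hu : InnerProductSpace.HarmonicOnNhd u U)
    (hc : c ∈ U) (hmin : ∀ z ∈ U, u c ≤ u z) : ∀ z ∈ U, u z = u c := by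
  have hcont : ContinuousOn u U := hu.contDiffOn.continuousOn
  have h1 : IsOpen {z | ∀ᶠ y in 𝓝 z, u y = u c} := isOpen_setOfPred_eventually_nhds
  have h2 : IsOpen (U ∩ u ⁻¹' Ioi (u c)) := hcont.isOpen_inter_preimage ho isOpen_Ioi
  have hloc : ∀ z ∈ U, u z = u c → ∀ᶠ y in 𝓝 z, u y = u c := by
    intro z hz hzc
    have := eventually_eq_of_isLocalMin_of_harmonicAt (hu z hz)
      (by filter_upwards [ho.mem_nhds hz] with y hy; rw [hzc]; exact hmin y hy)
    rwa [hzc] at this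
  have hsub := hU.subset_left_of_subset_union h1 h2 ?_ ?_ ⟨c, hc, hloc c hc rfl⟩
  · exact fun z hz => (hsub hz).self_of_nhds
  · rw [Set.disjoint_left]
    intro z hz hz'
    exact absurd hz.self_of_nhds (ne_of_gt hz'.2)
  · intro z hz
    rcases (hmin z hz).eq_or_lt with h | h
    · exact Or.inl (hloc z hz h.symm)
    · exact Or.inr ⟨hz, h⟩

/-- The open rectangle `(x₁, x₂) × (y₁, y₂)` of the complex plane. -/
def openBox (x₁ x₂ y₁ y₂ : ℝ) : Set ℂ := {z | z.re ∈ Ioo x₁ x₂ ∧ z.im ∈ Ioo y₁ y₂}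

/-- The closed rectangle `[x₁, x₂] × [y₁, y₂]` of the complex plane without its corners. -/
def puncturedBox (x₁ x₂ y₁ y₂ : ℝ) : Set ℂ :=
  {z | z.re ∈ Icc x₁ x₂ ∧ z.im ∈ Icc y₁ y₂ ∧
    ¬ ((z.re = x₁ ∨ z.re = x₂) ∧ (z.im = y₁ ∨ z.im = y₂))}

theorem isOpen_openBox (x₁ x₂ y₁ y₂ : ℝ) : IsOpen (openBox x₁ x₂ y₁ y₂) :=
  (isOpen_Ioo.preimage Complex.continuous_re).inter (isOpen_Ioo.preimage Complex.continuous_im)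

theorem isPreconnected_openBox (x₁ x₂ y₁ y₂ : ℝ) : IsPreconnected (openBox x₁ x₂ y₁ y₂) := by
  have : Convex ℝ (openBox x₁ x₂ y₁ y₂) :=
    ((convex_Ioo x₁ x₂).linear_preimage Complex.reLm).inter
      ((convex_Ioo y₁ y₂).linear_preimage Complex.imLm)
  exact this.isPreconnected

theorem openBox_subset_puncturedBox (x₁ x₂ y₁ y₂ : ℝ) :
    openBox x₁ x₂ y₁ y₂ ⊆ puncturedBox x₁ x₂ y₁ y₂ := by
  rintro z ⟨⟨h1, h2⟩, h3, h4⟩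
  refine ⟨⟨h1.le, h2.le⟩, ⟨h3.le, h4.le⟩, ?_⟩
  rintro ⟨h | h, -⟩ <;> linarith

theorem puncturedBox_subset_closure {x₁ x₂ y₁ y₂ : ℝ} (hx : x₁ < x₂) (hy : y₁ < y₂) :
    puncturedBox x₁ x₂ y₁ y₂ ⊆ closure (openBox x₁ x₂ y₁ y₂) := by
  intro z hz
  have h : openBox x₁ x₂ y₁ y₂ = Ioo x₁ x₂ ×ℂ Ioo y₁ y₂ := rfl
  rw [h, Complex.closure_reProdIm, closure_Ioo hx.ne, closure_Ioo hy.ne]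
  exact ⟨hz.1, hz.2.1⟩

/-- The barrier: `log D - log ‖z - c‖`. -/
theorem log_barrier_nonneg {D : ℝ} {z c : ℂ} (hne : z ≠ c)
    (h : ‖z - c‖ ≤ D) : 0 ≤ Real.log D - Real.log ‖z - c‖ := by
  have h0 : 0 < ‖z - c‖ := norm_pos_iff.2 (sub_ne_zero.2 hne)
  have := Real.log_le_log h0 h
  linarith

theorem harmonicAt_log_barrier {D : ℝ} {z c : ℂ} (hne : z ≠ c) :
    InnerProductSpace.HarmonicAt (fun z => Real.log D - Real.log ‖z - c‖) z := by
  have h1 : AnalyticAt ℂ (fun z : ℂ => z - c) z := analyticAt_id.sub analyticAt_const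
  have h2 := h1.harmonicAt_log_norm (sub_ne_zero.2 hne)
  have h3 : InnerProductSpace.HarmonicAt (fun _ : ℂ => Real.log D) z :=
    ⟨contDiffAt_const, by
      filter_upwards with y
      simp⟩
  exact h3.sub h2

/-- A harmonic function on an open rectangle that is bounded below, continuous up to the boundary
except at the corners, and non-negative on the open sides is non-negative. -/
theorem nonneg_of_nonneg_on_sides {x₁ x₂ y₁ y₂ : ℝ} (hx : x₁ < x₂) (hy : y₁ < y₂) {u : ℂ → ℝ}
    (hu : InnerProductSpace.HarmonicOnNhd u (openBox x₁ x₂ y₁ y₂))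
    (hc : ContinuousOn u (puncturedBox x₁ x₂ y₁ y₂))
    {C : ℝ} (hC : ∀ z ∈ puncturedBox x₁ x₂ y₁ y₂, -C ≤ u z)
    (hs : ∀ z ∈ puncturedBox x₁ x₂ y₁ y₂,
      (z.re = x₁ ∨ z.re = x₂ ∨ z.im = y₁ ∨ z.im = y₂) → 0 ≤ u z) :
    ∀ z ∈ puncturedBox x₁ x₂ y₁ y₂, 0 ≤ u z := by
  set P := puncturedBox x₁ x₂ y₁ y₂ with hP
  set D : ℝ := (x₂ - x₁) + (y₂ - y₁) with hD
  have hDpos : 0 < D := by rw [hD]; linarith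
  let corners : Finset ℂ := {⟨x₁, y₁⟩, ⟨x₁, y₂⟩, ⟨x₂, y₁⟩, ⟨x₂, y₂⟩}
  have hcorn : ∀ c ∈ corners, (c.re = x₁ ∨ c.re = x₂) ∧ (c.im = y₁ ∨ c.im = y₂) := by
    intro c hc
    simp only [corners, Finset.mem_insert, Finset.mem_singleton] at hc
    rcases hc with rfl | rfl | rfl | rfl <;> simp
  have hcorn' : ∀ z : ℂ, (z.re = x₁ ∨ z.re = x₂) → (z.im = y₁ ∨ z.im = y₂) → z ∈ corners := by
    intro z h1 h2
    simp only [corners, Finset.mem_insert, Finset.mem_singleton, Complex.ext_iff]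
    tauto
  have hne : ∀ z ∈ P, ∀ c ∈ corners, z ≠ c := by
    rintro z hz c hc rfl
    exact hz.2.2 (hcorn z hc)
  have hdist : ∀ z ∈ P, ∀ c ∈ corners, ‖z - c‖ ≤ D := by
    intro z hz c hc
    refine (Complex.norm_le_abs_re_add_abs_im _).trans (add_le_add ?_ ?_)
    · rw [Complex.sub_re, abs_le]
      rcases (hcorn c hc).1 with h | h <;> rw [h] <;> constructor <;> linarith [hz.1.1, hz.1.2]
    · rw [Complex.sub_im, abs_le]
      rcases (hcorn c hc).2 with h | h <;> rw [h] <;> constructor <;> linarith [hz.2.1.1, hz.2.1.2]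
  let B : ℂ → ℝ := fun z => ∑ c ∈ corners, (Real.log D - Real.log ‖z - c‖)
  have hB0 : ∀ z ∈ P, 0 ≤ B z := fun z hz => Finset.sum_nonneg fun c hc =>
    log_barrier_nonneg (hne z hz c hc) (hdist z hz c hc)
  have hC0 : -|C| ≤ -C := neg_le_neg (le_abs_self C)
  have key : ∀ ε > 0, ∀ z ∈ P, 0 ≤ u z + ε * B z := by
    intro ε hε
    set w : ℂ → ℝ := fun z => u z + ε * B z with hw
    set δ : ℝ := D * Real.exp (-(|C| + 1) / ε) with hδ
    have hδpos : 0 < δ := by positivity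
    -- the barrier dominates the lower bound `-C` near the corners
    have hnear : ∀ z ∈ P, ∀ c ∈ corners, ‖z - c‖ < δ → 0 < w z := by
      intro z hz c hc hlt
      have h0 : 0 < ‖z - c‖ := norm_pos_iff.2 (sub_ne_zero.2 (hne z hz c hc))
      have h1 : Real.log ‖z - c‖ < Real.log D + -(|C| + 1) / ε := by
        have := Real.log_lt_log h0 hlt
        rwa [hδ, Real.log_mul hDpos.ne' (Real.exp_pos _).ne', Real.log_exp] at this
      have h2 : Real.log D - Real.log ‖z - c‖ ≤ B z :=
        Finset.single_le_sum (f := fun c => Real.log D - Real.log ‖z - c‖)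
          (fun c hc => log_barrier_nonneg (hne z hz c hc) (hdist z hz c hc)) hc
      have h3 : ε * ((|C| + 1) / ε) = |C| + 1 := by field_simp
      have h4 : (|C| + 1) / ε < B z := by rw [neg_div] at h1; linarith
      have h5 := mul_lt_mul_of_pos_left h4 hε
      have := hC z hz
      simp only [hw]
      linarith
    have hwc : ContinuousOn w P := by
      refine hc.add (continuousOn_const.mul (continuousOn_finsetSum _ fun c hc => ?_))
      refine continuousOn_const.sub (ContinuousOn.log (by fun_prop) ?_)
      exact fun z hz => (norm_pos_iff.2 (sub_ne_zero.2 (hne z hz c hc))).ne'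
    have hBh : InnerProductSpace.HarmonicOnNhd B (openBox x₁ x₂ y₁ y₂) := by
      intro z hz
      have hz' := openBox_subset_puncturedBox _ _ _ _ hz
      have : ∀ s ⊆ corners, InnerProductSpace.HarmonicAt
          (fun z => ∑ c ∈ s, (Real.log D - Real.log ‖z - c‖)) z := by
        intro s
        induction s using Finset.induction_on with
        | empty =>
          intro _
          simp only [Finset.sum_empty]
          exact ⟨contDiffAt_const, by filter_upwards with y; simp⟩
        | insert c s hcs ih =>
          intro hsub
          simp only [Finset.sum_insert hcs]
          exact (harmonicAt_log_barrier (hne z hz' c (hsub (Finset.mem_insert_self _ _)))).add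
            (ih fun x hx => hsub (Finset.mem_insert_of_mem hx))
      exact this corners subset_rfl
    have hwh : InnerProductSpace.HarmonicOnNhd w (openBox x₁ x₂ y₁ y₂) := by
      intro z hz
      exact (hu z hz).add ((hBh z hz).const_smul (c := ε))
    by_contra! hneg
    obtain ⟨z₁, hz₁, hwz₁⟩ := hneg
    let K : Set ℂ := (Icc x₁ x₂ ×ℂ Icc y₁ y₂) ∩ ⋂ c ∈ corners, {z | δ ≤ ‖z - c‖}
    have hKP : K ⊆ P := by
      rintro z ⟨⟨h1, h2⟩, h3⟩
      refine ⟨h1, h2, fun h => ?_⟩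
      have := mem_iInter₂.1 h3 z (hcorn' z h.1 h.2)
      simp only [mem_ofPred_eq, sub_self, norm_zero] at this
      linarith
    have hKc : IsCompact K := by
      refine (isCompact_Icc.reProdIm isCompact_Icc).inter_right ?_
      exact isClosed_biInter fun c _ => isClosed_le (by fun_prop) (by fun_prop)
    have hPK : ∀ z ∈ P, w z ≤ 0 → z ∈ K := by
      intro z hz hwz
      refine ⟨⟨hz.1, hz.2.1⟩, mem_iInter₂.2 fun c hc => ?_⟩
      by_contra hlt
      exact absurd (hnear z hz c hc (not_le.1 hlt)) (not_lt.2 hwz)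
    obtain ⟨z₀, hz₀, hmin⟩ := hKc.exists_isMinOn ⟨z₁, hPK z₁ hz₁ hwz₁.le⟩ (hwc.mono hKP)
    have hwz₀ : w z₀ < 0 := lt_of_le_of_lt (hmin (hPK z₁ hz₁ hwz₁.le)) hwz₁
    have hz₀P := hKP hz₀
    have hz₀o : z₀ ∈ openBox x₁ x₂ y₁ y₂ := by
      by_contra hno
      have : z₀.re = x₁ ∨ z₀.re = x₂ ∨ z₀.im = y₁ ∨ z₀.im = y₂ := by
        by_contra! hcon
        exact hno ⟨⟨lt_of_le_of_ne hz₀P.1.1 hcon.1.symm, lt_of_le_of_ne hz₀P.1.2 hcon.2.1⟩,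
          lt_of_le_of_ne hz₀P.2.1.1 hcon.2.2.1.symm, lt_of_le_of_ne hz₀P.2.1.2 hcon.2.2.2⟩
      have h1 := hs z₀ hz₀P this
      have h2 := mul_nonneg hε.le (hB0 z₀ hz₀P)
      simp only [hw] at hwz₀
      linarith
    have hconst := eqOn_of_isPreconnected_of_isMinOn_harmonic
      (isPreconnected_openBox _ _ _ _) (isOpen_openBox _ _ _ _) hwh hz₀o (by
        intro z hz
        by_cases h : w z ≤ 0
        · exact hmin (hPK z (openBox_subset_puncturedBox _ _ _ _ hz) h)
        · linarith)
    -- a point of the open rectangle close to a corner contradicts constancy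
    set η : ℝ := min (δ / 4) (min ((x₂ - x₁) / 2) ((y₂ - y₁) / 2)) with hη
    have hη0 : 0 < η := by
      rw [hη]; exact lt_min (by linarith) (lt_min (by linarith) (by linarith))
    have hη1 : η ≤ δ / 4 := min_le_left _ _
    have hη2 : η ≤ (x₂ - x₁) / 2 := (min_le_right _ _).trans (min_le_left _ _)
    have hη3 : η ≤ (y₂ - y₁) / 2 := (min_le_right _ _).trans (min_le_right _ _)
    have hzo : (⟨x₁ + η, y₁ + η⟩ : ℂ) ∈ openBox x₁ x₂ y₁ y₂ :=
      ⟨⟨by simp only; linarith, by simp only; linarith⟩,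
        ⟨by simp only; linarith, by simp only; linarith⟩⟩
    have h1 := hconst _ hzo
    have h2 := hnear _ (openBox_subset_puncturedBox _ _ _ _ hzo) ⟨x₁, y₁⟩
      (hcorn' _ (Or.inl rfl) (Or.inl rfl)) (by
        refine lt_of_le_of_lt (Complex.norm_le_abs_re_add_abs_im _) ?_
        simp only [Complex.sub_re, Complex.sub_im, add_sub_cancel_left, abs_of_pos hη0]
        linarith)
    linarith
  intro z hz
  by_contra! hneg
  have hB1 : 0 < B z + 1 := by linarith [hB0 z hz]
  have h1 := key (-u z / (2 * (B z + 1))) (by apply div_pos <;> linarith) z hz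
  have h2 : -u z / (2 * (B z + 1)) * B z ≤ -u z / 2 := by
    rw [div_mul_eq_mul_div, div_le_div_iff₀ (by linarith) (by norm_num)]
    nlinarith [hB0 z hz]
  linarith

/-- If, moreover, the function is positive somewhere, it is positive on the open rectangle. -/
theorem pos_of_nonneg_on_sides {x₁ x₂ y₁ y₂ : ℝ} (hx : x₁ < x₂) (hy : y₁ < y₂) {u : ℂ → ℝ}
    (hu : InnerProductSpace.HarmonicOnNhd u (openBox x₁ x₂ y₁ y₂))
    (hc : ContinuousOn u (puncturedBox x₁ x₂ y₁ y₂))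
    {C : ℝ} (hC : ∀ z ∈ puncturedBox x₁ x₂ y₁ y₂, -C ≤ u z)
    (hs : ∀ z ∈ puncturedBox x₁ x₂ y₁ y₂,
      (z.re = x₁ ∨ z.re = x₂ ∨ z.im = y₁ ∨ z.im = y₂) → 0 ≤ u z)
    (hp : ∃ z ∈ puncturedBox x₁ x₂ y₁ y₂, 0 < u z) :
    ∀ z ∈ openBox x₁ x₂ y₁ y₂, 0 < u z := by
  have h0 := nonneg_of_nonneg_on_sides hx hy hu hc hC hs
  have hsub := openBox_subset_puncturedBox x₁ x₂ y₁ y₂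
  intro z hz
  by_contra! hle
  have hz0 : u z = 0 := le_antisymm hle (h0 z (hsub hz))
  have hconst := eqOn_of_isPreconnected_of_isMinOn_harmonic
    (isPreconnected_openBox _ _ _ _) (isOpen_openBox _ _ _ _) hu hz
    (fun y hy => by rw [hz0]; exact h0 y (hsub hy))
  obtain ⟨y, hyP, hy0⟩ := hp
  have hEq : EqOn u (fun _ => 0) (puncturedBox x₁ x₂ y₁ y₂) :=
    Set.EqOn.of_subset_closure (s := openBox x₁ x₂ y₁ y₂)
      (fun y hy => (hconst y hy).trans hz0) hc continuousOn_const hsub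
      (puncturedBox_subset_closure hx hy)
  have := hEq hyP
  simp only at this
  linarith

/-- Two tile functions of the same planar rectangle agree off the corners. -/
theorem IsTileHarmonic.eqOn {a b : ℝ} (ha : 0 < a) (hb : 0 < b) {f g : ℂ → ℝ}
    (hf : IsTileHarmonic a b f) (hg : IsTileHarmonic a b g) : EqOn f g (puncturedRect a b) := by
  have key : ∀ f g : ℂ → ℝ, IsTileHarmonic a b f → IsTileHarmonic a b g →
      ∀ z ∈ puncturedRect a b, 0 ≤ f z - g z := by
    intro f g hf hg
    obtain ⟨C₁, h₁⟩ := hf.bounded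
    obtain ⟨C₂, h₂⟩ := hg.bounded
    refine nonneg_of_nonneg_on_sides (C := C₁ + C₂) ha hb (hf.harmonic.sub hg.harmonic)
      (hf.continuousOn.sub hg.continuousOn) ?_ ?_
    · intro z hz
      have h3 := abs_le.1 (h₁ z hz)
      have h4 := abs_le.1 (h₂ z hz)
      change -(C₁ + C₂) ≤ f z - g z
      linarith [h3.1, h4.2]
    · intro z hz hside
      have : f z = g z := by
        by_cases hre : z.re = 0 ∨ z.re = a
        · have him : ¬ (z.im = 0 ∨ z.im = b) := fun h => hz.2.2 ⟨hre, h⟩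
          push Not at him
          have him' : z.im ∈ Ioo 0 b :=
            ⟨lt_of_le_of_ne hz.2.1.1 him.1.symm, lt_of_le_of_ne hz.2.1.2 him.2⟩
          rw [hf.vertical z hre him', hg.vertical z hre him']
        · have him : z.im = 0 ∨ z.im = b := by tauto
          push Not at hre
          have hre' : z.re ∈ Ioo 0 a :=
            ⟨lt_of_le_of_ne hz.1.1 hre.1.symm, lt_of_le_of_ne hz.1.2 hre.2⟩
          rw [hf.horizontal z hre' him, hg.horizontal z hre' him]
      simp [this]
  intro z hz
  have h1 := key f g hf hg z hz
  have h2 := key g f hg hf z hz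
  linarith

/-! ### Harmonicity under changes of the variable -/

theorem harmonicAt_comp_analyticAt {u : ℂ → ℝ} {f : ℂ → ℂ} {z : ℂ}
    (hu : InnerProductSpace.HarmonicAt u (f z)) (hf : AnalyticAt ℂ f z) :
    InnerProductSpace.HarmonicAt (fun w => u (f w)) z := by
  obtain ⟨ε, hε, hball⟩ := Metric.isOpen_iff.1
    (InnerProductSpace.isOpen_setOfPred_harmonicAt (f := u)) (f z) hu
  obtain ⟨F, hF, hFu⟩ := InnerProductSpace.HarmonicOnNhd.exists_analyticOnNhd_ball_re_eq
    (f := u) (z := f z) (R := ε) (fun y hy => hball hy)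
  have h1 : AnalyticAt ℂ (fun w => F (f w)) z :=
    AnalyticAt.comp (hF _ (Metric.mem_ball_self hε)) hf
  refine (InnerProductSpace.harmonicAt_congr_nhds ?_).1 h1.harmonicAt_re
  filter_upwards [hf.continuousAt (Metric.ball_mem_nhds _ hε)] with w hw
  exact hFu hw

theorem harmonicAt_comp_conj {u : ℂ → ℝ} {z : ℂ}
    (hu : InnerProductSpace.HarmonicAt u (starRingEnd ℂ z)) :
    InnerProductSpace.HarmonicAt (fun w => u (starRingEnd ℂ w)) z := by
  obtain ⟨ε, hε, hball⟩ := Metric.isOpen_iff.1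
    (InnerProductSpace.isOpen_setOfPred_harmonicAt (f := u)) _ hu
  obtain ⟨F, hF, hFu⟩ := InnerProductSpace.HarmonicOnNhd.exists_analyticOnNhd_ball_re_eq
    (f := u) (R := ε) (fun y hy => hball hy)
  have hmem : ∀ᶠ w in 𝓝 z, starRingEnd ℂ w ∈ Metric.ball (starRingEnd ℂ z) ε :=
    Complex.continuous_conj.continuousAt (Metric.ball_mem_nhds _ hε)
  have h1 : AnalyticAt ℂ (fun w => starRingEnd ℂ (F (starRingEnd ℂ w))) z := by
    rw [Complex.analyticAt_iff_eventually_differentiableAt]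
    filter_upwards [hmem] with w hw
    have := (hF _ hw).differentiableAt.conj_conj
    rwa [Complex.conj_conj] at this
  refine (InnerProductSpace.harmonicAt_congr_nhds ?_).1 h1.harmonicAt_re
  filter_upwards [hmem] with w hw
  simpa using hFu hw

/-- Exchanging the real and the imaginary coordinate preserves harmonicity. -/
theorem harmonicAt_comp_swap {u : ℂ → ℝ} {z : ℂ}
    (hu : InnerProductSpace.HarmonicAt u ⟨z.im, z.re⟩) :
    InnerProductSpace.HarmonicAt (fun w : ℂ => u ⟨w.im, w.re⟩) z := by
  have e : ∀ w : ℂ, (⟨w.im, w.re⟩ : ℂ) = starRingEnd ℂ (-Complex.I * w) := by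
    intro w
    apply Complex.ext <;> simp
  simp only [e] at hu ⊢
  exact harmonicAt_comp_analyticAt (u := fun w => u (starRingEnd ℂ w))
    (f := fun w => -Complex.I * w) (harmonicAt_comp_conj hu) (by fun_prop)

/-! ### The harmonic function of a half-strip -/

/-- The bounded harmonic function of the half-strip `0 ≤ x`, `0 ≤ y ≤ b` that is `0` on the
horizontal sides and `1` on the vertical one. For `b = 0` its value is `0`. -/
def halfStrip (b x y : ℝ) : ℝ :=
  2 / π * Complex.arg ⟨Real.sinh (π * x / b), Real.sin (π * y / b)⟩

/-- The holomorphic function `log tanh (w / 2)`, whose imaginary part is the harmonic function of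
the half-strip of width `π`. -/
def stripLog (w : ℂ) : ℂ := Complex.log (1 - Complex.exp (-w)) - Complex.log (1 + Complex.exp (-w))

theorem norm_exp_neg_lt_one {w : ℂ} (hw : 0 < w.re) : ‖Complex.exp (-w)‖ < 1 := by
  rw [Complex.norm_exp, Complex.neg_re, Real.exp_lt_one_iff]
  linarith

theorem re_one_add_pos {q : ℂ} (hq : ‖q‖ < 1) : 0 < (1 + q).re := by
  have := (abs_le.1 (Complex.abs_re_le_norm q)).1
  simp only [Complex.add_re, Complex.one_re]
  linarith

/-- The quotient `(1 - q) / (1 + q)`, where `q = exp (-w)`, is a positive multiple of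
`sinh (re w) + i sin (im w)`. -/
theorem im_stripLog {w : ℂ} (hw : 0 < w.re) :
    (stripLog w).im = Complex.arg ⟨Real.sinh w.re, Real.sin w.im⟩ := by
  set q := Complex.exp (-w) with hq
  have hqn : ‖q‖ < 1 := norm_exp_neg_lt_one hw
  have hv : 0 < (1 + q).re := re_one_add_pos hqn
  have hu : 0 < (1 - q).re := by
    rw [sub_eq_add_neg]; exact re_one_add_pos (by rwa [norm_neg])
  have hv0 : (1 + q) ≠ 0 := fun h => by rw [h] at hv; simp at hv
  have hu0 : (1 - q) ≠ 0 := fun h => by rw [h] at hu; simp at hu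
  have hN : 0 < Complex.normSq (1 + q) := Complex.normSq_pos.2 hv0
  set r : ℝ := 2 * Real.exp (-w.re) / Complex.normSq (1 + q) with hr
  have hrpos : 0 < r := by positivity
  have hqre : q.re = Real.exp (-w.re) * Real.cos w.im := by
    rw [hq, Complex.exp_re]; simp
  have hqim : q.im = -(Real.exp (-w.re) * Real.sin w.im) := by
    rw [hq, Complex.exp_im]; simp
  have hdiv : (1 - q) / (1 + q) = (r : ℂ) * ⟨Real.sinh w.re, Real.sin w.im⟩ := by
    have hee : Real.exp (-w.re) * Real.exp w.re = 1 := by rw [← Real.exp_add]; simp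
    have hcs := Real.sin_sq_add_cos_sq w.im
    have e1 : r * Complex.normSq (1 + q) = 2 * Real.exp (-w.re) := by
      rw [hr]; field_simp
    rw [div_eq_iff hv0]
    have hNq : Complex.normSq (1 + q) = (1 + q.re) * (1 + q.re) + q.im * q.im := by
      rw [Complex.normSq_apply]; simp
    rw [Complex.ext_iff]
    have key : ∀ x y : ℝ, (1 + q.re) * x = (1 + q.re) * y → x = y := by
      intro x y h
      exact mul_left_cancel₀ (by simpa using hv.ne') h
    have hmul : (1 - q) * (starRingEnd ℂ (1 + q)) =
        (2 * Real.exp (-w.re) : ℝ) * (⟨Real.sinh w.re, Real.sin w.im⟩ : ℂ) := by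
      apply Complex.ext
      · simp only [Complex.mul_re, Complex.sub_re, Complex.one_re, map_add, map_one,
          Complex.add_re, Complex.conj_re, Complex.sub_im, Complex.one_im, Complex.add_im,
          Complex.conj_im, Complex.ofReal_re, Complex.ofReal_im, hqre, hqim, Real.sinh_eq]
        linear_combination -(Real.exp (-w.re))^2 * hcs - hee
      · simp only [Complex.mul_im, Complex.sub_re, Complex.one_re, map_add, map_one,
          Complex.add_re, Complex.conj_re, Complex.sub_im, Complex.one_im, Complex.add_im,
          Complex.conj_im, Complex.ofReal_re, Complex.ofReal_im, hqre, hqim]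
        ring
    rw [← Complex.ext_iff]
    have hcj : starRingEnd ℂ (1 + q) ≠ 0 := by
      rwa [Ne, map_eq_zero]
    apply mul_right_cancel₀ hcj
    rw [hmul, mul_assoc, Complex.mul_conj, ← e1]
    push_cast
    ring
  have hdre : 0 < ((1 - q) / (1 + q)).re := by
    rw [hdiv, Complex.re_ofReal_mul]
    exact mul_pos hrpos (Real.sinh_pos_iff.2 hw)
  have hlog : Complex.log (1 - q) = Complex.log ((1 - q) / (1 + q)) + Complex.log (1 + q) := by
    have h1 := abs_lt.1 (Complex.abs_arg_lt_pi_div_two_iff.2 (Or.inl hdre))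
    have h2 := abs_lt.1 (Complex.abs_arg_lt_pi_div_two_iff.2 (Or.inl hv))
    have := (Complex.log_mul_eq_add_log_iff (div_ne_zero hu0 hv0) hv0).2
      ⟨by linarith [h1.1, h2.1], by linarith [h1.2, h2.2]⟩
    rwa [div_mul_cancel₀ _ hv0] at this
  rw [stripLog, ← hq, hlog, add_sub_cancel_right, Complex.log_im, hdiv,
    Complex.arg_real_mul _ hrpos]

theorem norm_log_one_add_le_of_le {z : ℂ} {q : ℝ} (hz : ‖z‖ ≤ q) (hq : q < 1) :
    ‖Complex.log (1 + z)‖ ≤ ‖z‖ / (1 - q) := by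
  have h1 := Complex.norm_log_one_add_le (lt_of_le_of_lt hz hq)
  have h0 := norm_nonneg z
  have h2 : ‖z‖ ^ 2 * (1 - ‖z‖)⁻¹ / 2 + ‖z‖ ≤ ‖z‖ * (1 - ‖z‖)⁻¹ := by
    have h3 : 0 < 1 - ‖z‖ := by linarith
    have h4 : ‖z‖ = ‖z‖ * (1 - ‖z‖) * (1 - ‖z‖)⁻¹ := by field_simp
    have h5 : 0 < (1 - ‖z‖)⁻¹ := inv_pos.2 h3
    nlinarith [mul_nonneg (sq_nonneg ‖z‖) h5.le]
  have h6 : (1 - ‖z‖)⁻¹ ≤ (1 - q)⁻¹ := by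
    apply inv_anti₀ <;> linarith
  calc _ ≤ _ := h1
    _ ≤ _ := h2
    _ ≤ ‖z‖ * (1 - q)⁻¹ := by gcongr
    _ = _ := by rw [div_eq_mul_inv]

theorem norm_stripLog_le {w : ℂ} {q : ℝ} (hw : Real.exp (-w.re) ≤ q) (hq : q < 1) :
    ‖stripLog w‖ ≤ 2 / (1 - q) * Real.exp (-w.re) := by
  have hn : ‖Complex.exp (-w)‖ = Real.exp (-w.re) := by rw [Complex.norm_exp, Complex.neg_re]
  have h1 := norm_log_one_add_le_of_le (z := Complex.exp (-w)) (hn.le.trans hw) hq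
  have h2 := norm_log_one_add_le_of_le (z := -Complex.exp (-w))
    (by rw [norm_neg]; exact hn.le.trans hw) hq
  rw [norm_neg, ← sub_eq_add_neg] at h2
  refine (norm_sub_le _ _).trans ((add_le_add h2 h1).trans (le_of_eq ?_))
  rw [hn]; ring

theorem differentiableAt_stripLog {w : ℂ} (hw : 0 < w.re) : DifferentiableAt ℂ stripLog w := by
  have hqn := norm_exp_neg_lt_one hw
  have hv : 0 < (1 + Complex.exp (-w)).re := re_one_add_pos hqn
  have hu : 0 < (1 - Complex.exp (-w)).re := by
    rw [sub_eq_add_neg]; exact re_one_add_pos (by rwa [norm_neg])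
  unfold stripLog
  exact DifferentiableAt.fun_sub
    (DifferentiableAt.clog (f := fun w => 1 - Complex.exp (-w)) (by fun_prop) (Or.inl hu))
    (DifferentiableAt.clog (f := fun w => 1 + Complex.exp (-w)) (by fun_prop) (Or.inl hv))

theorem halfStrip_eq_im {b x y : ℝ} (hb : 0 < b) (hx : 0 < x) :
    halfStrip b x y = 2 / π * (stripLog ⟨π * x / b, π * y / b⟩).im := by
  rw [im_stripLog (by simp only; positivity)]
  rfl

/-- The half-strip function at the conjugate point, used for the reflected half-strips. -/
theorem halfStrip_eq_neg_im {b x y : ℝ} (hb : 0 < b) (hx : 0 < x) :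
    halfStrip b x y = 2 / π * -(stripLog ⟨π * x / b, -(π * y / b)⟩).im := by
  have hpos : 0 < π * x / b := by positivity
  rw [im_stripLog (by simpa only), halfStrip]
  congr 1
  have h1 : (⟨Real.sinh (π * x / b), Real.sin (-(π * y / b))⟩ : ℂ) =
      starRingEnd ℂ ⟨Real.sinh (π * x / b), Real.sin (π * y / b)⟩ := by
    apply Complex.ext <;> simp
  have hsinh := Real.sinh_pos_iff.2 hpos
  simp only [h1, Complex.arg_conj]
  rw [if_neg, neg_neg]
  rw [Complex.arg_eq_pi_iff]
  intro h
  have := h.1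
  simp only at this
  linarith

theorem halfStrip_zero (x y : ℝ) : halfStrip 0 x y = 0 := by
  simp only [halfStrip, div_zero, Real.sinh_zero, Real.sin_zero]
  rw [show (⟨0, 0⟩ : ℂ) = 0 from rfl, Complex.arg_zero, mul_zero]

theorem abs_halfStrip_le {b x y q : ℝ} (hb : 0 ≤ b) (hx : 0 < x) (hq : q < 1)
    (h : b ≠ 0 → Real.exp (-(π * x / b)) ≤ q) :
    |halfStrip b x y| ≤ 2 / π * (2 / (1 - q)) * Real.exp (-(π * x / b)) := by
  have hpi := Real.pi_pos
  rcases hb.eq_or_lt with rfl | hb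
  · have : 0 < 1 - q := by linarith
    rw [halfStrip_zero, abs_zero]
    positivity
  · rw [halfStrip_eq_im hb hx, abs_mul, abs_of_pos (by positivity : 0 < 2 / π), mul_assoc]
    gcongr
    exact (Complex.abs_im_le_norm _).trans
      (norm_stripLog_le (w := ⟨π * x / b, π * y / b⟩) (h hb.ne') hq)

theorem abs_halfStrip_le_one {b x y : ℝ} (hb : 0 ≤ b) (hx : 0 ≤ x) : |halfStrip b x y| ≤ 1 := by
  have hpi := Real.pi_pos
  rw [halfStrip, abs_mul, abs_of_pos (by positivity : 0 < 2 / π)]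
  have : |Complex.arg ⟨Real.sinh (π * x / b), Real.sin (π * y / b)⟩| ≤ π / 2 := by
    rw [Complex.abs_arg_le_pi_div_two_iff]
    exact Real.sinh_nonneg_iff.2 (by positivity)
  calc _ ≤ 2 / π * (π / 2) := by gcongr
    _ = 1 := by field_simp

theorem halfStrip_of_sin_eq_zero {b x y : ℝ} (hb : 0 ≤ b) (hx : 0 ≤ x)
    (hy : Real.sin (π * y / b) = 0) : halfStrip b x y = 0 := by
  have hpi := Real.pi_pos
  have h : 0 ≤ Real.sinh (π * x / b) := Real.sinh_nonneg_iff.2 (by positivity)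
  rw [halfStrip, hy]
  have : (⟨Real.sinh (π * x / b), 0⟩ : ℂ) = ((Real.sinh (π * x / b) : ℝ) : ℂ) := rfl
  rw [this, Complex.arg_ofReal_of_nonneg h, mul_zero]

theorem sin_pos_of_mem_Ioo {b y : ℝ} (hy : y ∈ Ioo 0 b) : 0 < Real.sin (π * y / b) := by
  have hpi := Real.pi_pos
  have hb : 0 < b := hy.1.trans hy.2
  have hy0 := hy.1
  apply Real.sin_pos_of_pos_of_lt_pi
  · positivity
  · rw [div_lt_iff₀ hb]
    exact mul_lt_mul_of_pos_left hy.2 hpi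

theorem halfStrip_vertical {b y : ℝ} (hy : y ∈ Ioo 0 b) : halfStrip b 0 y = 1 := by
  have hpi := Real.pi_pos
  rw [halfStrip]
  simp only [mul_zero, zero_div, Real.sinh_zero]
  have h : Complex.arg ⟨0, Real.sin (π * y / b)⟩ = π / 2 :=
    Complex.arg_eq_pi_div_two_iff.2 ⟨rfl, sin_pos_of_mem_Ioo hy⟩
  rw [h]
  field_simp

/-- Joint continuity in the width of the half-strip and the point, down to width `0`. -/
theorem continuousOn_halfStrip :
    ContinuousOn (fun p : ℝ × ℝ × ℝ => halfStrip p.1 p.2.1 p.2.2)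
      {p | 0 ≤ p.1 ∧ 0 ≤ p.2.1 ∧ p.2.2 ∈ Icc 0 p.1 ∧
        ¬ (p.2.1 = 0 ∧ (p.2.2 = 0 ∨ p.2.2 = p.1))} := by
  have hpi := Real.pi_pos
  rintro ⟨b, x, y⟩ ⟨hb, hx, hy, hne⟩
  simp only at hb hx hy hne
  rcases hb.eq_or_lt with rfl | hb
  · have hy0 : y = 0 := le_antisymm hy.2 hy.1
    have hx0 : 0 < x := by
      rcases hx.eq_or_lt with h | h
      · exact absurd ⟨h.symm, Or.inl hy0⟩ hne
      · exact h
    rw [ContinuousWithinAt]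
    simp only [halfStrip_zero]
    refine squeeze_zero_norm' (a := fun p : ℝ × ℝ × ℝ => 2 / π * (2 / (1 - 1 / 2)) *
      (2 / (π * x) * p.1)) ?_ ?_
    · have e1 : ∀ᶠ p : ℝ × ℝ × ℝ in 𝓝 (0, x, y), x / 2 < p.2.1 :=
        ContinuousAt.eventually_lt (by fun_prop) (by fun_prop) (by simp only; linarith)
      have e2 : ∀ᶠ p : ℝ × ℝ × ℝ in 𝓝 (0, x, y), p.1 < π * x / 2 :=
        ContinuousAt.eventually_lt (by fun_prop) (by fun_prop) (by simp only; positivity)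
      filter_upwards [nhdsWithin_le_nhds e1, nhdsWithin_le_nhds e2, self_mem_nhdsWithin]
        with p h1 h2 h3
      have hp0 : 0 ≤ p.1 := h3.1
      rcases hp0.eq_or_lt with h0 | h0
      · rw [← h0, halfStrip_zero]; simp
      · have hu : 0 < π * p.2.1 / p.1 := by
          have : 0 < p.2.1 := by linarith
          positivity
        have hu1 : 1 ≤ π * p.2.1 / p.1 := by
          rw [le_div_iff₀ h0]
          nlinarith
        have hexp : Real.exp (-(π * p.2.1 / p.1)) ≤ (π * p.2.1 / p.1 + 1)⁻¹ := by
          rw [Real.exp_neg]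
          exact inv_anti₀ (by linarith) (Real.add_one_le_exp _)
        have hhalf : Real.exp (-(π * p.2.1 / p.1)) ≤ 1 / 2 := by
          refine hexp.trans ?_
          rw [one_div]
          exact inv_anti₀ (by norm_num) (by linarith)
        have hlin : Real.exp (-(π * p.2.1 / p.1)) ≤ 2 / (π * x) * p.1 := by
          refine hexp.trans ((inv_anti₀ hu (by linarith)).trans ?_)
          rw [inv_div, div_mul_eq_mul_div, div_le_div_iff₀ (by nlinarith) (by positivity)]
          nlinarith [mul_pos hpi h0]
        rw [Real.norm_eq_abs]
        refine (abs_halfStrip_le hp0 (by linarith) (by norm_num) fun _ => hhalf).trans ?_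
        gcongr
    · refine tendsto_nhdsWithin_of_tendsto_nhds ?_
      have : ContinuousAt (fun p : ℝ × ℝ × ℝ => 2 / π * (2 / (1 - 1 / 2)) *
        (2 / (π * x) * p.1)) (0, x, y) := by fun_prop
      simpa [ContinuousAt] using this
  · apply ContinuousAt.continuousWithinAt
    have hslit : (⟨Real.sinh (π * x / b), Real.sin (π * y / b)⟩ : ℂ) ∈ Complex.slitPlane := by
      rcases hx.eq_or_lt with rfl | hx
      · right
        have : y ∈ Ioo 0 b := ⟨lt_of_le_of_ne hy.1 fun h => hne ⟨rfl, Or.inl h.symm⟩,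
          lt_of_le_of_ne hy.2 fun h => hne ⟨rfl, Or.inr h⟩⟩
        exact (sin_pos_of_mem_Ioo this).ne'
      · left
        exact Real.sinh_pos_iff.2 (by positivity)
    have hin : ContinuousAt (fun p : ℝ × ℝ × ℝ =>
        (⟨Real.sinh (π * p.2.1 / p.1), Real.sin (π * p.2.2 / p.1)⟩ : ℂ)) (b, x, y) := by
      have e : (fun p : ℝ × ℝ × ℝ =>
        (⟨Real.sinh (π * p.2.1 / p.1), Real.sin (π * p.2.2 / p.1)⟩ : ℂ)) = fun p =>
          ((Real.sinh (π * p.2.1 / p.1) : ℝ) : ℂ) + ((Real.sin (π * p.2.2 / p.1) : ℝ) : ℂ) *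
            Complex.I := by
        funext p; exact Complex.mk_eq_add_mul_I _ _
      rw [e]
      have d1 : ContinuousAt (fun p : ℝ × ℝ × ℝ => π * p.2.1 / p.1) (b, x, y) :=
        ContinuousAt.div (by fun_prop) (by fun_prop) hb.ne'
      have d2 : ContinuousAt (fun p : ℝ × ℝ × ℝ => π * p.2.2 / p.1) (b, x, y) :=
        ContinuousAt.div (by fun_prop) (by fun_prop) hb.ne'
      refine ContinuousAt.add ?_ (ContinuousAt.mul ?_ continuousAt_const)
      · exact Complex.continuous_ofReal.continuousAt.comp
          (Real.continuous_sinh.continuousAt.comp d1)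
      · exact Complex.continuous_ofReal.continuousAt.comp
          (Real.continuous_sin.continuousAt.comp d2)
    exact continuousAt_const.mul
      (ContinuousAt.comp (g := Complex.arg) (Complex.continuousAt_arg hslit) hin)

/-! ### The harmonic function of a rectangle -/

/-- The general term of the series of reflected half-strip functions. -/
def rectTerm (a b x y : ℝ) (k : ℕ) : ℝ :=
  (-1) ^ (k + 1) * (halfStrip b (x + (k + 1) * a) y + halfStrip b ((k + 2) * a - x) y)

/-- The harmonic function of the rectangle `[0, a] × [0, b]`: the alternating sum of half-strip
functions attached to the vertical lines `x = k a`. For `b = 0` its value is `0`. -/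
def rectHarmonic (a b x y : ℝ) : ℝ :=
  halfStrip b x y + halfStrip b (a - x) y + ∑' k, rectTerm a b x y k

theorem rectHarmonic_zero (a x y : ℝ) : rectHarmonic a 0 x y = 0 := by
  simp [rectHarmonic, rectTerm, halfStrip_zero]

theorem rectHarmonic_reflect (a b x y : ℝ) :
    rectHarmonic a b (a - x) y = rectHarmonic a b x y := by
  have : ∀ k, rectTerm a b (a - x) y k = rectTerm a b x y k := by
    intro k
    rw [rectTerm, rectTerm, add_comm (halfStrip b (a - x + (k + 1) * a) y)]
    congr 3 <;> ring
  rw [rectHarmonic, rectHarmonic, tsum_congr this, sub_sub_cancel,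
    add_comm (halfStrip b (a - x) y)]

theorem rectHarmonic_reflect_im (a b x y : ℝ) :
    rectHarmonic a b x (b - y) = rectHarmonic a b x y := by
  have h : ∀ x, halfStrip b x (b - y) = halfStrip b x y := by
    intro x
    rcases eq_or_ne b 0 with rfl | hb
    · simp [halfStrip_zero]
    · rw [halfStrip, halfStrip, mul_sub, sub_div, mul_div_cancel_right₀ _ hb, Real.sin_pi_sub]
  simp only [rectHarmonic, rectTerm, h]

/-- The bound for the terms of the series, uniform in `a ≥ a₀` and `b ≤ b₀`. -/
def rectBound (a₀ b₀ : ℝ) (k : ℕ) : ℝ :=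
  2 * (2 / π * (2 / (1 - Real.exp (-(π * a₀ / b₀))))) * Real.exp (-(π * a₀ / b₀)) ^ (k + 1)

theorem exp_lt_one_of_pos {a₀ b₀ : ℝ} (ha : 0 < a₀) (hb : 0 < b₀) :
    Real.exp (-(π * a₀ / b₀)) < 1 := by
  have hpi := Real.pi_pos
  rw [Real.exp_lt_one_iff, neg_lt_zero]
  positivity

theorem summable_rectBound {a₀ b₀ : ℝ} (ha : 0 < a₀) (hb : 0 < b₀) :
    Summable (rectBound a₀ b₀) := by
  have h := summable_geometric_of_lt_one (Real.exp_pos _).le (exp_lt_one_of_pos ha hb)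
  exact ((summable_nat_add_iff 1).2 h).mul_left _

theorem exp_neg_le_pow {a₀ b₀ a b x : ℝ} (ha₀ : 0 < a₀) (ha : a₀ ≤ a) (hb : 0 < b) (hb₀ : b ≤ b₀)
    {k : ℕ} (hx : (k + 1) * a ≤ x) :
    Real.exp (-(π * x / b)) ≤ Real.exp (-(π * a₀ / b₀)) ^ (k + 1) := by
  have hpi := Real.pi_pos
  rw [← Real.exp_nat_mul]
  apply Real.exp_le_exp.2
  push_cast
  rw [mul_neg, neg_le_neg_iff, ← mul_div_assoc]
  apply div_le_div₀
  · have : 0 < a := by linarith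
    have : 0 ≤ x := le_trans (by positivity) hx
    positivity
  · have : ((k : ℝ) + 1) * a₀ ≤ (k + 1) * a := by gcongr
    calc ((k : ℝ) + 1) * (π * a₀) = π * ((k + 1) * a₀) := by ring
      _ ≤ π * x := by gcongr; linarith
  · exact hb
  · exact hb₀

theorem abs_halfStrip_le_bound {a₀ b₀ a b x y : ℝ} (ha₀ : 0 < a₀) (ha : a₀ ≤ a) (hb : 0 ≤ b)
    (hb₀ : b ≤ b₀) (hb₀' : 0 < b₀) {k : ℕ} (hx : (k + 1) * a ≤ x) :
    |halfStrip b x y| ≤ 2 / π * (2 / (1 - Real.exp (-(π * a₀ / b₀)))) *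
      Real.exp (-(π * a₀ / b₀)) ^ (k + 1) := by
  have hpi := Real.pi_pos
  have hq := exp_lt_one_of_pos ha₀ hb₀'
  have hq' : 0 < 1 - Real.exp (-(π * a₀ / b₀)) := by linarith
  have ha' : 0 < a := by linarith
  have hx' : 0 < x := lt_of_lt_of_le (by positivity) hx
  rcases hb.eq_or_lt with rfl | hb
  · rw [halfStrip_zero, abs_zero]; positivity
  · have h := exp_neg_le_pow ha₀ ha hb hb₀ hx
    refine (abs_halfStrip_le hb.le hx' hq fun _ => h.trans ?_).trans ?_
    · exact pow_le_of_le_one (Real.exp_pos _).le hq.le (Nat.succ_ne_zero k)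
    · gcongr

theorem abs_rectTerm_le {a₀ b₀ a b x y : ℝ} (ha₀ : 0 < a₀) (ha : a₀ ≤ a) (hb : 0 ≤ b)
    (hb₀ : b ≤ b₀) (hb₀' : 0 < b₀) (hx : x ∈ Icc 0 a) (k : ℕ) :
    |rectTerm a b x y k| ≤ rectBound a₀ b₀ k := by
  have h1 := abs_halfStrip_le_bound (y := y) ha₀ ha hb hb₀ hb₀' (k := k)
    (x := x + (k + 1) * a) (by linarith [hx.1])
  have h2 := abs_halfStrip_le_bound (y := y) ha₀ ha hb hb₀ hb₀' (k := k)
    (x := (k + 2) * a - x) (by linarith [hx.2])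
  rw [rectTerm, abs_mul, abs_pow, abs_neg, abs_one, one_pow, one_mul]
  refine (abs_add_le _ _).trans ((add_le_add h1 h2).trans (le_of_eq ?_))
  rw [rectBound]; ring

/-- Joint continuity in the side lengths and the point, off the corners. -/
theorem continuousOn_rectHarmonic {a₀ b₀ : ℝ} (ha₀ : 0 < a₀) (hb₀ : 0 < b₀) :
    ContinuousOn (fun p : ℝ × ℝ × ℝ × ℝ => rectHarmonic p.1 p.2.1 p.2.2.1 p.2.2.2)
      {p | a₀ ≤ p.1 ∧ p.2.1 ∈ Icc 0 b₀ ∧ p.2.2.1 ∈ Icc 0 p.1 ∧ p.2.2.2 ∈ Icc 0 p.2.1 ∧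
        ¬ ((p.2.2.1 = 0 ∨ p.2.2.1 = p.1) ∧ (p.2.2.2 = 0 ∨ p.2.2.2 = p.2.1))} := by
  refine ContinuousOn.add (ContinuousOn.add ?_ ?_)
    (continuousOn_tsum (u := rectBound a₀ b₀) (fun k => ?_) (summable_rectBound ha₀ hb₀) ?_)
  · refine continuousOn_halfStrip.comp (f := fun p : ℝ × ℝ × ℝ × ℝ => (p.2.1, p.2.2.1, p.2.2.2))
      (by fun_prop) ?_
    rintro p ⟨h1, h2, h3, h4, h5⟩
    exact ⟨h2.1, h3.1, h4, fun h => h5 ⟨Or.inl h.1, h.2⟩⟩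
  · refine continuousOn_halfStrip.comp
      (f := fun p : ℝ × ℝ × ℝ × ℝ => (p.2.1, p.1 - p.2.2.1, p.2.2.2)) (by fun_prop) ?_
    rintro p ⟨h1, h2, h3, h4, h5⟩
    exact ⟨h2.1, sub_nonneg.2 h3.2, h4, fun h => h5 ⟨Or.inr (sub_eq_zero.1 h.1).symm, h.2⟩⟩
  · refine continuousOn_const.mul (ContinuousOn.add ?_ ?_)
    · refine continuousOn_halfStrip.comp
        (f := fun p : ℝ × ℝ × ℝ × ℝ => (p.2.1, p.2.2.1 + (k + 1) * p.1, p.2.2.2))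
        (by fun_prop) ?_
      rintro p ⟨h1, h2, h3, h4, h5⟩
      have h6 : 0 < p.2.2.1 + (k + 1) * p.1 :=
        add_pos_of_nonneg_of_pos h3.1 (mul_pos (by positivity) (by linarith))
      exact ⟨h2.1, h6.le, h4, fun h => h6.ne' h.1⟩
    · refine continuousOn_halfStrip.comp
        (f := fun p : ℝ × ℝ × ℝ × ℝ => (p.2.1, (k + 2) * p.1 - p.2.2.1, p.2.2.2))
        (by fun_prop) ?_
      rintro p ⟨h1, h2, h3, h4, h5⟩
      have h6 : 0 < (k + 2) * p.1 - p.2.2.1 := by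
        have := mul_pos (by positivity : (0 : ℝ) < k + 1) (by linarith : 0 < p.1)
        linarith [h3.2]
      exact ⟨h2.1, h6.le, h4, fun h => h6.ne' h.1⟩
  · rintro k p ⟨h1, h2, h3, h4, h5⟩
    exact abs_rectTerm_le ha₀ h1 h2.1 h2.2 hb₀ h3 k

/-- On the vertical side `x = 0` all the terms but the first one cancel telescopically. -/
theorem rectHarmonic_left {a b y : ℝ} (ha : 0 < a) (hy : y ∈ Ioo 0 b) :
    rectHarmonic a b 0 y = 1 := by
  have hb : 0 < b := hy.1.trans hy.2
  set c : ℕ → ℝ := fun k => (-1) ^ k * halfStrip b ((k + 1) * a) y with hc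
  have hcs : Summable c := by
    refine Summable.of_norm_bounded (summable_rectBound ha hb) fun k => ?_
    have h1 := abs_halfStrip_le_bound (y := y) ha le_rfl hb.le le_rfl hb (k := k)
      (x := (k + 1) * a) le_rfl
    rw [Real.norm_eq_abs, abs_mul, abs_pow, abs_neg, abs_one, one_pow, one_mul]
    refine h1.trans ?_
    rw [rectBound, mul_assoc 2]
    have := (abs_nonneg _).trans h1
    linarith
  have hterm : ∀ k, rectTerm a b 0 y k = c (k + 1) - c k := by
    intro k
    simp only [rectTerm, hc]
    push_cast
    rw [pow_succ, zero_add, sub_zero, show ((k : ℝ) + 1 + 1) = k + 2 by ring]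
    ring
  have hsum : ∑' k, rectTerm a b 0 y k = - c 0 := by
    rw [tsum_congr hterm, Summable.tsum_sub ((summable_nat_add_iff 1).2 hcs) hcs,
      hcs.tsum_eq_zero_add]
    ring
  rw [rectHarmonic, hsum, halfStrip_vertical hy, hc]
  simp

theorem abs_rectHarmonic_le {a b x : ℝ} (ha : 0 < a) (hb : 0 < b) (hx : x ∈ Icc 0 a) (y : ℝ) :
    |rectHarmonic a b x y| ≤ 1 + 1 + ∑' k, rectBound a b k := by
  refine (abs_add_le _ _).trans (add_le_add ((abs_add_le _ _).trans (add_le_add ?_ ?_)) ?_)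
  · exact abs_halfStrip_le_one hb.le hx.1
  · exact abs_halfStrip_le_one hb.le (sub_nonneg.2 hx.2)
  · exact tsum_of_norm_bounded (f := rectTerm a b x y) (summable_rectBound ha hb).hasSum
      fun k => abs_rectTerm_le ha le_rfl hb.le le_rfl hb hx k

theorem rectHarmonic_horizontal {a b x y : ℝ} (hb : 0 < b) (hx : x ∈ Icc 0 a)
    (hy : y = 0 ∨ y = b) : rectHarmonic a b x y = 0 := by
  have hs : Real.sin (π * y / b) = 0 := by
    rcases hy with rfl | rfl
    · simp
    · rw [mul_div_cancel_right₀ _ hb.ne', Real.sin_pi]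
  have ha : 0 ≤ a := hx.1.trans hx.2
  have h1 := halfStrip_of_sin_eq_zero hb.le hx.1 hs
  have h2 := halfStrip_of_sin_eq_zero hb.le (sub_nonneg.2 hx.2) hs
  have h3 : ∀ k, rectTerm a b x y k = 0 := by
    intro k
    rw [rectTerm, halfStrip_of_sin_eq_zero hb.le _ hs, halfStrip_of_sin_eq_zero hb.le _ hs]
    · ring
    · have : 0 ≤ ((k : ℝ) + 1) * a := by positivity
      linarith [hx.2]
    · have : 0 ≤ ((k : ℝ) + 1) * a := by positivity
      linarith [hx.1]
  rw [rectHarmonic, h1, h2, tsum_congr h3]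
  simp

/-- The rectangle function is the imaginary part of a holomorphic series. -/
theorem harmonicAt_rectHarmonic {a b : ℝ} {z : ℂ} (ha : 0 < a) (hb : 0 < b)
    (hz : z.re ∈ Ioo 0 a) :
    InnerProductSpace.HarmonicAt (fun z => rectHarmonic a b z.re z.im) z := by
  have hpi := Real.pi_pos
  set c : ℝ := π / b with hc
  have hcpos : 0 < c := by positivity
  let U : Set ℂ := Complex.re ⁻¹' Ioo 0 a
  have hU : IsOpen U := isOpen_Ioo.preimage Complex.continuous_re
  let T : ℕ → ℂ → ℂ := fun k z => (-1) ^ (k + 1) *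
    (stripLog (c * (z + (k + 1) * a)) - stripLog (c * ((k + 2) * a - z)))
  let Φ : ℂ → ℂ := fun z => stripLog (c * z) - stripLog (c * (a - z)) + ∑' k, T k z
  have hre1 : ∀ (w : ℂ) (k : ℕ), (c * (w + (k + 1) * a) : ℂ).re = c * (w.re + (k + 1) * a) := by
    intro w k
    rw [Complex.re_ofReal_mul]; simp
  have hre2 : ∀ (w : ℂ) (k : ℕ), (c * ((k + 2) * a - w) : ℂ).re = c * ((k + 2) * a - w.re) := by
    intro w k
    rw [Complex.re_ofReal_mul]; simp
  have hpos1 : ∀ w ∈ U, ∀ k : ℕ, (k + 1) * a ≤ w.re + (k + 1) * a := by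
    intro w hw k
    have := hw.1
    linarith
  have hpos2 : ∀ w ∈ U, ∀ k : ℕ, (k + 1) * a ≤ (k + 2) * a - w.re := by
    intro w hw k
    have := hw.2
    linarith
  have hka : ∀ k : ℕ, 0 < (k + 1) * a := fun k => by positivity
  have hbd : ∀ (w : ℂ) (x : ℝ) (k : ℕ), w.re = c * x → (k + 1) * a ≤ x →
      ‖stripLog w‖ ≤ 2 / (1 - Real.exp (-(π * a / b))) * Real.exp (-(π * a / b)) ^ (k + 1) := by
    intro w x k hw hx
    have h := exp_neg_le_pow ha le_rfl hb le_rfl hx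
    have hq := exp_lt_one_of_pos ha hb
    have hq' : 0 < 1 - Real.exp (-(π * a / b)) := by linarith
    have e : -w.re = -(π * x / b) := by rw [hw, hc]; ring
    refine (norm_stripLog_le (q := Real.exp (-(π * a / b))) ?_ hq).trans ?_
    · rw [e]
      exact h.trans (pow_le_of_le_one (Real.exp_pos _).le hq.le (Nat.succ_ne_zero k))
    · rw [e]; gcongr
  have hTb : ∀ k, ∀ w ∈ U, ‖T k w‖ ≤ π / 2 * rectBound a b k := by
    intro k w hw
    have h1 := hbd _ _ k (hre1 w k) (hpos1 w hw k)
    have h2 := hbd _ _ k (hre2 w k) (hpos2 w hw k)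
    simp only [T, norm_mul, norm_pow, norm_neg, norm_one, one_pow, one_mul]
    refine (norm_sub_le _ _).trans ((add_le_add h1 h2).trans (le_of_eq ?_))
    rw [rectBound]
    field_simp
    ring
  have hsb : Summable fun k => π / 2 * rectBound a b k := (summable_rectBound ha hb).mul_left _
  have hTd : DifferentiableOn ℂ (fun w => ∑' k, T k w) U := by
    refine Complex.differentiableOn_tsum_of_summable_norm hsb (fun k w hw => ?_) hU hTb
    apply DifferentiableAt.differentiableWithinAt
    refine DifferentiableAt.const_mul (DifferentiableAt.fun_sub ?_ ?_) _
    · refine DifferentiableAt.comp w (g := stripLog) (differentiableAt_stripLog ?_) (by fun_prop)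
      rw [hre1]
      exact mul_pos hcpos ((hka k).trans_le (hpos1 w hw k))
    · refine DifferentiableAt.comp w (g := stripLog) (differentiableAt_stripLog ?_) (by fun_prop)
      rw [hre2]
      exact mul_pos hcpos ((hka k).trans_le (hpos2 w hw k))
  have hΦd : DifferentiableOn ℂ Φ U := by
    refine DifferentiableOn.add (fun w hw => ?_) hTd
    apply DifferentiableAt.differentiableWithinAt
    refine DifferentiableAt.fun_sub ?_ ?_
    · refine DifferentiableAt.comp w (g := stripLog) (differentiableAt_stripLog ?_) (by fun_prop)
      rw [Complex.re_ofReal_mul]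
      exact mul_pos hcpos hw.1
    · refine DifferentiableAt.comp w (g := stripLog) (differentiableAt_stripLog ?_) (by fun_prop)
      rw [Complex.re_ofReal_mul]
      exact mul_pos hcpos (by simpa using hw.2)
  have him1 : ∀ (x y : ℝ) (w : ℂ), 0 < x → w = ⟨x, y⟩ →
      halfStrip b x y = 2 / π * (stripLog (c * w)).im := by
    rintro x y w hx rfl
    rw [halfStrip_eq_im hb hx]
    congr 3
    apply Complex.ext <;> simp [hc] <;> ring
  have him2 : ∀ (x y : ℝ) (w : ℂ), 0 < x → w = ⟨x, -y⟩ →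
      halfStrip b x y = 2 / π * -(stripLog (c * w)).im := by
    rintro x y w hx rfl
    rw [halfStrip_eq_neg_im hb hx]
    congr 4
    apply Complex.ext <;> simp [hc] <;> ring
  have hΦim : ∀ w ∈ U, rectHarmonic a b w.re w.im = 2 / π * (Φ w).im := by
    intro w hw
    have hsum : Summable fun k => T k w := Summable.of_norm_bounded hsb fun k => hTb k w hw
    have e1 := him1 w.re w.im w hw.1 rfl
    have e2 := him2 (a - w.re) w.im (a - w) (sub_pos.2 hw.2) (by apply Complex.ext <;> simp)
    have e3 : ∀ k, rectTerm a b w.re w.im k = 2 / π * (T k w).im := by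
      intro k
      have f1 := him1 (w.re + (k + 1) * a) w.im (w + (k + 1) * a)
        ((hka k).trans_le (hpos1 w hw k)) (by apply Complex.ext <;> simp)
      have f2 := him2 ((k + 2) * a - w.re) w.im ((k + 2) * a - w)
        ((hka k).trans_le (hpos2 w hw k)) (by apply Complex.ext <;> simp)
      have f3 : ((-1 : ℂ) ^ (k + 1)) = (((-1 : ℝ) ^ (k + 1) : ℝ) : ℂ) := by push_cast; rfl
      simp only [T]
      rw [rectTerm, f1, f2, f3, Complex.im_ofReal_mul, Complex.sub_im]
      ring
    rw [rectHarmonic, e1, e2, tsum_congr e3, tsum_mul_left]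
    simp only [Φ, Complex.add_im, Complex.sub_im, Complex.im_tsum hsum]
    ring
  have hA : AnalyticAt ℂ Φ z := hΦd.analyticAt (hU.mem_nhds hz)
  refine (InnerProductSpace.harmonicAt_congr_nhds ?_).1 (hA.harmonicAt_im.const_smul (c := 2 / π))
  filter_upwards [hU.mem_nhds hz] with w hw
  exact (hΦim w hw).symm

theorem isTileHarmonic_rectHarmonic {a b : ℝ} (ha : 0 < a) (hb : 0 < b) :
    IsTileHarmonic a b fun z => rectHarmonic a b z.re z.im where
  harmonic := fun _ hz => harmonicAt_rectHarmonic ha hb hz.1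
  continuousOn := by
    refine (continuousOn_rectHarmonic ha hb).comp
      (f := fun z : ℂ => ((a, b, z.re, z.im) : ℝ × ℝ × ℝ × ℝ)) (by fun_prop) ?_
    rintro z ⟨h1, h2, h3⟩
    exact ⟨le_rfl, ⟨hb.le, le_rfl⟩, h1, h2, h3⟩
  bounded := ⟨_, fun z hz => abs_rectHarmonic_le ha hb hz.1 z.im⟩
  horizontal := fun z hz h => rectHarmonic_horizontal hb ⟨hz.1.le, hz.2.le⟩ h
  vertical := by
    rintro z (h | h) hy
    · rw [h, rectHarmonic_left ha hy]
    · rw [h, ← rectHarmonic_reflect, sub_self, rectHarmonic_left ha hy]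

theorem tileHarmonic_eq {a b : ℝ} (ha : 0 < a) (hb : 0 < b) {z : ℂ}
    (hz : z ∈ puncturedRect a b) : tileHarmonic a b z = rectHarmonic a b z.re z.im := by
  have h := isTileHarmonic_rectHarmonic ha hb
  exact IsTileHarmonic.eqOn ha hb (Classical.epsilon_spec ⟨_, h⟩) h hz

/-- Exchanging the sides of the rectangle exchanges the boundary values `0` and `1`. -/
theorem rectHarmonic_swap {a b x y : ℝ} (ha : 0 < a) (hb : 0 < b)
    (h : (⟨x, y⟩ : ℂ) ∈ puncturedRect a b) :
    rectHarmonic b a y x = 1 - rectHarmonic a b x y := by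
  have h1 := isTileHarmonic_rectHarmonic ha hb
  have h2 := isTileHarmonic_rectHarmonic hb ha
  have hmem : ∀ z ∈ puncturedRect a b, (⟨z.im, z.re⟩ : ℂ) ∈ puncturedRect b a :=
    fun z hz => ⟨hz.2.1, hz.1, fun h => hz.2.2 ⟨h.2, h.1⟩⟩
  have h3 : IsTileHarmonic a b fun z => 1 - rectHarmonic b a z.im z.re :=
    { harmonic := by
        intro z hz
        have hh : InnerProductSpace.HarmonicAt (fun _ : ℂ => (1 : ℝ)) z :=
          ⟨contDiffAt_const, by filter_upwards with y; simp⟩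
        exact hh.sub (harmonicAt_comp_swap (u := fun z => rectHarmonic b a z.re z.im)
          (harmonicAt_rectHarmonic hb ha (z := ⟨z.im, z.re⟩) hz.2))
      continuousOn := by
        refine continuousOn_const.sub (h2.continuousOn.comp
          (f := fun z : ℂ => (⟨z.im, z.re⟩ : ℂ)) ?_ hmem)
        have e : (fun z : ℂ => (⟨z.im, z.re⟩ : ℂ)) = fun z => (z.im : ℂ) + z.re * Complex.I := by
          funext z; exact Complex.mk_eq_add_mul_I _ _
        rw [e]
        fun_prop
      bounded := by
        obtain ⟨C, hC⟩ := h2.bounded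
        refine ⟨1 + C, fun z hz => (abs_sub _ _).trans ?_⟩
        have := hC _ (hmem z hz)
        simp only at this
        rw [abs_one]
        linarith
      horizontal := by
        intro z hz h
        have := h2.vertical ⟨z.im, z.re⟩ h hz
        simp only at this ⊢
        rw [this, sub_self]
      vertical := by
        intro z h hz
        have := h2.horizontal ⟨z.im, z.re⟩ hz h
        simp only at this ⊢
        rw [this, sub_zero] }
  have := IsTileHarmonic.eqOn ha hb h1 h3 h
  simp only at this
  linarith

/-! ### The reparametrization `ζ` -/

theorem zetaReal_zero : zetaReal 0 = 0 := by simp [zetaReal]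

theorem zetaReal_one : zetaReal 1 = 1 := by simp [zetaReal]

theorem zetaReal_lt_one {x : ℝ} (hx : x < 1) : zetaReal x < 1 := by
  have hpi := Real.pi_pos
  rw [zetaReal, if_neg hx.ne]
  calc _ < 2 / π * (π / 2) :=
        mul_lt_mul_of_pos_left (Real.arctan_lt_pi_div_two _) (by positivity)
    _ = 1 := by field_simp

theorem strictMonoOn_zetaReal : StrictMonoOn zetaReal (Icc 0 1) := by
  intro x hx y hy hxy
  have hpi := Real.pi_pos
  rcases hy.2.eq_or_lt with rfl | hy1
  · rw [zetaReal_one]; exact zetaReal_lt_one hxy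
  · have hx1 : x < 1 := hxy.trans hy1
    rw [zetaReal, zetaReal, if_neg hx1.ne, if_neg hy1.ne]
    refine mul_lt_mul_of_pos_left (Real.arctan_strictMono (Real.sqrt_lt_sqrt ?_ ?_))
      (by positivity)
    · apply Real.tan_nonneg_of_nonneg_of_le_pi_div_two
      · have := hx.1; positivity
      · nlinarith [hx.1]
    · apply Real.tan_lt_tan_of_lt_of_lt_pi_div_two <;> nlinarith [hx.1]

theorem zetaReal_one_sub {x : ℝ} (hx : x ∈ Icc (0 : ℝ) 1) :
    zetaReal (1 - x) = 1 - zetaReal x := by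
  have hpi := Real.pi_pos
  rcases hx.1.eq_or_lt with rfl | h0
  · rw [sub_zero, zetaReal_one, zetaReal_zero, sub_zero]
  rcases hx.2.eq_or_lt with rfl | h1
  · rw [sub_self, zetaReal_one, zetaReal_zero, sub_self]
  have htan : 0 < Real.tan (π * x / 2) := by
    apply Real.tan_pos_of_pos_of_lt_pi_div_two
    · positivity
    · nlinarith
  rw [zetaReal, zetaReal, if_neg h1.ne, if_neg (by linarith : (1 - x) ≠ 1),
    show π * (1 - x) / 2 = π / 2 - π * x / 2 by ring, Real.tan_pi_div_two_sub, Real.sqrt_inv,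
    Real.arctan_inv_of_pos (Real.sqrt_pos.2 htan)]
  field_simp

theorem continuousOn_zetaReal : ContinuousOn zetaReal (Icc 0 1) := by
  have hpi := Real.pi_pos
  have hlt : ∀ x ∈ Icc (0 : ℝ) 1, x < 1 → ContinuousAt zetaReal x := by
    intro x hx hx1
    have hcos : Real.cos (π * x / 2) ≠ 0 := by
      apply (Real.cos_pos_of_mem_Ioo ⟨?_, ?_⟩).ne'
      · nlinarith [hx.1]
      · nlinarith [hx.1]
    have h1 : ContinuousAt (fun x => 2 / π * Real.arctan (Real.sqrt (Real.tan (π * x / 2)))) x := by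
      refine continuousAt_const.mul (Real.continuous_arctan.continuousAt.comp
        (Real.continuous_sqrt.continuousAt.comp ?_))
      exact ContinuousAt.comp (f := fun x : ℝ => π * x / 2) (Real.continuousAt_tan.2 hcos)
        (by fun_prop)
    refine h1.congr ?_
    filter_upwards [isOpen_Iio.mem_nhds hx1] with y hy
    rw [zetaReal, if_neg (ne_of_lt hy)]
  intro x hx
  rcases hx.2.eq_or_lt with rfl | hx1
  · have h2 : ContinuousWithinAt (fun x => 1 - zetaReal (1 - x)) (Icc 0 1) 1 := by
      have h3 : ContinuousAt zetaReal (1 - 1) := hlt _ (by simp) (by simp)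
      exact (continuousAt_const.sub
        (ContinuousAt.comp (f := fun x : ℝ => 1 - x) h3 (by fun_prop))).continuousWithinAt
    refine h2.congr (fun y hy => ?_) ?_
    · rw [zetaReal_one_sub hy]; ring
    · simp [zetaReal_zero, zetaReal_one]
  · exact (hlt x hx hx1).continuousWithinAt

/-! ### The height function over a strip around an edge -/

/-- Comparison of the harmonic functions of two rectangles, translated by `(-c, -d)` and
`(-c', -d')`, on a common subrectangle. -/
theorem rectHarmonic_lt_of_le_on_sides {x₁ x₂ y₁ y₂ a b c d a' b' c' d' : ℝ} (hx : x₁ < x₂)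
    (hy : y₁ < y₂) (hb : 0 < b) (hb' : 0 < b')
    (hc : 0 ≤ x₁ + c) (hca : x₂ + c ≤ a) (hc' : 0 ≤ x₁ + c') (hca' : x₂ + c' ≤ a')
    (h : ∀ z ∈ puncturedBox x₁ x₂ y₁ y₂, (⟨z.re + c, z.im + d⟩ : ℂ) ∈ puncturedRect a b)
    (h' : ∀ z ∈ puncturedBox x₁ x₂ y₁ y₂, (⟨z.re + c', z.im + d'⟩ : ℂ) ∈ puncturedRect a' b')
    (hs : ∀ z ∈ puncturedBox x₁ x₂ y₁ y₂, (z.re = x₁ ∨ z.re = x₂ ∨ z.im = y₁ ∨ z.im = y₂) →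
      rectHarmonic a b (z.re + c) (z.im + d) ≤ rectHarmonic a' b' (z.re + c') (z.im + d'))
    (hp : ∃ z ∈ puncturedBox x₁ x₂ y₁ y₂,
      rectHarmonic a b (z.re + c) (z.im + d) < rectHarmonic a' b' (z.re + c') (z.im + d'))
    {x y : ℝ} (hxm : x ∈ Ioo x₁ x₂) (hym : y ∈ Ioo y₁ y₂) :
    rectHarmonic a b (x + c) (y + d) < rectHarmonic a' b' (x + c') (y + d') := by
  have ha : 0 < a := by linarith
  have ha' : 0 < a' := by linarith
  have htr : ∀ (e f : ℝ), (fun z : ℂ => (⟨z.re + e, z.im + f⟩ : ℂ)) = fun z => z + ⟨e, f⟩ := by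
    intro e f
    funext z
    apply Complex.ext <;> simp
  have hharm : ∀ {A B e f : ℝ}, 0 < A → 0 < B → 0 ≤ x₁ + e → x₂ + e ≤ A →
      InnerProductSpace.HarmonicOnNhd (fun z : ℂ => rectHarmonic A B (z.re + e) (z.im + f))
        (openBox x₁ x₂ y₁ y₂) := by
    intro A B e f hA hB he heA z hz
    have := harmonicAt_comp_analyticAt (u := fun z => rectHarmonic A B z.re z.im)
      (f := fun z => z + ⟨e, f⟩) (z := z)
      (harmonicAt_rectHarmonic hA hB ⟨by simp; linarith [hz.1.1], by simp; linarith [hz.1.2]⟩)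
      (by fun_prop)
    simpa using this
  have hcont : ∀ {A B e f : ℝ}, 0 < A → 0 < B →
      (∀ z ∈ puncturedBox x₁ x₂ y₁ y₂, (⟨z.re + e, z.im + f⟩ : ℂ) ∈ puncturedRect A B) →
      ContinuousOn (fun z : ℂ => rectHarmonic A B (z.re + e) (z.im + f))
        (puncturedBox x₁ x₂ y₁ y₂) := by
    intro A B e f hA hB hm
    refine (isTileHarmonic_rectHarmonic hA hB).continuousOn.comp
      (f := fun z : ℂ => (⟨z.re + e, z.im + f⟩ : ℂ)) ?_ hm
    rw [htr]
    fun_prop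
  have key := pos_of_nonneg_on_sides (C := (1 + 1 + ∑' k, rectBound a' b' k) +
      (1 + 1 + ∑' k, rectBound a b k)) hx hy
    ((hharm ha' hb' hc' hca' (f := d')).sub (hharm ha hb hc hca (f := d)))
    ((hcont ha' hb' h').sub (hcont ha hb h)) ?_ ?_ ?_ ⟨x, y⟩ ⟨hxm, hym⟩
  · exact sub_pos.1 key
  · intro z hz
    have h1 := (abs_le.1 (abs_rectHarmonic_le ha' hb' (h' z hz).1 (z.im + d'))).1
    have h2 := (abs_le.1 (abs_rectHarmonic_le ha hb (h z hz).1 (z.im + d))).2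
    change _ ≤ rectHarmonic a' b' (z.re + c') (z.im + d') - rectHarmonic a b (z.re + c) (z.im + d)
    linarith
  · intro z hz hzs
    exact sub_nonneg.2 (hs z hz hzs)
  · obtain ⟨z, hz, hlt⟩ := hp
    exact ⟨z, hz, sub_pos.2 hlt⟩

theorem rectHarmonic_pos {a b x y : ℝ} (ha : 0 < a) (hx : x ∈ Icc 0 a) (hy : y ∈ Ioo 0 b) :
    0 < rectHarmonic a b x y := by
  have hb : 0 < b := hy.1.trans hy.2
  rcases hx.1.eq_or_lt with rfl | h0
  · rw [rectHarmonic_left ha hy]; norm_num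
  rcases hx.2.eq_or_lt with rfl | h1
  · rw [← rectHarmonic_reflect, sub_self, rectHarmonic_left ha hy]; norm_num
  have h := isTileHarmonic_rectHarmonic ha hb
  obtain ⟨C, hC⟩ := h.bounded
  refine pos_of_nonneg_on_sides ha hb (C := C) h.harmonic h.continuousOn
    (fun z hz => (abs_le.1 (hC z hz)).1) ?_ ?_ ⟨x, y⟩ ⟨⟨h0, h1⟩, hy⟩
  · intro z hz hs
    by_cases him : z.im = 0 ∨ z.im = b
    · exact (rectHarmonic_horizontal hb hz.1 him).ge
    · have hre : z.re = 0 ∨ z.re = a := by tauto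
      push Not at him
      rw [h.vertical z hre ⟨lt_of_le_of_ne hz.2.1.1 him.1.symm, lt_of_le_of_ne hz.2.1.2 him.2⟩]
      exact zero_le_one
  · refine ⟨⟨0, y⟩, ⟨⟨le_rfl, ha.le⟩, ⟨hy.1.le, hy.2.le⟩, ?_⟩, ?_⟩
    · rintro ⟨-, h | h⟩
      · exact hy.1.ne' h
      · exact hy.2.ne h
    · simp only [rectHarmonic_left ha hy]; norm_num

theorem rectHarmonic_lt_one {a b x y : ℝ} (hb : 0 < b) (hx : x ∈ Ioo 0 a) (hy : y ∈ Icc 0 b) :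
    rectHarmonic a b x y < 1 := by
  have h1 := rectHarmonic_pos hb hy hx
  rw [rectHarmonic_swap (hx.1.trans hx.2) hb
    ⟨⟨hx.1.le, hx.2.le⟩, hy, fun h => h.1.elim hx.1.ne' hx.2.ne⟩] at h1
  linarith

theorem rectHarmonic_mem_Icc {a b x y : ℝ} (ha : 0 < a) (hb : 0 < b) (hx : x ∈ Icc 0 a)
    (hy : y ∈ Icc 0 b) : rectHarmonic a b x y ∈ Icc (0 : ℝ) 1 := by
  by_cases him : y = 0 ∨ y = b
  · rw [rectHarmonic_horizontal hb hx him]; simp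
  · push Not at him
    have hy' : y ∈ Ioo 0 b := ⟨lt_of_le_of_ne hy.1 him.1.symm, lt_of_le_of_ne hy.2 him.2⟩
    refine ⟨(rectHarmonic_pos ha hx hy').le, ?_⟩
    rcases hx.1.eq_or_lt with rfl | h0
    · rw [rectHarmonic_left ha hy']
    rcases hx.2.eq_or_lt with rfl | h1
    · rw [← rectHarmonic_reflect, sub_self, rectHarmonic_left ha hy']
    exact (rectHarmonic_lt_one hb ⟨h0, h1⟩ hy).le

/-- The height `ζ ∘ h_r` over the rectangle `r = [s, L - s] × [-s, s]` of the strip around an edge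
of length `L`. -/
def edgeHeight (L s x y : ℝ) : ℝ := zetaReal (rectHarmonic (L - 2 * s) (2 * s) (x - s) (y + s))

theorem edgeHeight_mem (L s x y : ℝ) : edgeHeight L s x y ∈ Icc (0 : ℝ) 1 := zetaReal_mem _

theorem edgeHeight_zero (L x y : ℝ) : edgeHeight L 0 x y = 0 := by
  rw [edgeHeight, mul_zero, rectHarmonic_zero, zetaReal_zero]

theorem edgeHeight_reflect (L s x y : ℝ) : edgeHeight L s (L - x) y = edgeHeight L s x y := by
  rw [edgeHeight, edgeHeight, ← rectHarmonic_reflect]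
  congr 2
  ring

theorem edgeHeight_neg (L s x y : ℝ) : edgeHeight L s x (-y) = edgeHeight L s x y := by
  rw [edgeHeight, edgeHeight, ← rectHarmonic_reflect_im]
  congr 2
  ring

theorem edgeHeight_eq_zero {L s x y : ℝ} (hs : 0 ≤ s) (hx : x ∈ Icc s (L - s)) (hy : |y| = s) :
    edgeHeight L s x y = 0 := by
  rcases hs.eq_or_lt with rfl | hs
  · exact edgeHeight_zero L x y
  rw [edgeHeight, rectHarmonic_horizontal (by linarith) ⟨by linarith [hx.1], by linarith [hx.2]⟩,
    zetaReal_zero]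
  rcases eq_or_eq_neg_of_abs_eq hy with rfl | rfl
  · right; ring
  · left; ring

theorem edgeHeight_eq_one {L s y : ℝ} (hL : 2 * s < L) (hy : |y| < s) :
    edgeHeight L s s y = 1 := by
  have := abs_lt.1 hy
  rw [edgeHeight, sub_self, rectHarmonic_left (by linarith) ⟨by linarith, by linarith⟩,
    zetaReal_one]

theorem edgeHeight_pos {L s x y : ℝ} (hL : 2 * s < L) (hx : x ∈ Icc s (L - s)) (hy : |y| < s) :
    0 < edgeHeight L s x y := by
  have hs : 0 < s := (abs_nonneg y).trans_lt hy
  have := abs_lt.1 hy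
  have hxm : x - s ∈ Icc 0 (L - 2 * s) := ⟨by linarith [hx.1], by linarith [hx.2]⟩
  have hym : y + s ∈ Ioo 0 (2 * s) := ⟨by linarith, by linarith⟩
  rw [edgeHeight, ← zetaReal_zero]
  exact strictMonoOn_zetaReal ⟨le_rfl, zero_le_one⟩
    (rectHarmonic_mem_Icc (by linarith) (by linarith) hxm ⟨hym.1.le, hym.2.le⟩)
    (rectHarmonic_pos (by linarith) hxm hym)

theorem edgeHeight_lt_one {L s x y : ℝ} (hs : 0 ≤ s) (hx : x ∈ Ioo s (L - s)) (hy : |y| ≤ s) :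
    edgeHeight L s x y < 1 := by
  rcases hs.eq_or_lt with rfl | hs
  · rw [edgeHeight_zero]; norm_num
  have := abs_le.1 hy
  exact zetaReal_lt_one (rectHarmonic_lt_one (by linarith) ⟨by linarith [hx.1], by linarith [hx.2]⟩
    ⟨by linarith, by linarith⟩)

/-- The height decreases from a short side towards the middle of the edge: compare it with its
reflection in the line `x = (x₁ + x₂) / 2`. -/
theorem edgeHeight_strictAnti {L s x₁ x₂ y : ℝ} (h₁ : s ≤ x₁) (h₁₂ : x₁ < x₂)
    (h₂ : x₂ ≤ L / 2) (hy : |y| < s) : edgeHeight L s x₂ y < edgeHeight L s x₁ y := by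
  have hs : 0 < s := (abs_nonneg y).trans_lt hy
  have hya := abs_lt.1 hy
  rcases h₁.eq_or_lt with rfl | h₁
  · rw [edgeHeight_eq_one (by linarith) hy]
    exact edgeHeight_lt_one hs.le ⟨h₁₂, by linarith⟩ hy.le
  set c := (x₁ + x₂) / 2 with hc
  have hlt := rectHarmonic_lt_of_le_on_sides (x₁ := s) (x₂ := c) (y₁ := -s) (y₂ := s)
    (a := L - 2 * s) (b := 2 * s) (c := L - 2 * c - s) (d := s)
    (a' := L - 2 * s) (b' := 2 * s) (c' := -s) (d' := s) (x := x₁) (y := y)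
    (by linarith) (by linarith) (by linarith) (by linarith) (by linarith) (by linarith)
    (by linarith) (by linarith) ?_ ?_ ?_ ?_ ⟨h₁, by linarith⟩ hya
  · have e : edgeHeight L s x₂ y = zetaReal (rectHarmonic (L - 2 * s) (2 * s)
        (x₁ + (L - 2 * c - s)) (y + s)) := by
      rw [← edgeHeight_reflect, edgeHeight]
      congr 2
      rw [hc]; ring
    rw [e, edgeHeight, ← sub_eq_add_neg x₁ s] at *
    have hym : y + s ∈ Icc 0 (2 * s) := ⟨by linarith, by linarith⟩
    refine strictMonoOn_zetaReal (rectHarmonic_mem_Icc (by linarith) (by linarith) ?_ hym)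
      (rectHarmonic_mem_Icc (by linarith) (by linarith) ?_ hym) hlt
    · constructor <;> linarith
    · constructor <;> linarith
  · rintro z ⟨⟨hz1, hz2⟩, ⟨hz3, hz4⟩, -⟩
    refine ⟨⟨by simp only; linarith, by simp only; linarith⟩,
      ⟨by simp only; linarith, by simp only; linarith⟩, ?_⟩
    rintro ⟨h | h, -⟩ <;> simp only at h <;> linarith
  · rintro z ⟨⟨hz1, hz2⟩, ⟨hz3, hz4⟩, hne⟩
    refine ⟨⟨by simp only; linarith, by simp only; linarith⟩,
      ⟨by simp only; linarith, by simp only; linarith⟩, ?_⟩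
    rintro ⟨h | h, h'⟩ <;> simp only at h h'
    · refine hne ⟨Or.inl (by linarith), h'.imp (fun h' => by linarith) (fun h' => by linarith)⟩
    · linarith
  · rintro z ⟨⟨hz1, hz2⟩, ⟨hz3, hz4⟩, hne⟩ hside
    have hz1m : z.re + (L - 2 * c - s) ∈ Icc 0 (L - 2 * s) := ⟨by linarith, by linarith⟩
    have hz2m : z.re + -s ∈ Icc 0 (L - 2 * s) := ⟨by linarith, by linarith⟩
    by_cases him : z.im = -s ∨ z.im = s
    · have : z.im + s = 0 ∨ z.im + s = 2 * s :=
        him.imp (fun h => by linarith) (fun h => by linarith)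
      rw [rectHarmonic_horizontal (by linarith) hz1m this,
        rectHarmonic_horizontal (by linarith) hz2m this]
    · have hre : z.re = s ∨ z.re = c := by tauto
      rcases hre with hre | hre
      · push Not at him
        have h3 : z.im + s ∈ Ioo 0 (2 * s) :=
          ⟨by linarith [lt_of_le_of_ne hz3 him.1.symm], by linarith [lt_of_le_of_ne hz4 him.2]⟩
        have h4 : z.re + -s = 0 := by linarith
        rw [h4, rectHarmonic_left (by linarith) h3]
        exact (rectHarmonic_mem_Icc (by linarith) (by linarith) hz1m ⟨h3.1.le, h3.2.le⟩).2
      · rw [← rectHarmonic_reflect]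
        apply le_of_eq
        congr 1
        rw [hre]; ring
  · refine ⟨⟨s, y⟩, ⟨⟨le_rfl, by simp only; linarith⟩, ⟨hya.1.le, hya.2.le⟩, ?_⟩, ?_⟩
    · rintro ⟨-, h | h⟩ <;> simp only at h <;> linarith
    · simp only
      rw [add_neg_cancel, rectHarmonic_left (by linarith) ⟨by linarith, by linarith⟩]
      exact rectHarmonic_lt_one (by linarith) ⟨by linarith, by linarith⟩
        ⟨by linarith, by linarith⟩

/-- The height increases with the width of the strip. -/
theorem edgeHeight_strictMono {L s s' x y : ℝ} (hs : 0 ≤ s) (hss : s < s') (hL : 2 * s' < L)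
    (hx : x ∈ Icc s' (L - s')) (hy : |y| ≤ s) : edgeHeight L s x y < edgeHeight L s' x y := by
  have hy' : |y| < s' := hy.trans_lt hss
  have hya := abs_le.1 hy
  rcases hy.eq_or_lt with h | hlt
  · rw [edgeHeight_eq_zero hs ⟨by linarith [hx.1], by linarith [hx.2]⟩ h]
    exact edgeHeight_pos hL hx hy'
  have hs0 : 0 < s := (abs_nonneg y).trans_lt hlt
  have hya' := abs_lt.1 hlt
  rcases hx.1.eq_or_lt with rfl | hx1
  · rw [edgeHeight_eq_one hL hy']
    exact edgeHeight_lt_one hs ⟨hss, by linarith [hx.2]⟩ hy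
  rcases hx.2.eq_or_lt with rfl | hx2
  · rw [edgeHeight_reflect, edgeHeight_reflect, edgeHeight_eq_one hL hy']
    exact edgeHeight_lt_one hs ⟨hss, by linarith⟩ hy
  have key := rectHarmonic_lt_of_le_on_sides (x₁ := s') (x₂ := L - s') (y₁ := -s) (y₂ := s)
    (a := L - 2 * s) (b := 2 * s) (c := - s) (d := s)
    (a' := L - 2 * s') (b' := 2 * s') (c' := -s') (d' := s') (x := x) (y := y)
    (by linarith) (by linarith) (by linarith) (by linarith) (by linarith) (by linarith)
    (by linarith) (by linarith) ?_ ?_ ?_ ?_ ⟨hx1, hx2⟩ hya'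
  · rw [← sub_eq_add_neg, ← sub_eq_add_neg] at key
    exact strictMonoOn_zetaReal (rectHarmonic_mem_Icc (by linarith) (by linarith)
      ⟨by linarith, by linarith⟩ ⟨by linarith, by linarith⟩)
      (rectHarmonic_mem_Icc (by linarith) (by linarith)
      ⟨by linarith, by linarith⟩ ⟨by linarith, by linarith⟩) key
  · rintro z ⟨⟨hz1, hz2⟩, ⟨hz3, hz4⟩, -⟩
    refine ⟨⟨by simp only; linarith, by simp only; linarith⟩,
      ⟨by simp only; linarith, by simp only; linarith⟩, ?_⟩
    rintro ⟨h | h, -⟩ <;> simp only at h <;> linarith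
  · rintro z ⟨⟨hz1, hz2⟩, ⟨hz3, hz4⟩, -⟩
    refine ⟨⟨by simp only; linarith, by simp only; linarith⟩,
      ⟨by simp only; linarith, by simp only; linarith⟩, ?_⟩
    rintro ⟨-, h | h⟩ <;> simp only at h <;> linarith
  · rintro z ⟨⟨hz1, hz2⟩, ⟨hz3, hz4⟩, hne⟩ hside
    have hz1m : z.re + -s ∈ Icc 0 (L - 2 * s) := ⟨by linarith, by linarith⟩
    have hz2m : z.re + -s' ∈ Icc 0 (L - 2 * s') := ⟨by linarith, by linarith⟩
    have hz3m : z.im + s ∈ Icc 0 (2 * s) := ⟨by linarith, by linarith⟩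
    have hz4m : z.im + s' ∈ Ioo 0 (2 * s') := ⟨by linarith, by linarith⟩
    by_cases him : z.im = -s ∨ z.im = s
    · have : z.im + s = 0 ∨ z.im + s = 2 * s :=
        him.imp (fun h => by linarith) (fun h => by linarith)
      rw [rectHarmonic_horizontal (by linarith) hz1m this]
      exact (rectHarmonic_mem_Icc (by linarith) (by linarith) hz2m ⟨hz4m.1.le, hz4m.2.le⟩).1
    · have hre : z.re = s' ∨ z.re = L - s' := by tauto
      have h1 : rectHarmonic (L - 2 * s') (2 * s') (z.re + -s') (z.im + s') = 1 := by
        rcases hre with hre | hre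
        · rw [hre, add_neg_cancel, rectHarmonic_left (by linarith) hz4m]
        · rw [← rectHarmonic_reflect, hre,
            show L - 2 * s' - (L - s' + -s') = 0 by ring, rectHarmonic_left (by linarith) hz4m]
      rw [h1]
      exact (rectHarmonic_mem_Icc (by linarith) (by linarith) hz1m hz3m).2
  · refine ⟨⟨s', y⟩, ⟨⟨le_rfl, by simp only; linarith⟩, hya, ?_⟩, ?_⟩
    · rintro ⟨-, h | h⟩ <;> simp only at h <;> linarith
    · simp only
      rw [add_neg_cancel, rectHarmonic_left (by linarith) ⟨by linarith, by linarith⟩]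
      exact rectHarmonic_lt_one (by linarith) ⟨by linarith, by linarith⟩
        ⟨by linarith, by linarith⟩

/-- Over the square where a strip around a horizontal edge crosses a strip around a vertical edge,
the first surface lies below the second one. -/
theorem edgeHeight_crossing {L M s s' m n u y : ℝ} (hs : 0 ≤ s) (hs' : 0 ≤ s')
    (hm : m ∈ Ioo (s + s') (L - (s + s'))) (hn : n ∈ Ioo (s + s') (M - (s + s')))
    (hu : |u| ≤ s') (hy : |y| ≤ s) :
    edgeHeight L s (m + u) y < 1 - edgeHeight M s' (n + y) u := by
  have hua := abs_le.1 hu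
  have hya := abs_le.1 hy
  obtain ⟨hm1, hm2⟩ := hm
  obtain ⟨hn1, hn2⟩ := hn
  have h1 : edgeHeight L s (m + u) y < 1 :=
    edgeHeight_lt_one hs ⟨by linarith, by linarith⟩ hy
  have h2 : edgeHeight M s' (n + y) u < 1 :=
    edgeHeight_lt_one hs' ⟨by linarith, by linarith⟩ hu
  rcases hy.eq_or_lt with h | hy'
  · rw [edgeHeight_eq_zero hs ⟨by linarith, by linarith⟩ h]; linarith
  rcases hu.eq_or_lt with h | hu'
  · rw [edgeHeight_eq_zero hs' ⟨by linarith, by linarith⟩ h]; linarith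
  have hs0 : 0 < s := (abs_nonneg y).trans_lt hy'
  have hs0' : 0 < s' := (abs_nonneg u).trans_lt hu'
  have key := rectHarmonic_lt_of_le_on_sides (x₁ := -s') (x₂ := s') (y₁ := -s) (y₂ := s)
    (a := L - 2 * s) (b := 2 * s) (c := m - s) (d := s)
    (a' := 2 * s') (b' := M - 2 * s') (c' := s') (d' := n - s') (x := u) (y := y)
    (by linarith) (by linarith) (by linarith) (by linarith) (by linarith) (by linarith)
    (by linarith) (by linarith) ?_ ?_ ?_ ?_ (abs_lt.1 hu') (abs_lt.1 hy')
  · rw [rectHarmonic_swap (a := M - 2 * s') (b := 2 * s') (by linarith) (by linarith)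
      ⟨⟨by simp only; linarith, by simp only; linarith⟩,
      ⟨by simp only; linarith, by simp only; linarith⟩,
      by rintro ⟨h | h, -⟩ <;> simp only at h <;> linarith⟩] at key
    have hmem := rectHarmonic_mem_Icc (a := M - 2 * s') (b := 2 * s') (x := y + (n - s'))
      (y := u + s') (by linarith) (by linarith) ⟨by linarith, by linarith⟩
      ⟨by linarith, by linarith⟩
    rw [edgeHeight, edgeHeight, show n + y - s' = y + (n - s') by ring,
      show m + u - s = u + (m - s) by ring, ← zetaReal_one_sub hmem]
    exact strictMonoOn_zetaReal (rectHarmonic_mem_Icc (by linarith) (by linarith)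
      ⟨by linarith, by linarith⟩ ⟨by linarith, by linarith⟩)
      ⟨by linarith [hmem.2], by linarith [hmem.1]⟩ key
  · rintro z ⟨⟨hz1, hz2⟩, ⟨hz3, hz4⟩, -⟩
    refine ⟨⟨by simp only; linarith, by simp only; linarith⟩,
      ⟨by simp only; linarith, by simp only; linarith⟩, ?_⟩
    rintro ⟨h | h, -⟩ <;> simp only at h <;> linarith
  · rintro z ⟨⟨hz1, hz2⟩, ⟨hz3, hz4⟩, -⟩
    refine ⟨⟨by simp only; linarith, by simp only; linarith⟩,
      ⟨by simp only; linarith, by simp only; linarith⟩, ?_⟩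
    rintro ⟨-, h | h⟩ <;> simp only at h <;> linarith
  · rintro z ⟨⟨hz1, hz2⟩, ⟨hz3, hz4⟩, hne⟩ hside
    have hz1m : z.re + (m - s) ∈ Icc 0 (L - 2 * s) := ⟨by linarith, by linarith⟩
    have hz2m : z.re + s' ∈ Icc 0 (2 * s') := ⟨by linarith, by linarith⟩
    have hz3m : z.im + s ∈ Icc 0 (2 * s) := ⟨by linarith, by linarith⟩
    have hz4m : z.im + (n - s') ∈ Ioo 0 (M - 2 * s') := ⟨by linarith, by linarith⟩
    by_cases him : z.im = -s ∨ z.im = s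
    · have : z.im + s = 0 ∨ z.im + s = 2 * s :=
        him.imp (fun h => by linarith) (fun h => by linarith)
      rw [rectHarmonic_horizontal (by linarith) hz1m this]
      exact (rectHarmonic_mem_Icc (by linarith) (by linarith) hz2m ⟨hz4m.1.le, hz4m.2.le⟩).1
    · have hre : z.re = -s' ∨ z.re = s' := by tauto
      have h1 : rectHarmonic (2 * s') (M - 2 * s') (z.re + s') (z.im + (n - s')) = 1 := by
        rcases hre with hre | hre
        · rw [hre, neg_add_cancel, rectHarmonic_left (by linarith) hz4m]
        · rw [← rectHarmonic_reflect, hre,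
            show 2 * s' - (s' + s') = 0 by ring, rectHarmonic_left (by linarith) hz4m]
      rw [h1]
      exact (rectHarmonic_mem_Icc (by linarith) (by linarith) hz1m hz3m).2
  · refine ⟨⟨-s', y⟩, ⟨⟨le_rfl, by simp only; linarith⟩, hya, ?_⟩, ?_⟩
    · have := abs_lt.1 hy'
      rintro ⟨-, h | h⟩ <;> simp only at h <;> linarith
    · simp only
      rw [neg_add_cancel, rectHarmonic_left (by linarith) ⟨by linarith, by linarith⟩]
      exact rectHarmonic_lt_one (by linarith) ⟨by linarith, by linarith⟩
        ⟨by linarith, by linarith⟩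

/-- Joint continuity of the height in the width of the strip, down to width `0`, and the point. -/
theorem continuousOn_edgeHeight (L : ℝ) :
    ContinuousOn (fun p : ℝ × ℝ × ℝ => edgeHeight L p.1 p.2.1 p.2.2)
      {p | 0 ≤ p.1 ∧ 2 * p.1 < L ∧ p.2.1 ∈ Icc p.1 (L - p.1) ∧ |p.2.2| ≤ p.1 ∧
        ¬ ((p.2.1 = p.1 ∨ p.2.1 = L - p.1) ∧ |p.2.2| = p.1)} := by
  set S := {p : ℝ × ℝ × ℝ | 0 ≤ p.1 ∧ 2 * p.1 < L ∧ p.2.1 ∈ Icc p.1 (L - p.1) ∧ |p.2.2| ≤ p.1 ∧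
        ¬ ((p.2.1 = p.1 ∨ p.2.1 = L - p.1) ∧ |p.2.2| = p.1)} with hS
  refine continuousOn_zetaReal.comp
    (f := fun p : ℝ × ℝ × ℝ => rectHarmonic (L - 2 * p.1) (2 * p.1) (p.2.1 - p.1) (p.2.2 + p.1))
    ?_ ?_
  · intro p hp
    -- near `p` the length `L - 2 s` of the rectangle stays away from `0`
    set a₀ := (L - 2 * p.1) / 2 with ha₀
    have ha₀pos : 0 < a₀ := by linarith [hp.2.1]
    have hLpos : 0 < L := by linarith [hp.1, hp.2.1]
    have hev : {q : ℝ × ℝ × ℝ | a₀ < L - 2 * q.1} ∈ 𝓝 p :=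
      (isOpen_lt (by fun_prop) (by fun_prop)).mem_nhds (by simp only [mem_ofPred_eq]; linarith)
    have h := (continuousOn_rectHarmonic ha₀pos hLpos).comp
      (f := fun p : ℝ × ℝ × ℝ => (L - 2 * p.1, 2 * p.1, p.2.1 - p.1, p.2.2 + p.1))
      (s := S ∩ {q | a₀ < L - 2 * q.1}) (by fun_prop) ?_
    · exact (continuousWithinAt_inter hev).1 (h p ⟨hp, by simp only [mem_ofPred_eq]; linarith⟩)
    · rintro q ⟨⟨h1, h2, h3, h4, h5⟩, h6⟩
      have h7 := abs_le.1 h4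
      simp only [mem_ofPred_eq] at h6
      refine ⟨h6.le, ⟨by simp only; linarith, by simp only; linarith⟩,
        ⟨by simp only; linarith [h3.1], by simp only; linarith [h3.2]⟩,
        ⟨by simp only; linarith, by simp only; linarith⟩, ?_⟩
      rintro ⟨h8, h9⟩
      simp only at h8 h9
      refine h5 ⟨h8.imp (fun h => by linarith) (fun h => by linarith), ?_⟩
      rcases h9 with h9 | h9
      · rw [show q.2.2 = -q.1 by linarith, abs_neg, abs_of_nonneg h1]
      · rw [show q.2.2 = q.1 by linarith, abs_of_nonneg h1]
  · rintro p ⟨h1, h2, h3, h4, h5⟩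
    simp only
    rcases h1.eq_or_lt with h0 | h0
    · rw [← h0, mul_zero, rectHarmonic_zero]; simp
    · have h7 := abs_le.1 h4
      exact rectHarmonic_mem_Icc (by linarith) (by linarith)
        ⟨by linarith [h3.1], by linarith [h3.2]⟩
        ⟨by linarith, by linarith⟩

theorem zeta_tileHarmonic_horizontal {L s : ℝ} (hs : 0 < s) (hL : 2 * s < L) {z : ℂ}
    (hz : z ∈ puncturedRect (L - 2 * s) (2 * s)) :
    (zeta (tileHarmonic (L - 2 * s) (2 * s) z) : ℝ) = edgeHeight L s (z.re + s) (z.im - s) := by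
  rw [tileHarmonic_eq (by linarith) (by linarith) hz, edgeHeight, add_sub_cancel_right,
    sub_add_cancel]
  rfl

theorem zeta_tileHarmonic_vertical {L s : ℝ} (hs : 0 < s) (hL : 2 * s < L) {z : ℂ}
    (hz : z ∈ puncturedRect (2 * s) (L - 2 * s)) :
    (zeta (tileHarmonic (2 * s) (L - 2 * s) z) : ℝ) =
      1 - edgeHeight L s (z.im + s) (z.re - s) := by
  have hz' : (⟨z.im, z.re⟩ : ℂ) ∈ puncturedRect (L - 2 * s) (2 * s) :=
    ⟨hz.2.1, hz.1, fun h => hz.2.2 ⟨h.2, h.1⟩⟩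
  rw [tileHarmonic_eq (by linarith) (by linarith) hz, edgeHeight, add_sub_cancel_right,
    sub_add_cancel, rectHarmonic_swap (by linarith) (by linarith) hz']
  exact zetaReal_one_sub (rectHarmonic_mem_Icc (by linarith) (by linarith) hz.2.1 hz.1)

/-! ### Arcs of the circle -/

theorem coe_arcLength (x y : S1) : ((arcLength x y : ℝ) : S1) = y - x := by
  have := (AddCircle.equivIco (2 * π) 0).symm_apply_apply (y - x)
  exact this

theorem add_arcLength (x y : S1) : x + ((arcLength x y : ℝ) : S1) = y := by
  rw [coe_arcLength, add_sub_cancel]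

theorem arcLength_mem (x y : S1) : arcLength x y ∈ Ico 0 (2 * π) := by
  have := (AddCircle.equivIco (2 * π) 0 (y - x)).2
  exact ⟨this.1, this.2.trans_eq (zero_add _)⟩

/-- A real number of absolute value less than `2π` representing `0` in the circle is `0`. -/
theorem eq_zero_of_coe_eq_zero {r : ℝ} (h : ((r : ℝ) : S1) = 0) (h₁ : -(2 * π) < r)
    (h₂ : r < 2 * π) : r = 0 := by
  obtain ⟨n, hn⟩ := (AddCircle.coe_eq_zero_iff (2 * π)).1 h
  have hpi := Real.pi_pos
  rw [zsmul_eq_mul] at hn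
  have hn1 : (n : ℝ) < 1 := by
    by_contra hc
    push Not at hc
    nlinarith
  have hn2 : (-1 : ℝ) < n := by
    by_contra hc
    push Not at hc
    nlinarith
  have : n = 0 := by
    have h1 : n < 1 := by exact_mod_cast hn1
    have h2 : -1 < n := by exact_mod_cast hn2
    omega
  rw [← hn, this]
  simp

theorem coe_inj_of_abs_lt {r r' : ℝ} (h : ((r : ℝ) : S1) = (r' : ℝ)) (h' : |r - r'| < 2 * π) :
    r = r' := by
  have h1 : ((r - r' : ℝ) : S1) = 0 := by rw [AddCircle.coe_sub, h, sub_self]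
  have := eq_zero_of_coe_eq_zero h1 (abs_lt.1 h').1 (abs_lt.1 h').2
  linarith

theorem arcLength_add {x : S1} {r : ℝ} (h₀ : 0 ≤ r) (h₁ : r < 2 * π) :
    arcLength x (x + (r : S1)) = r := by
  have h2 := arcLength_mem x (x + (r : S1))
  apply coe_inj_of_abs_lt
  · rw [coe_arcLength, add_sub_cancel_left]
  · rw [abs_lt]; constructor <;> linarith [h2.1, h2.2]

theorem dist_le_of_add_eq {x y : S1} {r : ℝ} (h : x + (r : S1) = y) : dist x y ≤ |r| := by
  rw [← h, dist_self_add_right]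
  exact QuotientAddGroup.norm_mk_le_norm

theorem arcLength_add_arcLength {x y : S1} (h : x ≠ y) : arcLength x y + arcLength y x = 2 * π := by
  have h1 := arcLength_mem x y
  have h2 := arcLength_mem y x
  have h3 : ((arcLength x y + arcLength y x - 2 * π : ℝ) : S1) = 0 := by
    rw [AddCircle.coe_sub, AddCircle.coe_add, coe_arcLength, coe_arcLength, AddCircle.coe_period]
    abel
  have hpos : 0 < arcLength x y + arcLength y x := by
    refine lt_of_le_of_ne (add_nonneg h1.1 h2.1) fun h0 => h ?_
    have h4 : arcLength x y = 0 := by linarith [h1.1, h2.1]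
    have := add_arcLength x y
    rw [h4] at this
    simpa using this
  have := eq_zero_of_coe_eq_zero h3 (by linarith) (by linarith [h1.2, h2.2])
  linarith

theorem dist_le_pi (x y : S1) : dist x y ≤ π := by
  have := AddCircle.norm_le_half_period (2 * π) (x := x - y) (by positivity)
  rw [dist_eq_norm]
  rwa [abs_of_pos Real.two_pi_pos, mul_div_cancel_left₀ _ two_ne_zero] at this

/-! ### Combinatorial data of a rectangular diagram of a link -/

/-- The vertices of a rectangular diagram of a link, indexed by `ι`, with the involutions exchanging
the ends of the horizontal edges and of the vertical edges, and a radius `t` such that distinct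
meridians and distinct longitudes of the diagram are more than `2t` apart. -/
structure EdgeData (ι : Type) where
  θ : ι → S1
  φ : ι → S1
  h : ι → ι
  v : ι → ι
  t : ℝ
  h_h : ∀ i, h (h i) = i
  v_v : ∀ i, v (v i) = i
  φ_h : ∀ i, φ (h i) = φ i
  θ_v : ∀ i, θ (v i) = θ i
  θ_h_ne : ∀ i, θ (h i) ≠ θ i
  φ_v_ne : ∀ i, φ (v i) ≠ φ i
  eq_of_θ_eq : ∀ i j, θ i = θ j → j = i ∨ j = v i
  eq_of_φ_eq : ∀ i j, φ i = φ j → j = i ∨ j = h i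
  t_pos : 0 < t
  θ_sep : ∀ i j, θ i ≠ θ j → 2 * t < dist (θ i) (θ j)
  φ_sep : ∀ i j, φ i ≠ φ j → 2 * t < dist (φ i) (φ j)

/-- The sign `1` or `-1` of a direction. -/
def sgn (ε : Bool) : ℝ := if ε then 1 else -1

@[simp] theorem sgn_true : sgn true = 1 := rfl
@[simp] theorem sgn_false : sgn false = -1 := rfl
theorem sgn_not (ε : Bool) : sgn (!ε) = -sgn ε := by cases ε <;> simp
theorem sgn_mul_self (ε : Bool) : sgn ε * sgn ε = 1 := by cases ε <;> simp
theorem abs_sgn (ε : Bool) : |sgn ε| = 1 := by cases ε <;> simp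
theorem abs_sgn_mul (ε : Bool) (x : ℝ) : |sgn ε * x| = |x| := by rw [abs_mul, abs_sgn, one_mul]

namespace EdgeData

variable {ι : Type} (D : EdgeData ι)

/-- Exchange of the two coordinates of the torus. -/
def swap : EdgeData ι where
  θ := D.φ
  φ := D.θ
  h := D.v
  v := D.h
  t := D.t
  h_h := D.v_v
  v_v := D.h_h
  φ_h := D.θ_v
  θ_v := D.φ_h
  θ_h_ne := D.φ_v_ne
  φ_v_ne := D.θ_h_ne
  eq_of_θ_eq := D.eq_of_φ_eq
  eq_of_φ_eq := D.eq_of_θ_eq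
  t_pos := D.t_pos
  θ_sep := D.φ_sep
  φ_sep := D.θ_sep

/-- The same diagram with a smaller radius. -/
def withRadius (s : ℝ) (hs : 0 < s) (hst : s ≤ D.t) : EdgeData ι where
  __ := D
  t := s
  t_pos := hs
  θ_sep := fun i j h => lt_of_le_of_lt (by linarith) (D.θ_sep i j h)
  φ_sep := fun i j h => lt_of_le_of_lt (by linarith) (D.φ_sep i j h)

/-- The length of the arc going from `θ i` to `θ (h i)` in the direction `ε`. -/
def len (i : ι) (ε : Bool) : ℝ :=
  if ε then arcLength (D.θ i) (D.θ (D.h i)) else arcLength (D.θ (D.h i)) (D.θ i)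

theorem len_h (i : ι) (ε : Bool) : D.len (D.h i) (!ε) = D.len i ε := by
  cases ε <;> simp [len, D.h_h]

theorem θ_h (i : ι) (ε : Bool) : D.θ i + ((sgn ε * D.len i ε : ℝ) : S1) = D.θ (D.h i) := by
  cases ε
  · simp only [len, sgn_false, neg_mul, one_mul, AddCircle.coe_neg, Bool.false_eq_true, if_false]
    rw [← sub_eq_add_neg, sub_eq_iff_eq_add, add_arcLength]
  · simp only [len, sgn_true, one_mul, if_true, add_arcLength]

theorem two_t_lt_len (i : ι) (ε : Bool) : 2 * D.t < D.len i ε := by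
  have h := D.θ_sep i (D.h i) (D.θ_h_ne i).symm
  have h1 := dist_le_of_add_eq (D.θ_h i ε)
  have h2 : 0 ≤ D.len i ε := by
    cases ε <;> simp only [len, if_true, if_false, Bool.false_eq_true] <;>
      exact (arcLength_mem _ _).1
  rw [abs_sgn_mul, abs_of_nonneg h2] at h1
  linarith

theorem len_add_len (i : ι) (ε : Bool) : D.len i ε + D.len i (!ε) = 2 * π := by
  cases ε
  · simpa [len] using arcLength_add_arcLength (D.θ_h_ne i)
  · simpa [len] using arcLength_add_arcLength (D.θ_h_ne i).symm

theorem len_lt (i : ι) (ε : Bool) : D.len i ε < 2 * π - 2 * D.t := by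
  have h1 := D.len_add_len i ε
  have h2 := D.two_t_lt_len i (!ε)
  linarith

theorem two_t_lt_pi (i : ι) : 2 * D.t < π :=
  (D.θ_sep i (D.h i) (D.θ_h_ne i).symm).trans_le (dist_le_pi _ _)

/-- Points at distance at most `t` from two meridians of the diagram coincide only if the
meridians do. -/
theorem θ_eq_of_add_eq {i j : ι} {a b : ℝ} (h : D.θ i + (a : S1) = D.θ j + (b : S1))
    (hab : |a - b| ≤ 2 * D.t) : D.θ i = D.θ j ∧ a = b := by
  have hθ : D.θ i = D.θ j := by
    by_contra hne
    have h1 := D.θ_sep i j hne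
    have h2 : D.θ i + ((a - b : ℝ) : S1) = D.θ j := by
      rw [AddCircle.coe_sub, ← add_sub_assoc, h, add_sub_cancel_right]
    linarith [dist_le_of_add_eq h2]
  refine ⟨hθ, coe_inj_of_abs_lt (r := a) (r' := b) ?_ ?_⟩
  · rw [hθ] at h
    exact add_left_cancel h
  · linarith [D.two_t_lt_pi i, Real.pi_pos]

/-- The first half of an edge is far from the other end of the edge. -/
theorem θ_ne_of_le_half {i : ι} {ε : Bool} {x u : ℝ} (hx₀ : 0 ≤ x) (hx : x ≤ D.len i ε / 2)
    (hu : |u| ≤ D.t) :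
    D.θ i + ((sgn ε * x : ℝ) : S1) ≠ D.θ (D.h i) + (u : S1) := by
  intro h
  rw [← D.θ_h i ε, add_assoc] at h
  have h1 := add_left_cancel h
  have h2 := D.two_t_lt_len i ε
  have h3 := D.len_lt i ε
  have h4 := abs_le.1 hu
  have h5 := D.t_pos
  rw [← AddCircle.coe_add] at h1
  have h6 := coe_inj_of_abs_lt h1 (by
    rw [abs_lt]; cases ε <;> simp only [sgn_true, sgn_false] <;> constructor <;> linarith)
  cases ε <;> simp only [sgn_true, sgn_false] at h6 <;> linarith

/-- The halves of an edge at the two ends of the edge meet only in the midpoint. -/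
theorem θ_half_eq_iff {i : ι} {ε ε' : Bool} {x x' : ℝ} (hx₀ : 0 ≤ x) (hx : x ≤ D.len i ε / 2)
    (hx₀' : 0 ≤ x') (hx' : x' ≤ D.len (D.h i) ε' / 2)
    (h : D.θ i + ((sgn ε * x : ℝ) : S1) = D.θ (D.h i) + ((sgn ε' * x' : ℝ) : S1)) :
    ε' = !ε ∧ x = D.len i ε / 2 ∧ x' = D.len i ε / 2 := by
  rw [← D.θ_h i ε, add_assoc] at h
  have h1 := add_left_cancel h
  have h2 := D.two_t_lt_len i ε
  have h3 := D.len_lt i ε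
  have h5 := D.t_pos
  rw [← AddCircle.coe_add] at h1
  by_cases he : ε' = !ε
  · subst he
    rw [D.len_h] at hx'
    have h6 := coe_inj_of_abs_lt h1 (by
      rw [sgn_not, abs_lt]
      cases ε <;> simp only [sgn_true, sgn_false] <;> constructor <;> linarith)
    rw [sgn_not] at h6
    refine ⟨rfl, ?_⟩
    cases ε <;> simp only [sgn_true, sgn_false] at h6 <;> constructor <;> linarith
  · have he' : ε' = ε := by cases ε <;> cases ε' <;> simp_all
    subst he'
    have h7 : D.len (D.h i) ε' = 2 * π - D.len i ε' := by
      have := D.len_add_len i ε'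
      have h8 := D.len_h i (!ε')
      rw [Bool.not_not] at h8
      linarith
    have h6 := coe_inj_of_abs_lt h1 (by
      rw [abs_lt]; cases ε' <;> simp only [sgn_true, sgn_false] <;> constructor <;> linarith)
    cases ε' <;> simp only [sgn_true, sgn_false] at h6 <;> exfalso <;> linarith

theorem θ_half_midpoint (i : ι) (ε : Bool) :
    D.θ i + ((sgn ε * (D.len i ε / 2) : ℝ) : S1) =
      D.θ (D.h i) + ((sgn (!ε) * (D.len i ε / 2) : ℝ) : S1) := by
  rw [← D.θ_h i ε, sgn_not, add_assoc, ← AddCircle.coe_add]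
  congr 2
  ring

/-- Every point of the circle lies over one of the two edges of a longitude. -/
theorem exists_θ_eq (i : ι) (x : S1) :
    ∃ ε r, 0 ≤ r ∧ r ≤ D.len i ε ∧ x = D.θ i + ((sgn ε * r : ℝ) : S1) := by
  have h1 := arcLength_mem (D.θ i) x
  have h2 := D.len_add_len i true
  by_cases h : arcLength (D.θ i) x ≤ D.len i true
  · exact ⟨true, _, h1.1, h, by rw [sgn_true, one_mul, add_arcLength]⟩
  · refine ⟨false, 2 * π - arcLength (D.θ i) x, by linarith [h1.2], ?_, ?_⟩
    · simp only [Bool.not_true] at h2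
      linarith
    · rw [sgn_false, neg_one_mul, neg_sub, AddCircle.coe_sub, AddCircle.coe_period, sub_zero,
        add_arcLength]

end EdgeData

/-! ### Orienting the link -/

/-- Two fixed-point-free involutions `h`, `v` admit a colouring in two colours that both of them
change: the orbits of `v ∘ h` come in pairs exchanged by `h`. -/
theorem exists_coloring {ι : Type} [Finite ι] (h v : ι → ι) (hh : ∀ i, h (h i) = i)
    (vv : ∀ i, v (v i) = i) (hne : ∀ i, h i ≠ i) (vne : ∀ i, v i ≠ i) :
    ∃ c : ι → Bool, (∀ i, c (h i) = !c i) ∧ ∀ i, c (v i) = !c i := by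
  let H : Equiv.Perm ι := ⟨h, h, hh, hh⟩
  let V : Equiv.Perm ι := ⟨v, v, vv, vv⟩
  have HH : H * H = 1 := Equiv.ext hh
  have VV : V * V = 1 := Equiv.ext vv
  have Hinv : H⁻¹ = H := inv_eq_of_mul_eq_one_left HH
  have Vinv : V⁻¹ = V := inv_eq_of_mul_eq_one_left VV
  set g : Equiv.Perm ι := V * H with hg
  have hconj : ∀ n : ℤ, H * g ^ n = g ^ (-n) * H := by
    intro n
    have h1 : H * g * H⁻¹ = g⁻¹ := by
      rw [hg, mul_inv_rev, Hinv, Vinv, mul_assoc, mul_assoc, HH, mul_one]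
    have h2 : H * g ^ n * H⁻¹ = g ^ (-n) := by
      rw [← conj_zpow, h1, inv_zpow, zpow_neg]
    rw [← h2, inv_mul_cancel_right]
  -- a reflection in the dihedral group generated by `h`, `v` has no fixed points
  have key : ∀ (n : ℤ) (i : ι), H i ≠ (g ^ n) i := by
    intro n i hi
    rcases Int.even_or_odd' n with ⟨m, rfl | rfl⟩
    · apply hne ((g ^ m) i)
      change H ((g ^ m) i) = _
      rw [← Equiv.Perm.mul_apply, hconj, Equiv.Perm.mul_apply, hi, ← Equiv.Perm.mul_apply,
        ← zpow_add]
      congr 2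
      ring
    · have h1 : H ((g ^ m) i) = g ((g ^ m) i) := by
        rw [← Equiv.Perm.mul_apply, hconj, Equiv.Perm.mul_apply, hi, ← Equiv.Perm.mul_apply,
          ← zpow_add, ← Equiv.Perm.mul_apply, ← zpow_one_add]
        congr 2
        ring
      apply vne (H ((g ^ m) i))
      rw [hg, Equiv.Perm.mul_apply] at h1
      exact h1.symm
  let O := Quotient (Equiv.Perm.SameCycle.setoid g)
  let q : ι → O := Quotient.mk _
  have hq : ∀ i j, q i = q j ↔ Equiv.Perm.SameCycle g i j := fun i j => Quotient.eq
  have hqH : ∀ i j, q i = q j → q (h i) = q (h j) := by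
    intro i j hij
    obtain ⟨n, hn⟩ := (hq i j).1 hij
    refine (hq _ _).2 ⟨-n, ?_⟩
    change (g ^ (-n)) (H i) = H j
    rw [← Equiv.Perm.mul_apply, ← hconj, Equiv.Perm.mul_apply, hn]
  have hqne : ∀ i, q (h i) ≠ q i := by
    intro i hi
    obtain ⟨n, hn⟩ := (hq _ _).1 hi.symm
    exact key n i hn.symm
  have hqv : ∀ i, q (v i) = q (h i) := by
    intro i
    refine (hq _ _).2 ⟨-1, ?_⟩
    have h2 : g (H i) = V i := by
      rw [hg, Equiv.Perm.mul_apply]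
      change v (h (h i)) = v i
      rw [hh]
    change (g ^ (-1 : ℤ)) (V i) = H i
    rw [← h2, zpow_neg_one]
    exact Equiv.Perm.inv_eq_iff_eq.2 rfl
  obtain ⟨N, ⟨f⟩⟩ := Finite.exists_equiv_fin O
  have hflip : ∀ i j, q j = q (h i) → decide (f (q j) < f (q (h j))) =
      !decide (f (q i) < f (q (h i))) := by
    intro i j hj
    have h1 : q (h j) = q i := by rw [hqH _ _ hj, hh]
    rw [hj, h1]
    have h2 : f (q (h i)) ≠ f (q i) := fun h => hqne i (f.injective h)
    rcases lt_or_gt_of_ne h2 with h3 | h3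
    · simp [h3, h3.le]
    · simp [h3, h3.le]
  exact ⟨fun i => decide (f (q i) < f (q (h i))), fun i => hflip i _ rfl,
    fun i => hflip i _ (hqv i)⟩

/-! ### Half-tiles -/

/-- The half-tiles over the first half of an edge of length `L`, for all radii `s ≤ t`, with the
corners `(s, ±s)` blown up to segments: `s` is the radius, `x` the distance along the edge, `y` the
distance from the edge, and `τ` the height. For `s = 0` the half-tile degenerates to the core. -/
structure InTri (t L s x y τ : ℝ) : Prop where
  s_nonneg : 0 ≤ s
  s_le : s ≤ t
  s_le_x : s ≤ x
  x_le : x ≤ L / 2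
  y_le : |y| ≤ s
  τ_nonneg : 0 ≤ τ
  τ_le : τ ≤ 1
  corner_or : (x = s ∧ |y| = s) ∨ τ = edgeHeight L s x y

/-- The coordinate along the core: it is `0` at the midpoint of the edge and `1` at the short side
of the tile, and equals `τ` on the segment over a corner. -/
def coreParam (L s y τ : ℝ) : ℝ := (τ - edgeHeight L s (L / 2) y) / (1 - edgeHeight L s (L / 2) y)

theorem mid_lt_one {L s y : ℝ} (hs : 0 ≤ s) (hL : 2 * s < L) (hy : |y| ≤ s) :
    edgeHeight L s (L / 2) y < 1 :=
  edgeHeight_lt_one hs ⟨by linarith, by linarith⟩ hy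

theorem mid_eq_zero {L s y : ℝ} (hs : 0 ≤ s) (hL : 2 * s < L) (hy : |y| = s) :
    edgeHeight L s (L / 2) y = 0 :=
  edgeHeight_eq_zero hs ⟨by linarith, by linarith⟩ hy

theorem eq_of_coreParam {L s y τ : ℝ} (hs : 0 ≤ s) (hL : 2 * s < L) (hy : |y| ≤ s) :
    τ = coreParam L s y τ + (1 - coreParam L s y τ) * edgeHeight L s (L / 2) y := by
  have h := mid_lt_one hs hL hy
  have h' : 1 - edgeHeight L s (L / 2) y ≠ 0 := by linarith
  rw [coreParam]
  field_simp
  ring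

theorem coreParam_of_abs_eq {L s y τ : ℝ} (hs : 0 ≤ s) (hL : 2 * s < L) (hy : |y| = s) :
    coreParam L s y τ = τ := by
  rw [coreParam, mid_eq_zero hs hL hy, sub_zero, sub_zero, div_one]

theorem coreParam_one {L s y : ℝ} (hs : 0 ≤ s) (hL : 2 * s < L) (hy : |y| ≤ s) :
    coreParam L s y 1 = 1 := by
  have h := mid_lt_one hs hL hy
  rw [coreParam, div_self (by linarith)]

theorem coreParam_mid (L s y : ℝ) : coreParam L s y (edgeHeight L s (L / 2) y) = 0 := by
  rw [coreParam, sub_self, zero_div]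

namespace InTri

variable {t L s x y τ : ℝ}

theorem two_s_lt (h : InTri t L s x y τ) (ht : 2 * t < L) :
    2 * s < L := by linarith [h.s_le]

theorem x_eq_of_τ_eq_one (h : InTri t L s x y τ) (ht : 2 * t < L)
    (hτ : τ = 1) : x = s := by
  rcases h.corner_or with h1 | h1
  · exact h1.1
  · by_contra hne
    have h2 : s < x := lt_of_le_of_ne h.s_le_x (Ne.symm hne)
    have h3 := h.two_s_lt ht
    have h4 := edgeHeight_lt_one (L := L) h.s_nonneg ⟨h2, by linarith [h.x_le]⟩ h.y_le
    linarith

theorem mem_Icc (h : InTri t L s x y τ) (ht : 2 * t < L) :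
    x ∈ Icc s (L - s) := ⟨h.s_le_x, by linarith [h.x_le, h.s_le]⟩

theorem abs_y_eq_of_τ_eq_zero (h : InTri t L s x y τ) (ht : 2 * t < L)
    (hτ : τ = 0) : |y| = s := by
  rcases h.corner_or with h1 | h1
  · exact h1.2
  · by_contra hne
    have h2 : |y| < s := lt_of_le_of_ne h.y_le hne
    have h3 := edgeHeight_pos (h.two_s_lt ht) (h.mem_Icc ht) h2
    linarith

theorem x_eq_of_abs_y_eq (h : InTri t L s x y τ) (ht : 2 * t < L)
    (hy : |y| = s) (hτ : τ ≠ 0) : x = s := by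
  rcases h.corner_or with h1 | h1
  · exact h1.1
  · exact absurd (h1.trans (edgeHeight_eq_zero h.s_nonneg (h.mem_Icc ht) hy)) hτ

theorem mid_le (h : InTri t L s x y τ) (ht : 2 * t < L) :
    edgeHeight L s (L / 2) y ≤ τ := by
  rcases h.y_le.eq_or_lt with h1 | h1
  · rw [mid_eq_zero h.s_nonneg (h.two_s_lt ht) h1]; exact h.τ_nonneg
  · rcases h.corner_or with h2 | h2
    · exact absurd h2.2 h1.ne
    · rw [h2]
      rcases h.x_le.eq_or_lt with h3 | h3
      · rw [h3]
      · exact (edgeHeight_strictAnti h.s_le_x h3 le_rfl h1).le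

theorem coreParam_mem (h : InTri t L s x y τ) (ht : 2 * t < L) :
    coreParam L s y τ ∈ Icc (0 : ℝ) 1 := by
  have h1 := mid_lt_one h.s_nonneg (h.two_s_lt ht) h.y_le
  have h2 := h.mid_le ht
  refine ⟨div_nonneg (by linarith) (by linarith), ?_⟩
  rw [coreParam, div_le_one (by linarith)]
  linarith [h.τ_le]

theorem τ_eq (h : InTri t L s x y τ) (ht : 2 * t < L) :
    τ = coreParam L s y τ + (1 - coreParam L s y τ) * edgeHeight L s (L / 2) y :=
  eq_of_coreParam h.s_nonneg (h.two_s_lt ht) h.y_le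

theorem τ_eq_one (h : InTri t L s x y τ) (ht : 2 * t < L)
    (hσ : coreParam L s y τ = 1) : τ = 1 := by
  have := h.τ_eq ht
  rw [hσ] at this
  linarith

theorem coreParam_eq_of_τ_eq_one (h : InTri t L s x y τ) (ht : 2 * t < L)
    (hτ : τ = 1) : coreParam L s y τ = 1 := by
  rw [hτ]; exact coreParam_one h.s_nonneg (h.two_s_lt ht) h.y_le

theorem coreParam_eq_of_abs_eq (h : InTri t L s x y τ) (ht : 2 * t < L)
    (hy : |y| = s) : coreParam L s y τ = τ :=
  coreParam_of_abs_eq h.s_nonneg (h.two_s_lt ht) hy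

/-- Points with `σ = 0` lie over the midpoint of the edge or on the core circle. -/
theorem x_eq_half_or (h : InTri t L s x y τ) (ht : 2 * t < L)
    (hσ : coreParam L s y τ = 0) :
    τ = edgeHeight L s (L / 2) y ∧ (x = L / 2 ∨ τ = 0) := by
  have h1 := h.τ_eq ht
  rw [hσ, zero_add, sub_zero, one_mul] at h1
  refine ⟨h1, ?_⟩
  by_cases h0 : τ = 0
  · exact Or.inr h0
  · left
    have hy : |y| < s := lt_of_le_of_ne h.y_le fun hy =>
      h0 (h1.trans (mid_eq_zero h.s_nonneg (h.two_s_lt ht) hy))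
    rcases h.corner_or with h2 | h2
    · exact absurd h2.2 hy.ne
    · by_contra hne
      have := edgeHeight_strictAnti h.s_le_x (lt_of_le_of_ne h.x_le hne) le_rfl hy
      linarith

/-- On a half-tile of given radius, `y` and `τ` determine the point `[θ, φ, τ]`. -/
theorem x_eq_or (h : InTri t L s x y τ) (ht : 2 * t < L)
    {x' : ℝ} (h' : InTri t L s x' y τ) : x = x' ∨ τ = 0 := by
  by_cases h0 : τ = 0
  · exact Or.inr h0
  left
  rcases h.y_le.eq_or_lt with hy | hy
  · rw [h.x_eq_of_abs_y_eq ht hy h0, h'.x_eq_of_abs_y_eq ht hy h0]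
  · rcases h.corner_or with h2 | h2
    · exact absurd h2.2 hy.ne
    rcases h'.corner_or with h3 | h3
    · exact absurd h3.2 hy.ne
    rcases lt_trichotomy x x' with h4 | h4 | h4
    · linarith [edgeHeight_strictAnti h.s_le_x h4 h'.x_le hy]
    · exact h4
    · linarith [edgeHeight_strictAnti h'.s_le_x h4 h.x_le hy]

/-- Half-tiles of different radii are disjoint. -/
theorem s_eq (h : InTri t L s x y τ) (ht : 2 * t < L)
    {s' : ℝ} (h' : InTri t L s' x y τ) : s = s' := by
  have key : ∀ {s s' : ℝ}, InTri t L s x y τ → InTri t L s' x y τ → ¬ s < s' := by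
    intro s s' h h' hlt
    have hy : |y| < s' := h.y_le.trans_lt hlt
    have hx : s < x := hlt.trans_le h'.s_le_x
    rcases h.corner_or with h1 | h1
    · exact hx.ne' h1.1
    rcases h'.corner_or with h2 | h2
    · exact hy.ne h2.2
    have := edgeHeight_strictMono h.s_nonneg hlt (h'.two_s_lt ht) (h'.mem_Icc ht) h.y_le
    linarith
  rcases lt_trichotomy s s' with h1 | h1 | h1
  · exact absurd h1 (key h h')
  · exact h1
  · exact absurd h1 (key h' h)

theorem of_s_eq_zero (h : InTri t L s x y τ) (ht : 2 * t < L)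
    (hs : s = 0) : y = 0 ∧ coreParam L s y τ = τ ∧ (τ = 0 ∨ x = 0) := by
  have hy : y = 0 := by
    have := h.y_le
    rw [hs] at this
    exact abs_nonpos_iff.1 this
  have hy' : |y| = s := by rw [hy, hs, abs_zero]
  refine ⟨hy, h.coreParam_eq_of_abs_eq ht hy', ?_⟩
  by_cases h0 : τ = 0
  · exact Or.inl h0
  · exact Or.inr ((h.x_eq_of_abs_y_eq ht hy' h0).trans hs)

end InTri

/-! ### Coordinates along and across the link -/

/-- Two triples `(θ, φ, τ)` represent the same point of the join. -/
def JoinEq (p q : S1 × S1 × ℝ) : Prop :=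
  p.2.2 = q.2.2 ∧ (p.1 = q.1 ∨ p.2.2 = 0) ∧ (p.2.1 = q.2.1 ∨ p.2.2 = 1)

/-- Exchange of the two circles of the join. -/
def joinSwap (p : S1 × S1 × ℝ) : S1 × S1 × ℝ := (p.2.1, p.1, 1 - p.2.2)

theorem joinEq_joinSwap {p q : S1 × S1 × ℝ} : JoinEq (joinSwap p) (joinSwap q) ↔ JoinEq p q := by
  simp only [JoinEq, joinSwap, sub_right_inj, sub_eq_zero, sub_eq_self, eq_comm (a := (1 : ℝ))]
  tauto

theorem JoinEq.symm {p q : S1 × S1 × ℝ} (h : JoinEq p q) : JoinEq q p :=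
  ⟨h.1.symm, h.2.1.imp Eq.symm fun h' => h.1 ▸ h', h.2.2.imp Eq.symm fun h' => h.1 ▸ h'⟩

theorem joinSwap_joinSwap (p : S1 × S1 × ℝ) : joinSwap (joinSwap p) = p := by
  simp [joinSwap]

/-- Coordinates `(i, σ, z₁, z₂)` in the neighbourhood of the arc of the link over the vertex `i`:
`σ` is the position on the arc and `z` the position in the transversal disc, whose radius is
measured by `|z₁| + |z₂|`. -/
abbrev BlockPt (ι : Type) : Type := ι × ℝ × ℝ × ℝ

/-- Exchange of the two circles of the join, in block coordinates. -/
def blockSwap {ι : Type} (p : BlockPt ι) : BlockPt ι := (p.1, 1 - p.2.1, p.2.2.2, p.2.2.1)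

theorem blockSwap_blockSwap {ι : Type} (p : BlockPt ι) : blockSwap (blockSwap p) = p := by
  simp [blockSwap]

namespace EdgeData

variable {ι : Type} (D : EdgeData ι)

/-- The gluing of the neighbourhoods of the arcs of the link at their ends. -/
def BlockRel (p q : BlockPt ι) : Prop :=
  p.2.1 = q.2.1 ∧
    ((q.1 = p.1 ∧ p.2.2.1 = q.2.2.1 ∧ p.2.2.2 = q.2.2.2) ∨
    (p.2.1 = 0 ∧ q.1 = D.h p.1 ∧ q.2.2.1 = -p.2.2.1 ∧ q.2.2.2 = p.2.2.2) ∨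
    (p.2.1 = 1 ∧ q.1 = D.v p.1 ∧ q.2.2.1 = p.2.2.1 ∧ q.2.2.2 = -p.2.2.2))

theorem blockRel_blockSwap {p q : BlockPt ι} :
    D.swap.BlockRel (blockSwap p) (blockSwap q) ↔ D.BlockRel p q := by
  simp only [BlockRel, blockSwap, swap, sub_right_inj, sub_eq_zero, sub_eq_self,
    eq_comm (a := (1 : ℝ))]
  tauto

theorem BlockRel.symm {D : EdgeData ι} {p q : BlockPt ι} (h : D.BlockRel p q) :
    D.BlockRel q p := by
  obtain ⟨h1, ⟨h2, h3, h4⟩ | ⟨h0, h2, h3, h4⟩ | ⟨h0, h2, h3, h4⟩⟩ := h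
  · exact ⟨h1.symm, Or.inl ⟨h2.symm, h3.symm, h4.symm⟩⟩
  · exact ⟨h1.symm, Or.inr (Or.inl ⟨h1 ▸ h0, by rw [h2, D.h_h], by rw [h3, neg_neg], h4.symm⟩)⟩
  · exact ⟨h1.symm, Or.inr (Or.inr ⟨h1 ▸ h0, by rw [h2, D.v_v], h3.symm, by rw [h4, neg_neg]⟩)⟩

/-- The point of the join given by a point of a half-tile over the half-edge that starts at the
vertex `i` in the direction `ε`. -/
def pos (i : ι) (ε : Bool) (p : ℝ × ℝ × ℝ × ℝ) : S1 × S1 × ℝ :=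
  (D.θ i + ((sgn ε * p.2.1 : ℝ) : S1), D.φ i + ((p.2.2.1 : ℝ) : S1), p.2.2.2)

/-- The block coordinates of a point of a half-tile. The lines `y = const` of the half-tile fan out
from its short side `σ = 1`. -/
def block (i : ι) (ε : Bool) (p : ℝ × ℝ × ℝ × ℝ) : BlockPt ι :=
  (i, coreParam (D.len i ε) p.1 p.2.2.1 p.2.2.2,
    sgn ε * (p.1 - (1 - coreParam (D.len i ε) p.1 p.2.2.1 p.2.2.2) * |p.2.2.1|),
    (1 - coreParam (D.len i ε) p.1 p.2.2.1 p.2.2.2) * p.2.2.1)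

theorem sub_coreParam_mul_nonneg {t L s x y τ : ℝ} (ht : 2 * t < L) (h : InTri t L s x y τ) :
    0 ≤ s - (1 - coreParam L s y τ) * |y| := by
  have h1 := h.coreParam_mem ht
  nlinarith [h.y_le, abs_nonneg y, h1.1, h1.2]

theorem abs_sgn_sub_le (D : EdgeData ι) {ε ε' : Bool} {s s' : ℝ} (h0 : 0 ≤ s) (h0' : 0 ≤ s')
    (h : s ≤ D.t) (h' : s' ≤ D.t) : |sgn ε * s - sgn ε' * s'| ≤ 2 * D.t := by
  rw [abs_le]
  cases ε <;> cases ε' <;> simp only [sgn_true, sgn_false] <;> constructor <;> linarith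

/-- Points of half-tiles over horizontal edges that coincide in the join have glued block
coordinates. -/
theorem blockRel_of_joinEq {i j : ι} {ε ε' : Bool} {s x y τ s' x' y' τ' : ℝ}
    (h : InTri D.t (D.len i ε) s x y τ) (h' : InTri D.t (D.len j ε') s' x' y' τ')
    (hj : JoinEq (D.pos i ε (s, x, y, τ)) (D.pos j ε' (s', x', y', τ'))) :
    D.BlockRel (D.block i ε (s, x, y, τ)) (D.block j ε' (s', x', y', τ')) := by
  have hL := D.two_t_lt_len i ε
  have hL' := D.two_t_lt_len j ε'
  obtain ⟨hτ, hθ, hφ⟩ := hj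
  simp only [pos] at hτ hθ hφ
  subst hτ
  simp only [BlockRel, block]
  -- at height `1` both points lie on the short sides of their tiles
  by_cases hτ1 : τ = 1
  · have hθ' := hθ.resolve_right (by rw [hτ1]; norm_num)
    have hx := h.x_eq_of_τ_eq_one hL hτ1
    have hx' := h'.x_eq_of_τ_eq_one hL' hτ1
    subst hx hx'
    obtain ⟨h1, h2⟩ := D.θ_eq_of_add_eq hθ'
      (D.abs_sgn_sub_le h.s_nonneg h'.s_nonneg h.s_le h'.s_le)
    rw [h.coreParam_eq_of_τ_eq_one hL hτ1, h'.coreParam_eq_of_τ_eq_one hL' hτ1]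
    refine ⟨rfl, ?_⟩
    simp only [sub_self, zero_mul, sub_zero, h2, neg_zero, and_self, and_true, true_and]
    rcases D.eq_of_θ_eq i j h1 with h3 | h3
    · exact Or.inl h3
    · exact Or.inr (Or.inr h3)
  have hφ' := hφ.resolve_right hτ1
  obtain ⟨h1, rfl⟩ := D.swap.θ_eq_of_add_eq hφ' (by
    have h3 := abs_le.1 h.y_le
    have h4 := abs_le.1 h'.y_le
    have h5 := h.s_le
    have h6 := h'.s_le
    rw [abs_le]
    change -(2 * D.t) ≤ _ ∧ _ ≤ 2 * D.t
    constructor <;> linarith)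
  -- at height `0` both points lie on the long sides of their tiles
  by_cases hτ0 : τ = 0
  · have hy := h.abs_y_eq_of_τ_eq_zero hL hτ0
    have hy' := h'.abs_y_eq_of_τ_eq_zero hL' hτ0
    rw [h.coreParam_eq_of_abs_eq hL hy, h'.coreParam_eq_of_abs_eq hL' hy', hy, ← hy', hy, hτ0]
    refine ⟨rfl, ?_⟩
    simp only [sub_zero, one_mul, sub_self, mul_zero, neg_zero, and_true, true_and]
    rcases D.eq_of_φ_eq i j h1 with h3 | h3
    · exact Or.inl h3
    · exact Or.inr (Or.inl h3)
  have hθ' := hθ.resolve_right hτ0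
  -- otherwise the half-tiles share a vertex, or they are the two halves of one tile and the points
  -- lie over the midpoint of the edge
  rcases D.eq_of_φ_eq i j h1 with rfl | rfl
  · by_cases hε : ε' = ε
    · subst hε
      have h2 := add_left_cancel hθ'
      have h3 := D.len_lt j ε'
      have h4 := D.t_pos
      have h5 := coe_inj_of_abs_lt h2 (by
        rw [← mul_sub, abs_sgn_mul, abs_lt]
        constructor <;> linarith [h.s_nonneg, h.s_le_x, h.x_le, h'.s_nonneg, h'.s_le_x, h'.x_le])
      have h6 : x = x' := by
        cases ε' <;> simp only [sgn_true, sgn_false] at h5 <;> linarith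
      subst h6
      have h7 := h.s_eq hL h'
      subst h7
      exact ⟨rfl, Or.inl ⟨rfl, rfl, rfl⟩⟩
    · have hε' : ε' = !ε := by cases ε <;> cases ε' <;> simp_all
      subst hε'
      have h2 := add_left_cancel hθ'
      have h3 := D.len_add_len j ε
      have h4 := Real.pi_pos
      have hx0 := h.s_nonneg.trans h.s_le_x
      have hx0' := h'.s_nonneg.trans h'.s_le_x
      have h5 := coe_inj_of_abs_lt h2 (by
        rw [sgn_not, neg_mul, sub_neg_eq_add, ← mul_add, abs_sgn_mul, abs_lt]
        constructor <;> linarith [h.x_le, h'.x_le])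
      have h6 : x = 0 ∧ x' = 0 := by
        cases ε <;> simp only [Bool.not_true, Bool.not_false, sgn_true, sgn_false] at h5 <;>
          constructor <;> linarith
      have hs : s = 0 := le_antisymm (h.s_le_x.trans h6.1.le) h.s_nonneg
      have hs' : s' = 0 := le_antisymm (h'.s_le_x.trans h6.2.le) h'.s_nonneg
      obtain ⟨hy, hc, -⟩ := h.of_s_eq_zero hL hs
      obtain ⟨-, hc', -⟩ := h'.of_s_eq_zero hL' hs'
      rw [hc, hc', hs, hs', hy]
      simp
  · have hx0 := h.s_nonneg.trans h.s_le_x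
    have hx0' := h'.s_nonneg.trans h'.s_le_x
    obtain ⟨rfl, h6, h7⟩ := D.θ_half_eq_iff hx0 h.x_le hx0' h'.x_le hθ'
    rw [D.len_h] at h' hL' ⊢
    subst h6 h7
    have h8 := h.s_eq hL h'
    subst h8
    have h9 : τ = edgeHeight (D.len i ε) s (D.len i ε / 2) y := by
      rcases h.corner_or with h10 | h10
      · linarith [h10.1, h.s_le]
      · exact h10
    have h11 : coreParam (D.len i ε) s y τ = 0 := by rw [h9, coreParam_mid]
    rw [h11, sgn_not]
    refine ⟨rfl, Or.inr (Or.inl ⟨rfl, rfl, by ring, rfl⟩)⟩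

/-- Points of half-tiles over horizontal edges with glued block coordinates coincide in the join. -/
theorem joinEq_of_blockRel {i j : ι} {ε ε' : Bool} {s x y τ s' x' y' τ' : ℝ}
    (h : InTri D.t (D.len i ε) s x y τ) (h' : InTri D.t (D.len j ε') s' x' y' τ')
    (hb : D.BlockRel (D.block i ε (s, x, y, τ)) (D.block j ε' (s', x', y', τ'))) :
    JoinEq (D.pos i ε (s, x, y, τ)) (D.pos j ε' (s', x', y', τ')) := by
  have hL := D.two_t_lt_len i ε
  have hL' := D.two_t_lt_len j ε'
  have hn := sub_coreParam_mul_nonneg hL h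
  have hn' := sub_coreParam_mul_nonneg hL' h'
  have hc := h.coreParam_mem hL
  have hc' := h'.coreParam_mem hL'
  simp only [BlockRel, block] at hb
  obtain ⟨hσ, hb⟩ := hb
  simp only [JoinEq, pos]
  rcases hb with ⟨rfl, hz1, hz2⟩ | ⟨hσ0, rfl, hz1, hz2⟩ | ⟨hσ1, rfl, hz1, hz2⟩
  · have habs : (1 - coreParam (D.len j ε) s y τ) * |y| =
        (1 - coreParam (D.len j ε') s' y' τ') * |y'| := by
      rw [← abs_of_nonneg (sub_nonneg.2 hc.2), ← abs_mul, hz2, abs_mul,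
        abs_of_nonneg (sub_nonneg.2 hc'.2)]
    by_cases hε : ε' = ε
    · subst hε
      have h1 : s = s' := by
        cases ε' <;> simp only [sgn_true, sgn_false] at hz1 <;> linarith
      subst h1
      by_cases hσ1 : coreParam (D.len j ε') s y τ = 1
      · have h2 := h.τ_eq_one hL hσ1
        have h2' := h'.τ_eq_one hL' (hσ ▸ hσ1)
        rw [h.x_eq_of_τ_eq_one hL h2, h'.x_eq_of_τ_eq_one hL' h2', h2, h2']
        exact ⟨rfl, Or.inl rfl, Or.inr rfl⟩
      · rw [← hσ] at hz2
        have h2 := mul_left_cancel₀ (sub_ne_zero.2 (Ne.symm hσ1)) hz2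
        subst h2
        have h3 : τ = τ' := by
          rw [h.τ_eq hL, h'.τ_eq hL', hσ]
        subst h3
        refine ⟨rfl, ?_, Or.inl rfl⟩
        rcases h.x_eq_or hL h' with h4 | h4
        · exact Or.inl (by rw [h4])
        · exact Or.inr h4
    · have hε' : ε' = !ε := by cases ε <;> cases ε' <;> simp_all
      subst hε'
      have h1 : s = (1 - coreParam (D.len j ε) s y τ) * |y| ∧ s = s' := by
        rw [sgn_not] at hz1
        cases ε <;> simp only [sgn_true, sgn_false] at hz1 <;> constructor <;> linarith
      obtain ⟨h1, rfl⟩ := h1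
      rcases h.s_nonneg.eq_or_lt with h0 | h0
      · obtain ⟨hy, hk, hx⟩ := h.of_s_eq_zero hL h0.symm
        obtain ⟨hy', hk', hx'⟩ := h'.of_s_eq_zero hL' h0.symm
        have h3 : τ = τ' := by rw [← hk, ← hk', hσ]
        subst h3
        rw [hy, hy']
        refine ⟨rfl, ?_, Or.inl rfl⟩
        rcases hx with hx | hx
        · exact Or.inr hx
        rcases hx' with hx' | hx'
        · exact Or.inr hx'
        rw [hx, hx']
        simp
      · have hyle := h.y_le
        have h2 : coreParam (D.len j ε) s y τ = 0 ∧ |y| = s := by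
          have h3 : 0 ≤ coreParam (D.len j ε) s y τ * |y| := mul_nonneg hc.1 (abs_nonneg _)
          have h4 : |y| = s := by linarith
          rw [h4] at h3 h1
          refine ⟨?_, h4⟩
          have h5 : coreParam (D.len j ε) s y τ * s = 0 := by linarith
          exact (mul_eq_zero.1 h5).resolve_right h0.ne'
        have hσ' := hσ ▸ h2.1
        rw [hσ', h2.1] at hz2
        have h3 : y = y' := by linarith
        subst h3
        rw [h.coreParam_eq_of_abs_eq hL h2.2, h'.coreParam_eq_of_abs_eq hL' h2.2] at hσ
        rw [h.coreParam_eq_of_abs_eq hL h2.2] at h2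
        exact ⟨hσ, Or.inr h2.1, Or.inl rfl⟩
  · have hσ0' := hσ ▸ hσ0
    obtain ⟨h1, h2⟩ := h.x_eq_half_or hL hσ0
    obtain ⟨h1', h2'⟩ := h'.x_eq_half_or hL' hσ0'
    rw [hσ0, hσ0'] at hz1 hz2
    rw [hσ0] at hn
    rw [hσ0'] at hn'
    simp only [sub_zero, one_mul] at hz1 hz2 hn hn'
    subst hz2
    by_cases hε : ε' = ε
    · subst hε
      have h3 : s = |y'| ∧ s' = |y'| := by
        cases ε' <;> simp only [sgn_true, sgn_false] at hz1 <;> constructor <;> linarith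
      have h4 : τ = 0 := h1.trans (mid_eq_zero h.s_nonneg (h.two_s_lt hL) h3.1.symm)
      have h4' : τ' = 0 := h1'.trans (mid_eq_zero h'.s_nonneg (h'.two_s_lt hL') h3.2.symm)
      rw [h4, h4', D.φ_h]
      exact ⟨rfl, Or.inr rfl, Or.inl rfl⟩
    · have hε' : ε' = !ε := by cases ε <;> cases ε' <;> simp_all
      subst hε'
      rw [D.len_h] at h' h1' h2'
      have h3 : s = s' := by
        rw [sgn_not] at hz1
        cases ε <;> simp only [sgn_true, sgn_false] at hz1 <;> linarith
      subst h3
      have h4 : τ = τ' := h1.trans h1'.symm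
      subst h4
      refine ⟨rfl, ?_, Or.inl (by rw [D.φ_h])⟩
      rcases h2 with h2 | h2
      · rcases h2' with h2' | h2'
        · rw [h2, h2']
          exact Or.inl (D.θ_half_midpoint i ε)
        · exact Or.inr h2'
      · exact Or.inr h2
  · have hσ1' := hσ ▸ hσ1
    have h1 := h.τ_eq_one hL hσ1
    have h1' := h'.τ_eq_one hL' hσ1'
    rw [hσ1, hσ1'] at hz1
    simp only [sub_self, zero_mul, sub_zero] at hz1
    rw [h.x_eq_of_τ_eq_one hL h1, h'.x_eq_of_τ_eq_one hL' h1', h1, h1', hz1, D.θ_v]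
    exact ⟨rfl, Or.inl rfl, Or.inr rfl⟩

/-- Half-tiles over a horizontal and a vertical edge that do not share a vertex are disjoint. -/
theorem crossing_false {i j : ι} {ε ε' : Bool} {s x y τ s' x' y' τ' : ℝ}
    (h : InTri D.t (D.len i ε) s x y τ) (h' : InTri D.t (D.swap.len j ε') s' x' y' τ')
    (hτ : τ = 1 - τ')
    (hθ : D.θ i + ((sgn ε * x : ℝ) : S1) = D.θ j + (y' : S1))
    (hφ : D.φ i + (y : S1) = D.φ j + ((sgn ε' * x' : ℝ) : S1))
    (h1 : D.θ i ≠ D.θ j) (h2 : D.φ i ≠ D.φ j) : False := by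
  have hL := D.two_t_lt_len i ε
  have hL' := D.swap.two_t_lt_len j ε'
  change 2 * D.t < _ at hL'
  have hx0 := h.s_nonneg.trans h.s_le_x
  have hx0' := h'.s_nonneg.trans h'.s_le_x
  have ht := D.t_pos
  have hyt : |y| ≤ D.t := h.y_le.trans h.s_le
  have hyt' : |y'| ≤ D.t := h'.y_le.trans h'.s_le
  have h3 : D.θ (D.h i) ≠ D.θ j := by
    intro h3
    exact D.θ_ne_of_le_half hx0 h.x_le hyt' (by rw [h3]; exact hθ)
  have h4 : D.φ (D.v j) ≠ D.φ i := by
    intro h4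
    exact D.swap.θ_ne_of_le_half hx0' h'.x_le hyt (by
      change D.φ j + _ = D.φ (D.v j) + _
      rw [h4]; exact hφ.symm)
  have key : ∀ (D : EdgeData ι) (i j : ι) (ε : Bool) (x u : ℝ), 2 * D.t < D.len i ε →
      0 < D.t → 0 ≤ x → x ≤ D.len i ε / 2 → |u| ≤ D.t →
      D.θ i + ((sgn ε * x : ℝ) : S1) = D.θ j + (u : S1) → D.θ i ≠ D.θ j → D.θ (D.h i) ≠ D.θ j →
      x - sgn ε * u ∈ Ioo (2 * D.t) (D.len i ε - 2 * D.t) := by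
    intro D i j ε x u hL ht hx0 hx hu hθ h1 h3
    have hu' := abs_le.1 hu
    have hsu : sgn ε * u ∈ Icc (-D.t) D.t := by
      cases ε <;> simp only [sgn_true, sgn_false] <;> constructor <;> linarith
    have e1 : D.θ i + ((sgn ε * (x - sgn ε * u) : ℝ) : S1) = D.θ j := by
      rw [mul_sub, ← mul_assoc, sgn_mul_self, one_mul, AddCircle.coe_sub, ← add_sub_assoc, hθ,
        add_sub_cancel_right]
    have e2 : D.θ (D.h i) + ((sgn ε * (x - sgn ε * u - D.len i ε) : ℝ) : S1) = D.θ j := by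
      rw [← e1, ← D.θ_h i ε, add_assoc, ← AddCircle.coe_add]
      congr 2
      ring
    have d1 := (D.θ_sep _ _ h1).trans_le (dist_le_of_add_eq e1)
    have d2 := (D.θ_sep _ _ h3).trans_le (dist_le_of_add_eq e2)
    rw [abs_sgn_mul, lt_abs] at d1 d2
    constructor
    · rcases d1 with d1 | d1
      · exact d1
      · linarith [hsu.2]
    · rcases d2 with d2 | d2
      · linarith [hsu.1]
      · linarith
  have hm := key D i j ε x y' hL ht hx0 h.x_le hyt' hθ h1 h3
  have hn := key D.swap j i ε' x' y hL' ht hx0' h'.x_le hyt hφ.symm h2.symm h4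
  change _ ∈ Ioo (2 * D.t) (_ - 2 * D.t) at hn
  have hs := h.s_le
  have hs' := h'.s_le
  have hy0 : sgn ε * y' ∈ Icc (-s') s' := by
    have := abs_le.1 h'.y_le
    cases ε <;> simp only [sgn_true, sgn_false] <;> constructor <;> linarith
  have hy0' : sgn ε' * y ∈ Icc (-s) s := by
    have := abs_le.1 h.y_le
    cases ε' <;> simp only [sgn_true, sgn_false] <;> constructor <;> linarith
  have hcross := edgeHeight_crossing (L := D.len i ε) (M := D.swap.len j ε') (s := s) (s' := s')
    (m := x - sgn ε * y') (n := x' - sgn ε' * y) (u := sgn ε * y') (y := sgn ε' * y)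
    h.s_nonneg h'.s_nonneg ⟨by linarith [hm.1], by linarith [hm.2]⟩
    ⟨by linarith [hn.1], by linarith [hn.2]⟩ (abs_le.2 hy0) (abs_le.2 hy0')
  have hsymm : ∀ (L s x y : ℝ) (ε : Bool), edgeHeight L s x (sgn ε * y) = edgeHeight L s x y := by
    intro L s x y ε
    cases ε
    · rw [sgn_false, neg_one_mul, edgeHeight_neg]
    · rw [sgn_true, one_mul]
  rw [sub_add_cancel, sub_add_cancel, hsymm, hsymm] at hcross
  have c1 : τ = edgeHeight (D.len i ε) s x y := by
    rcases h.corner_or with h5 | h5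
    · linarith [hm.1, hy0.1]
    · exact h5
  have c2 : τ' = edgeHeight (D.swap.len j ε') s' x' y' := by
    rcases h'.corner_or with h5 | h5
    · linarith [hn.1, hy0'.1]
    · exact h5
  linarith

/-- Points of half-tiles over a horizontal and a vertical edge that coincide in the join lie over a
common corner or at height `0` or `1`, and have glued block coordinates. -/
theorem blockRel_of_joinEq_swap {i j : ι} {ε ε' : Bool} {s x y τ s' x' y' τ' : ℝ}
    (h : InTri D.t (D.len i ε) s x y τ) (h' : InTri D.t (D.swap.len j ε') s' x' y' τ')
    (hj : JoinEq (D.pos i ε (s, x, y, τ)) (joinSwap (D.swap.pos j ε' (s', x', y', τ')))) :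
    D.BlockRel (D.block i ε (s, x, y, τ)) (blockSwap (D.swap.block j ε' (s', x', y', τ'))) := by
  have hL := D.two_t_lt_len i ε
  have hL' : 2 * D.t < D.swap.len j ε' := D.swap.two_t_lt_len j ε'
  have ht := D.t_pos
  have hyt : |y| ≤ D.t := h.y_le.trans h.s_le
  have hyt' : |y'| ≤ D.t := h'.y_le.trans h'.s_le
  have hclose : ∀ {s u : ℝ} (ε : Bool), 0 ≤ s → s ≤ D.t → |u| ≤ D.t →
      |sgn ε * s - u| ≤ 2 * D.t := by
    intro s u ε h0 h1 h2
    have h3 := abs_le.1 h2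
    rw [abs_le]
    cases ε <;> simp only [sgn_true, sgn_false] <;> constructor <;> linarith
  obtain ⟨hτ, hθ, hφ⟩ := hj
  simp only [pos, joinSwap] at hτ hθ hφ
  change D.θ i + _ = D.θ j + _ ∨ _ at hθ
  change D.φ i + _ = D.φ j + _ ∨ _ at hφ
  simp only [BlockRel, block, blockSwap]
  -- at height `1` the first point lies on a short side, and the second one on a long side
  by_cases hτ1 : τ = 1
  · have hτ0' : τ' = 0 := by linarith
    have hθ' := hθ.resolve_right (by rw [hτ1]; norm_num)
    have hx := h.x_eq_of_τ_eq_one hL hτ1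
    have hy' := h'.abs_y_eq_of_τ_eq_zero hL' hτ0'
    subst hx
    obtain ⟨h1, h2⟩ := D.θ_eq_of_add_eq hθ' (hclose ε h.s_nonneg h.s_le hyt')
    rw [h.coreParam_eq_of_τ_eq_one hL hτ1, h'.coreParam_eq_of_abs_eq hL' hy', hy', hτ0']
    refine ⟨by norm_num, ?_⟩
    simp only [sub_self, zero_mul, sub_zero, one_mul, mul_zero, neg_zero, h2, and_true, true_and]
    rcases D.eq_of_θ_eq i j h1 with h3 | h3
    · exact Or.inl h3
    · exact Or.inr (Or.inr h3)
  have hφ' := hφ.resolve_right hτ1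
  -- at height `0` it is the other way round
  by_cases hτ0 : τ = 0
  · have hτ1' : τ' = 1 := by linarith
    have hx' := h'.x_eq_of_τ_eq_one hL' hτ1'
    have hy := h.abs_y_eq_of_τ_eq_zero hL hτ0
    subst hx'
    obtain ⟨h1, h2⟩ := D.swap.θ_eq_of_add_eq hφ'.symm
      (hclose ε' h'.s_nonneg h'.s_le hyt)
    rw [h'.coreParam_eq_of_τ_eq_one hL' hτ1', h.coreParam_eq_of_abs_eq hL hy, hy, hτ0]
    refine ⟨by norm_num, ?_⟩
    simp only [sub_self, zero_mul, sub_zero, one_mul, mul_zero, neg_zero, h2, and_true, true_and]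
    rcases D.eq_of_φ_eq i j h1.symm with h3 | h3
    · exact Or.inl h3
    · exact Or.inr (Or.inl h3)
  have hθ' := hθ.resolve_right hτ0
  have hτ0' : τ' ≠ 0 := fun h0 => hτ1 (by linarith)
  have hx0 := h.s_nonneg.trans h.s_le_x
  have hx0' := h'.s_nonneg.trans h'.s_le_x
  -- otherwise the half-tiles share a vertex, and the points lie over a common corner
  by_cases hθij : D.θ i = D.θ j
  · have hε1 : sgn ε * x = y' := by
      rw [hθij] at hθ'
      refine coe_inj_of_abs_lt (add_left_cancel hθ') ?_
      have h3 := D.len_lt i ε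
      have h4 := abs_le.1 hyt'
      have h5 := h.x_le
      have h6 := D.two_t_lt_pi i
      rw [abs_lt]
      cases ε <;> simp only [sgn_true, sgn_false] <;> constructor <;> linarith
    rcases D.eq_of_θ_eq i j hθij with rfl | rfl
    · have hε2 : sgn ε' * x' = y := by
        refine coe_inj_of_abs_lt (add_left_cancel hφ'.symm) ?_
        have h3 : D.swap.len j ε' < 2 * π - 2 * D.t := D.swap.len_lt j ε'
        have h4 := abs_le.1 hyt
        have h5 := h'.x_le
        have h6 := D.two_t_lt_pi j
        rw [abs_lt]
        cases ε' <;> simp only [sgn_true, sgn_false] <;> constructor <;> linarith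
      have a1 : |y'| = x := by rw [← hε1, abs_sgn_mul, abs_of_nonneg hx0]
      have a2 : |y| = x' := by rw [← hε2, abs_sgn_mul, abs_of_nonneg hx0']
      have b1 := h.s_le_x
      have b2 := h'.s_le_x
      have b3 := h.y_le
      have b4 := h'.y_le
      have c1 : x = s := by linarith
      have c2 : s' = s := by linarith
      have c3 : x' = s := by linarith
      have e1 : |y| = s := by linarith
      have e2 : |y'| = s' := by linarith
      rw [h.coreParam_eq_of_abs_eq hL e1, h'.coreParam_eq_of_abs_eq hL' e2, e1, e2, c2, ← hε1,
        ← hε2, c1, c3]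
      refine ⟨hτ, Or.inl ⟨rfl, ?_, ?_⟩⟩
      · rw [hτ]; ring
      · rw [hτ]; ring
    · exfalso
      have := D.swap.θ_ne_of_le_half hx0' h'.x_le hyt
      apply this
      change D.φ _ + _ = D.φ (D.v (D.v i)) + _
      rw [D.v_v]
      exact hφ'.symm
  · by_cases hφij : D.φ i = D.φ j
    · exfalso
      rcases D.eq_of_φ_eq i j hφij with rfl | rfl
      · exact hθij rfl
      · exact D.θ_ne_of_le_half hx0 h.x_le hyt' hθ'
    · exact absurd (D.crossing_false h h' hτ hθ' hφ' hθij hφij) id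

/-- Points of half-tiles over a horizontal and a vertical edge with glued block coordinates coincide
in the join. -/
theorem joinEq_of_blockRel_swap {i j : ι} {ε ε' : Bool} {s x y τ s' x' y' τ' : ℝ}
    (h : InTri D.t (D.len i ε) s x y τ) (h' : InTri D.t (D.swap.len j ε') s' x' y' τ')
    (hb : D.BlockRel (D.block i ε (s, x, y, τ))
      (blockSwap (D.swap.block j ε' (s', x', y', τ')))) :
    JoinEq (D.pos i ε (s, x, y, τ)) (joinSwap (D.swap.pos j ε' (s', x', y', τ'))) := by
  have hL := D.two_t_lt_len i ε
  have hL' : 2 * D.t < D.swap.len j ε' := D.swap.two_t_lt_len j ε'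
  have hn := sub_coreParam_mul_nonneg hL h
  have hn' := sub_coreParam_mul_nonneg hL' h'
  have hc := h.coreParam_mem hL
  have hc' := h'.coreParam_mem hL'
  simp only [BlockRel, block, blockSwap] at hb
  obtain ⟨hσ, hb⟩ := hb
  simp only [JoinEq, pos, joinSwap]
  change _ ∧ (D.θ i + _ = D.θ j + _ ∨ _) ∧ (D.φ i + _ = D.φ j + _ ∨ _)
  have hσ' : 1 - coreParam (D.swap.len j ε') s' y' τ' = coreParam (D.len i ε) s y τ := hσ.symm
  rcases hb with ⟨rfl, hz1, hz2⟩ | ⟨hσ0, rfl, hz1, hz2⟩ | ⟨hσ1, rfl, hz1, hz2⟩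
  · rw [hσ'] at hz1 hz2 hn'
    have h1 : s - (1 - coreParam (D.len j ε) s y τ) * |y| =
        coreParam (D.len j ε) s y τ * |y'| := by
      rw [← abs_of_nonneg hn, ← abs_sgn_mul ε, hz1, abs_mul, abs_of_nonneg hc.1]
    have h2 : (1 - coreParam (D.len j ε) s y τ) * |y| =
        s' - coreParam (D.len j ε) s y τ * |y'| := by
      rw [← abs_of_nonneg hn', ← abs_sgn_mul ε' (s' - _), ← hz2, abs_mul,
        abs_of_nonneg (sub_nonneg.2 hc.2)]
    have h3 : s' = s := by linarith
    subst h3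
    have hy := h.y_le
    have hy' := h'.y_le
    by_cases hσ0 : coreParam (D.len j ε) s' y τ = 0
    · rw [hσ0] at h1 hz2
      have e1 : |y| = s' := by linarith
      have e2 : τ = 0 := by rw [← h.coreParam_eq_of_abs_eq hL e1, hσ0]
      have e3 : τ' = 1 := h'.τ_eq_one hL' (by linarith)
      rw [e2, e3, h'.x_eq_of_τ_eq_one hL' e3]
      refine ⟨by norm_num, Or.inr rfl, Or.inl ?_⟩
      rw [show y = sgn ε' * s' by linarith]
    by_cases hσ1 : coreParam (D.len j ε) s' y τ = 1
    · rw [hσ1] at h1 hz1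
      have e1 : |y'| = s' := by linarith
      have e2 : τ' = 0 := by rw [← h'.coreParam_eq_of_abs_eq hL' e1]; linarith
      have e3 : τ = 1 := h.τ_eq_one hL hσ1
      rw [e2, e3, h.x_eq_of_τ_eq_one hL e3]
      refine ⟨by norm_num, Or.inl ?_, Or.inr rfl⟩
      rw [show y' = sgn ε * s' by linarith]
    · have p1 : 0 < coreParam (D.len j ε) s' y τ := lt_of_le_of_ne hc.1 (Ne.symm hσ0)
      have p2 : 0 < 1 - coreParam (D.len j ε) s' y τ :=
        sub_pos.2 (lt_of_le_of_ne hc.2 hσ1)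
      have q1 := mul_le_mul_of_nonneg_left hy' p1.le
      have q2 := mul_le_mul_of_nonneg_left hy p2.le
      have e1 : |y| = s' := mul_left_cancel₀ p2.ne' (by linarith)
      have e2 : |y'| = s' := mul_left_cancel₀ p1.ne' (by linarith)
      have k1 := h.coreParam_eq_of_abs_eq hL e1
      have k2 := h'.coreParam_eq_of_abs_eq hL' e2
      have k3 : τ = 1 - τ' := by linarith
      have x1 := h.x_eq_of_abs_y_eq hL e1 (fun h0 => hσ0 (k1.trans h0))
      have x2 := h'.x_eq_of_abs_y_eq hL' e2 (fun h0 => hσ1 (by linarith))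
      rw [x1, x2]
      refine ⟨k3, Or.inl ?_, Or.inl ?_⟩
      · have : y' = sgn ε * s' := by
          apply mul_left_cancel₀ p1.ne'
          rw [← hz1, e1]; ring
        rw [this]
      · have : y = sgn ε' * s' := by
          apply mul_left_cancel₀ p2.ne'
          rw [hz2, e2]; ring
        rw [this]
  · rw [hσ'] at hz1 hz2 hn'
    rw [hσ0] at hz1 hz2 hn hn'
    simp only [sub_zero, one_mul, zero_mul] at hz1 hz2 hn hn'
    have e1 : |y| = s := by
      cases ε <;> simp only [sgn_true, sgn_false] at hz1 <;> linarith
    have e2 : τ = 0 := by rw [← h.coreParam_eq_of_abs_eq hL e1, hσ0]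
    have e3 : τ' = 1 := h'.τ_eq_one hL' (by linarith)
    rw [e2, e3, h'.x_eq_of_τ_eq_one hL' e3, hz2, D.φ_h]
    exact ⟨by norm_num, Or.inr rfl, Or.inl rfl⟩
  · rw [hσ'] at hz1 hz2 hn'
    rw [hσ1] at hz1 hz2 hn hn'
    simp only [sub_self, one_mul, zero_mul, sub_zero, neg_zero] at hz1 hz2 hn hn'
    have e1 : |y'| = s' := by
      cases ε' <;> simp only [sgn_true, sgn_false] at hz2 <;> linarith
    have e2 : τ' = 0 := by rw [← h'.coreParam_eq_of_abs_eq hL' e1]; linarith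
    have e3 : τ = 1 := h.τ_eq_one hL hσ1
    rw [e2, e3, h.x_eq_of_τ_eq_one hL e3, hz1, D.θ_v]
    exact ⟨by norm_num, Or.inl rfl, Or.inr rfl⟩

end EdgeData

/-! ### The join of two circles -/

/-- The point `[θ, φ, τ]` of the three-sphere, for a real height `τ` (projected to `[0, 1]`). -/
def joinMk (p : S1 × S1 × ℝ) : S3 := S3.mk p.1 p.2.1 (projIcc 0 1 zero_le_one p.2.2)

theorem continuous_mk : Continuous fun p : S1 × S1 × unitInterval => S3.mk p.1 p.2.1 p.2.2 :=
  continuous_quotient_mk'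

theorem continuous_joinMk : Continuous joinMk :=
  continuous_mk.comp (continuous_fst.prodMk (continuous_snd.fst.prodMk
    ((continuous_projIcc (h := zero_le_one)).comp continuous_snd.snd)))

theorem mk_eq_joinMk (θ φ : S1) (τ : unitInterval) : S3.mk θ φ τ = joinMk (θ, φ, τ) := by
  rw [joinMk, projIcc_val]

theorem joinMk_eq_iff {p q : S1 × S1 × ℝ} (hp : p.2.2 ∈ Icc (0 : ℝ) 1)
    (hq : q.2.2 ∈ Icc (0 : ℝ) 1) : joinMk p = joinMk q ↔ JoinEq p q := by
  have h : joinMk p = joinMk q ↔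
      (projIcc (0 : ℝ) 1 zero_le_one p.2.2 = projIcc 0 1 zero_le_one q.2.2 ∧
        (p.1 = q.1 ∨ projIcc (0 : ℝ) 1 zero_le_one p.2.2 = 0) ∧
        (p.2.1 = q.2.1 ∨ projIcc (0 : ℝ) 1 zero_le_one p.2.2 = 1)) := Quotient.eq
  rw [h, JoinEq]
  simp only [projIcc_of_mem zero_le_one hp, projIcc_of_mem zero_le_one hq,
    Subtype.ext_iff, Icc.coe_zero, Icc.coe_one]

/-- The join embeds in `ℂ²` by `[θ, φ, τ] ↦ (τ e^{iθ}, (1 - τ) e^{iφ})`. -/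
instance instT2SpaceS3 : T2Space S3 := by
  let F : S1 × S1 × unitInterval → ℂ × ℂ := fun p =>
    (((p.2.2 : ℝ) : ℂ) * (AddCircle.toCircle p.1 : ℂ),
      ((1 - (p.2.2 : ℝ) : ℝ) : ℂ) * (AddCircle.toCircle p.2.1 : ℂ))
  have hF : Continuous F := by
    have hc : Continuous (fun x : S1 => (AddCircle.toCircle x : ℂ)) :=
      continuous_subtype_val.comp AddCircle.continuous_toCircle
    refine Continuous.prodMk (Continuous.mul ?_ (hc.comp continuous_fst))
      (Continuous.mul ?_ (hc.comp continuous_snd.fst))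
    · fun_prop
    · fun_prop
  have hinj : ∀ x y : S1, (AddCircle.toCircle x : ℂ) = AddCircle.toCircle y → x = y :=
    fun x y h => AddCircle.injective_toCircle Real.two_pi_pos.ne' (Subtype.ext h)
  have hn : ∀ x : S1, ‖(AddCircle.toCircle x : ℂ)‖ = 1 := fun x => Circle.norm_coe _
  have key : ∀ p q, F p = F q ↔ joinSetoid.r p q := by
    intro p q
    constructor
    · intro h
      have h1 : ((p.2.2 : ℝ) : ℂ) * (AddCircle.toCircle p.1 : ℂ) =
        ((q.2.2 : ℝ) : ℂ) * (AddCircle.toCircle q.1 : ℂ) := congrArg Prod.fst h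
      have h2 : ((1 - (p.2.2 : ℝ) : ℝ) : ℂ) * (AddCircle.toCircle p.2.1 : ℂ) =
        ((1 - (q.2.2 : ℝ) : ℝ) : ℂ) * (AddCircle.toCircle q.2.1 : ℂ) := congrArg Prod.snd h
      have h3 : p.2.2 = q.2.2 := by
        have := congrArg norm h1
        rw [norm_mul, norm_mul, hn, hn, mul_one, mul_one, Complex.norm_real, Complex.norm_real,
          Real.norm_of_nonneg p.2.2.2.1, Real.norm_of_nonneg q.2.2.2.1] at this
        exact Subtype.ext this
      rw [← h3] at h1 h2
      refine ⟨h3, ?_, ?_⟩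
      · by_cases h0 : p.2.2 = 0
        · exact Or.inr h0
        · left
          refine hinj _ _ (mul_left_cancel₀ ?_ h1)
          rw [Complex.ofReal_ne_zero]
          exact fun h => h0 (Subtype.ext h)
      · by_cases h0 : p.2.2 = 1
        · exact Or.inr h0
        · left
          refine hinj _ _ (mul_left_cancel₀ ?_ h2)
          rw [Complex.ofReal_ne_zero, sub_ne_zero]
          exact fun h => h0 (Subtype.ext h.symm)
    · rintro ⟨h1, h2, h3⟩
      refine Prod.ext ?_ ?_
      · change ((p.2.2 : ℝ) : ℂ) * _ = ((q.2.2 : ℝ) : ℂ) * _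
        rw [← h1]
        rcases h2 with h2 | h2
        · rw [h2]
        · rw [h2]; simp
      · change ((1 - (p.2.2 : ℝ) : ℝ) : ℂ) * _ = ((1 - (q.2.2 : ℝ) : ℝ) : ℂ) * _
        rw [← h1]
        rcases h3 with h3 | h3
        · rw [h3]
        · rw [h3]; simp
  let G : S3 → ℂ × ℂ := Quotient.lift F fun p q h => (key p q).2 h
  have hG : Continuous G := hF.quotient_lift _
  refine T2Space.of_injective_continuous (f := G) ?_ hG
  intro x y
  induction x using Quotient.inductionOn with
  | h p =>
    induction y using Quotient.inductionOn with
    | h q => exact fun h => Quotient.sound ((key p q).1 h)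

/-! ### Round discs -/

/-- The radial map from the plane with the norm `|z₁| + |z₂|` to the Euclidean plane. -/
def roundOut (z₁ z₂ : ℝ) : ℂ := (((|z₁| + |z₂|) / ‖(⟨z₁, z₂⟩ : ℂ)‖ : ℝ) : ℂ) * ⟨z₁, z₂⟩

theorem norm_roundOut (z₁ z₂ : ℝ) : ‖roundOut z₁ z₂‖ = |z₁| + |z₂| := by
  rcases eq_or_ne (⟨z₁, z₂⟩ : ℂ) 0 with h | h
  · have h1 : z₁ = 0 := congrArg Complex.re h
    have h2 : z₂ = 0 := congrArg Complex.im h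
    rw [roundOut, h, h1, h2]
    simp
  · have := norm_pos_iff.2 h
    rw [roundOut, norm_mul, Complex.norm_real, Real.norm_of_nonneg (by positivity)]
    field_simp

theorem continuous_roundOut : Continuous fun p : ℝ × ℝ => roundOut p.1 p.2 := by
  have hc : Continuous fun p : ℝ × ℝ => (⟨p.1, p.2⟩ : ℂ) := by
    have e : (fun p : ℝ × ℝ => (⟨p.1, p.2⟩ : ℂ)) = fun p => (p.1 : ℂ) + p.2 * Complex.I := by
      funext p; exact Complex.mk_eq_add_mul_I _ _
    rw [e]
    fun_prop
  rw [continuous_iff_continuousAt]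
  intro p
  by_cases h : (⟨p.1, p.2⟩ : ℂ) = 0
  · have h1 : p.1 = 0 := congrArg Complex.re h
    have h2 : p.2 = 0 := congrArg Complex.im h
    have h0 : roundOut p.1 p.2 = 0 := by
      rw [← norm_eq_zero, norm_roundOut, h1, h2]; simp
    rw [ContinuousAt, h0]
    rw [tendsto_zero_iff_norm_tendsto_zero]
    simp only [norm_roundOut]
    have : ContinuousAt (fun p : ℝ × ℝ => |p.1| + |p.2|) p := by fun_prop
    simpa [ContinuousAt, h1, h2] using this
  · have h' := norm_ne_zero_iff.2 h
    refine ContinuousAt.mul ?_ hc.continuousAt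
    refine Complex.continuous_ofReal.continuousAt.comp (ContinuousAt.div ?_ ?_ h')
    · fun_prop
    · exact hc.norm.continuousAt

theorem roundOut_injective {z₁ z₂ w₁ w₂ : ℝ} (h : roundOut z₁ z₂ = roundOut w₁ w₂) :
    z₁ = w₁ ∧ z₂ = w₂ := by
  have hn : |z₁| + |z₂| = |w₁| + |w₂| := by rw [← norm_roundOut, ← norm_roundOut, h]
  rcases (add_nonneg (abs_nonneg z₁) (abs_nonneg z₂)).eq_or_lt with h0 | h0
  · have a1 := abs_nonneg z₁
    have a2 := abs_nonneg z₂
    have a3 := abs_nonneg w₁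
    have a4 := abs_nonneg w₂
    rw [abs_eq_zero.1 (by linarith : |z₁| = 0), abs_eq_zero.1 (by linarith : |z₂| = 0),
      abs_eq_zero.1 (by linarith : |w₁| = 0), abs_eq_zero.1 (by linarith : |w₂| = 0)]
    exact ⟨rfl, rfl⟩
  · have h0' : 0 < |w₁| + |w₂| := by rwa [← hn]
    have hz : 0 < ‖(⟨z₁, z₂⟩ : ℂ)‖ := by
      rw [norm_pos_iff]
      intro h
      have h1 : z₁ = 0 := congrArg Complex.re h
      have h2 : z₂ = 0 := congrArg Complex.im h
      rw [h1, h2] at h0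
      simp at h0
    have hw : 0 < ‖(⟨w₁, w₂⟩ : ℂ)‖ := by
      rw [norm_pos_iff]
      intro h
      have h1 : w₁ = 0 := congrArg Complex.re h
      have h2 : w₂ = 0 := congrArg Complex.im h
      rw [h1, h2] at h0'
      simp at h0'
    set a := (|z₁| + |z₂|) / ‖(⟨z₁, z₂⟩ : ℂ)‖ with ha
    set b := (|w₁| + |w₂|) / ‖(⟨w₁, w₂⟩ : ℂ)‖ with hb
    have hapos : 0 < a := div_pos h0 hz
    have hbpos : 0 < b := div_pos h0' hw
    have e1 : a * z₁ = b * w₁ := by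
      have := congrArg Complex.re h
      rwa [roundOut, roundOut, Complex.re_ofReal_mul, Complex.re_ofReal_mul] at this
    have e2 : a * z₂ = b * w₂ := by
      have := congrArg Complex.im h
      rwa [roundOut, roundOut, Complex.im_ofReal_mul, Complex.im_ofReal_mul] at this
    have e3 : a * (|z₁| + |z₂|) = b * (|w₁| + |w₂|) := by
      have e4 : ∀ {r : ℝ} (u : ℝ), 0 < r → r * |u| = |r * u| := fun u hr => by
        rw [abs_mul, abs_of_pos hr]
      rw [mul_add, mul_add, e4 _ hapos, e4 _ hapos, e4 _ hbpos, e4 _ hbpos, e1, e2]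
    rw [hn] at e3
    have e4 : a = b := mul_right_cancel₀ h0'.ne' e3
    rw [e4] at e1 e2
    exact ⟨mul_left_cancel₀ hbpos.ne' e1, mul_left_cancel₀ hbpos.ne' e2⟩

theorem roundOut_surjective (w : ℂ) : ∃ z₁ z₂, roundOut z₁ z₂ = w := by
  rcases eq_or_ne w 0 with rfl | hw
  · exact ⟨0, 0, by rw [← norm_eq_zero, norm_roundOut]; simp⟩
  · have hwn := norm_pos_iff.2 hw
    have h1 : 0 < |w.re| + |w.im| := hwn.trans_le (Complex.norm_le_abs_re_add_abs_im w)
    set a := ‖w‖ / (|w.re| + |w.im|) with ha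
    have hapos : 0 < a := div_pos hwn h1
    refine ⟨a * w.re, a * w.im, ?_⟩
    have e : (⟨a * w.re, a * w.im⟩ : ℂ) = (a : ℂ) * w := by
      apply Complex.ext <;> simp
    rw [roundOut, e, norm_mul, Complex.norm_real, Real.norm_of_nonneg hapos.le, ← mul_assoc,
      ← Complex.ofReal_mul, abs_mul, abs_mul, abs_of_pos hapos, ← mul_add]
    have : a * (|w.re| + |w.im|) / (a * ‖w‖) * a = 1 := by
      rw [ha]; field_simp
    rw [this]
    simp

theorem roundOut_neg_left (z₁ z₂ : ℝ) :
    roundOut (-z₁) z₂ = -starRingEnd ℂ (roundOut z₁ z₂) := by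
  have e : (⟨-z₁, z₂⟩ : ℂ) = -starRingEnd ℂ ⟨z₁, z₂⟩ := by apply Complex.ext <;> simp
  rw [roundOut, roundOut, e, norm_neg, Complex.norm_conj, abs_neg, map_mul, Complex.conj_ofReal,
    mul_neg]

theorem roundOut_neg_right (z₁ z₂ : ℝ) :
    roundOut z₁ (-z₂) = starRingEnd ℂ (roundOut z₁ z₂) := by
  have e : (⟨z₁, -z₂⟩ : ℂ) = starRingEnd ℂ ⟨z₁, z₂⟩ := by apply Complex.ext <;> simp
  rw [roundOut, roundOut, e, Complex.norm_conj, abs_neg, map_mul, Complex.conj_ofReal]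

/-- The framing over an arc of the link. Over the arcs of one colour it is the standard one, over
those of the other colour it is reflected and makes half a turn. -/
def twist (c : Bool) (σ : ℝ) (w : ℂ) : ℂ :=
  if c then w else Complex.exp ((π * (1 - σ) : ℝ) * Complex.I) * starRingEnd ℂ w

theorem norm_twist (c : Bool) (σ : ℝ) (w : ℂ) : ‖twist c σ w‖ = ‖w‖ := by
  cases c
  · simp only [twist, Bool.false_eq_true, if_false]
    rw [norm_mul, Complex.norm_exp_ofReal_mul_I, one_mul, Complex.norm_conj]
  · rfl

theorem twist_injective {c : Bool} {σ : ℝ} {w w' : ℂ} (h : twist c σ w = twist c σ w') :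
    w = w' := by
  cases c
  · simp only [twist, Bool.false_eq_true, if_false] at h
    exact (starRingEnd ℂ).injective (mul_left_cancel₀ (Complex.exp_ne_zero _) h)
  · exact h

theorem twist_surjective (c : Bool) (σ : ℝ) (w : ℂ) : ∃ w', twist c σ w' = w := by
  cases c
  · refine ⟨starRingEnd ℂ ((Complex.exp ((π * (1 - σ) : ℝ) * Complex.I))⁻¹ * w), ?_⟩
    simp only [twist, Bool.false_eq_true, if_false]
    rw [Complex.conj_conj, mul_inv_cancel_left₀ (Complex.exp_ne_zero _)]
  · exact ⟨w, rfl⟩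

theorem continuous_twist (c : Bool) : Continuous fun p : ℝ × ℂ => twist c p.1 p.2 := by
  cases c
  · simp only [twist, Bool.false_eq_true, if_false]
    have : Continuous fun p : ℝ × ℂ => starRingEnd ℂ p.2 :=
      Complex.continuous_conj.comp continuous_snd
    exact Continuous.mul (by fun_prop) this
  · exact continuous_snd

theorem twist_not_zero (c : Bool) (w : ℂ) : twist (!c) 0 w = twist c 0 (-starRingEnd ℂ w) := by
  cases c <;> simp [twist]

theorem twist_not_one (c : Bool) (w : ℂ) : twist (!c) 1 w = twist c 1 (starRingEnd ℂ w) := by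
  cases c <;> simp [twist]

namespace EdgeData

variable {ι : Type} (D : EdgeData ι)

/-- The map from block coordinates to the product of the three-sphere and the disc: the point of
the link and the position in the framed transversal disc. -/
def frame (c : ι → Bool) (p : BlockPt ι) : S3 × ℂ :=
  (joinMk (D.θ p.1, D.φ p.1, p.2.1),
    twist (c p.1) p.2.1 (roundOut (p.2.2.1 / D.t) (p.2.2.2 / D.t)))

/-- The change of the framing at the ends of the arcs compensates for the reflections in the gluing
of block coordinates. -/
theorem frame_eq_iff {c : ι → Bool} (hh : ∀ i, c (D.h i) = !c i) (hv : ∀ i, c (D.v i) = !c i)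
    {p q : BlockPt ι} (hp : p.2.1 ∈ Icc (0 : ℝ) 1) (hq : q.2.1 ∈ Icc (0 : ℝ) 1) :
    D.frame c p = D.frame c q ↔ D.BlockRel p q := by
  obtain ⟨i, σ, z₁, z₂⟩ := p
  obtain ⟨j, σ', w₁, w₂⟩ := q
  have ht := D.t_pos.ne'
  have hdiv : ∀ {a b : ℝ}, a / D.t = b / D.t ↔ a = b := fun {a b} => div_left_inj' ht
  rw [frame, frame, Prod.mk_inj, joinMk_eq_iff hp hq]
  simp only [JoinEq, BlockRel] at *
  constructor
  · rintro ⟨⟨rfl, h1, h2⟩, h3⟩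
    refine ⟨rfl, ?_⟩
    by_cases hij : j = i
    · subst hij
      obtain ⟨h4, h5⟩ := roundOut_injective (twist_injective h3)
      exact Or.inl ⟨rfl, hdiv.1 h4, hdiv.1 h5⟩
    right
    by_cases h0 : σ = 0
    · subst h0
      have h4 := (D.eq_of_φ_eq i j (h2.resolve_right zero_ne_one)).resolve_left hij
      subst h4
      rw [hh, twist_not_zero, ← roundOut_neg_left] at h3
      obtain ⟨h4, h5⟩ := roundOut_injective (twist_injective h3)
      refine Or.inl ⟨rfl, rfl, ?_, (hdiv.1 h5).symm⟩
      rw [← neg_div] at h4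
      linarith [hdiv.1 h4]
    · have h4 := (D.eq_of_θ_eq i j (h1.resolve_right h0)).resolve_left hij
      subst h4
      have h5 : σ = 1 := h2.resolve_left (D.φ_v_ne i).symm
      subst h5
      rw [hv, twist_not_one, ← roundOut_neg_right] at h3
      obtain ⟨h4, h5⟩ := roundOut_injective (twist_injective h3)
      refine Or.inr ⟨rfl, rfl, (hdiv.1 h4).symm, ?_⟩
      rw [← neg_div] at h5
      linarith [hdiv.1 h5]
  · rintro ⟨rfl, ⟨rfl, rfl, rfl⟩ | ⟨rfl, rfl, rfl, rfl⟩ | ⟨rfl, rfl, rfl, rfl⟩⟩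
    · exact ⟨⟨rfl, Or.inl rfl, Or.inl rfl⟩, rfl⟩
    · refine ⟨⟨rfl, Or.inr rfl, Or.inl (D.φ_h i).symm⟩, ?_⟩
      rw [hh, twist_not_zero, ← roundOut_neg_left, neg_div, neg_neg]
    · refine ⟨⟨rfl, Or.inl (D.θ_v i).symm, Or.inr rfl⟩, ?_⟩
      rw [hv, twist_not_one, ← roundOut_neg_right, neg_div, neg_neg]

theorem continuous_frame (c : ι → Bool) (i : ι) :
    Continuous fun p : ℝ × ℝ × ℝ => D.frame c (i, p) := by
  refine Continuous.prodMk (continuous_joinMk.comp (by fun_prop)) ?_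
  refine (continuous_twist (c i)).comp (continuous_fst.prodMk ?_)
  exact continuous_roundOut.comp
    (f := fun p : ℝ × ℝ × ℝ => (p.2.1 / D.t, p.2.2 / D.t)) (by fun_prop)

/-! ### The surfaces in a neighbourhood of the link -/

/-- The half-tiles over half an edge of length `L`, of all radii. -/
def triSet (t L : ℝ) : Set (ℝ × ℝ × ℝ × ℝ) := {p | InTri t L p.1 p.2.1 p.2.2.1 p.2.2.2}

/-- The height is discontinuous at the corners, but the whole segment over a corner belongs to the
set, which is therefore closed. -/
theorem isCompact_triSet {t L : ℝ} (hL : 2 * t < L) : IsCompact (triSet t L) := by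
  let B : Set (ℝ × ℝ × ℝ × ℝ) :=
    Icc 0 t ×ˢ Icc 0 (L / 2) ×ˢ Icc (-t) t ×ˢ Icc 0 1
  have hB : IsCompact B :=
    isCompact_Icc.prod (isCompact_Icc.prod (isCompact_Icc.prod isCompact_Icc))
  refine hB.of_isClosed_subset ?_ ?_
  · let E : Set (ℝ × ℝ × ℝ × ℝ) := {p | 0 ≤ p.1 ∧ p.1 ≤ t ∧ p.1 ≤ p.2.1 ∧ p.2.1 ≤ L / 2 ∧
      |p.2.2.1| ≤ p.1 ∧ 0 ≤ p.2.2.2 ∧ p.2.2.2 ≤ 1}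
    have hE : IsClosed E := by
      have h1 : IsClosed {p : ℝ × ℝ × ℝ × ℝ | 0 ≤ p.1} := isClosed_le (by fun_prop) (by fun_prop)
      have h2 : IsClosed {p : ℝ × ℝ × ℝ × ℝ | p.1 ≤ t} := isClosed_le (by fun_prop) (by fun_prop)
      have h3 : IsClosed {p : ℝ × ℝ × ℝ × ℝ | p.1 ≤ p.2.1} :=
        isClosed_le (by fun_prop) (by fun_prop)
      have h4 : IsClosed {p : ℝ × ℝ × ℝ × ℝ | p.2.1 ≤ L / 2} :=
        isClosed_le (by fun_prop) (by fun_prop)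
      have h5 : IsClosed {p : ℝ × ℝ × ℝ × ℝ | |p.2.2.1| ≤ p.1} :=
        isClosed_le (by fun_prop) (by fun_prop)
      have h6 : IsClosed {p : ℝ × ℝ × ℝ × ℝ | 0 ≤ p.2.2.2} :=
        isClosed_le (by fun_prop) (by fun_prop)
      have h7 : IsClosed {p : ℝ × ℝ × ℝ × ℝ | p.2.2.2 ≤ 1} :=
        isClosed_le (by fun_prop) (by fun_prop)
      exact h1.inter (h2.inter (h3.inter (h4.inter (h5.inter (h6.inter h7)))))
    let C : Set (ℝ × ℝ × ℝ × ℝ) := {p | p.2.1 = p.1 ∧ |p.2.2.1| = p.1}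
    have hC : IsClosed C :=
      (isClosed_eq (by fun_prop) (by fun_prop)).inter (isClosed_eq (by fun_prop) (by fun_prop))
    let G : Set (ℝ × ℝ × ℝ × ℝ) := {p | p ∈ E ∧ p ∉ C ∧ p.2.2.2 = edgeHeight L p.1 p.2.1 p.2.2.1}
    have hmem : ∀ p, p ∈ triSet t L ↔ p ∈ (E ∩ C) ∪ G := by
      intro p
      constructor
      · intro h
        have hpE : p ∈ E := ⟨h.s_nonneg, h.s_le, h.s_le_x, h.x_le, h.y_le, h.τ_nonneg, h.τ_le⟩
        by_cases hpC : p ∈ C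
        · exact Or.inl ⟨hpE, hpC⟩
        · exact Or.inr ⟨hpE, hpC, h.corner_or.resolve_left hpC⟩
      · rintro (⟨⟨h1, h2, h3, h4, h5, h6, h7⟩, h8⟩ | ⟨⟨h1, h2, h3, h4, h5, h6, h7⟩, -, h8⟩)
        · exact ⟨h1, h2, h3, h4, h5, h6, h7, Or.inl h8⟩
        · exact ⟨h1, h2, h3, h4, h5, h6, h7, Or.inr h8⟩
    have hcont : ContinuousOn (fun p : ℝ × ℝ × ℝ × ℝ => p.2.2.2 - edgeHeight L p.1 p.2.1 p.2.2.1)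
        {p | p ∈ E ∧ p ∉ C} := by
      refine ContinuousOn.sub (by fun_prop) ((continuousOn_edgeHeight L).comp
        (f := fun p : ℝ × ℝ × ℝ × ℝ => (p.1, p.2.1, p.2.2.1)) (by fun_prop) ?_)
      rintro p ⟨⟨h1, h2, h3, h4, h5, h6, h7⟩, h8⟩
      refine ⟨h1, by simp only; linarith, ⟨h3, by simp only; linarith⟩, h5, ?_⟩
      rintro ⟨h9 | h9, h10⟩
      · exact h8 ⟨h9, h10⟩
      · simp only at h9
        linarith
    have heq : triSet t L = (E ∩ C) ∪ G := Set.ext hmem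
    rw [heq]
    refine isClosed_of_closure_subset ?_
    rw [closure_union, (hE.inter hC).closure_eq]
    rintro p (hp | hp)
    · exact Or.inl hp
    · have hpE : p ∈ E := closure_minimal (fun q hq => hq.1) hE hp
      by_cases hpC : p ∈ C
      · exact Or.inl ⟨hpE, hpC⟩
      · right
        refine ⟨hpE, hpC, ?_⟩
        have h1 : ContinuousWithinAt (fun p : ℝ × ℝ × ℝ × ℝ =>
            p.2.2.2 - edgeHeight L p.1 p.2.1 p.2.2.1) G p :=
          (hcont p ⟨hpE, hpC⟩).mono fun q hq => ⟨hq.1, hq.2.1⟩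
        have h2 := h1.mem_closure (t := {0}) hp fun q hq => sub_eq_zero.2 hq.2.2
        rw [closure_singleton] at h2
        exact sub_eq_zero.1 h2
  · intro p h
    have h1 := abs_le.1 h.y_le
    have h2 := h.s_le
    exact ⟨⟨h.s_nonneg, h.s_le⟩, ⟨h.s_nonneg.trans h.s_le_x, h.x_le⟩,
      ⟨by linarith, by linarith⟩, ⟨h.τ_nonneg, h.τ_le⟩⟩

theorem continuousOn_coreParam {t L : ℝ} (hL : 2 * t < L) :
    ContinuousOn (fun p : ℝ × ℝ × ℝ × ℝ => coreParam L p.1 p.2.2.1 p.2.2.2) (triSet t L) := by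
  have h1 : ContinuousOn (fun p : ℝ × ℝ × ℝ × ℝ => edgeHeight L p.1 (L / 2) p.2.2.1)
      (triSet t L) := by
    refine (continuousOn_edgeHeight L).comp
      (f := fun p : ℝ × ℝ × ℝ × ℝ => (p.1, L / 2, p.2.2.1)) (by fun_prop) ?_
    intro p h
    have h2 := h.s_le
    refine ⟨h.s_nonneg, by simp only; linarith, ⟨by simp only; linarith, by simp only; linarith⟩,
      h.y_le, ?_⟩
    rintro ⟨h3 | h3, -⟩ <;> simp only at h3 <;> linarith
  refine ContinuousOn.div (ContinuousOn.sub (by fun_prop) h1) (continuousOn_const.sub h1) ?_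
  intro p h
  have := mid_lt_one h.s_nonneg (h.two_s_lt hL) h.y_le
  linarith

/-- The data `D` or its swap, depending on whether horizontal or vertical edges are considered. -/
def axis (a : Bool) : EdgeData ι := if a then D else D.swap

/-- The point of the join given by a point of a half-tile over a horizontal (`a = true`) or a
vertical (`a = false`) half-edge. -/
def piecePos (a : Bool) (i : ι) (ε : Bool) (p : ℝ × ℝ × ℝ × ℝ) : S1 × S1 × ℝ :=
  if a then D.pos i ε p else joinSwap (D.swap.pos i ε p)

/-- The block coordinates of a point of a half-tile over a half-edge. -/
def pieceBlock (a : Bool) (i : ι) (ε : Bool) (p : ℝ × ℝ × ℝ × ℝ) : BlockPt ι :=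
  if a then D.block i ε p else blockSwap (D.swap.block i ε p)

/-- The half-tiles over a half-edge. -/
def piece (a : Bool) (i : ι) (ε : Bool) : Set (ℝ × ℝ × ℝ × ℝ) :=
  triSet D.t ((D.axis a).len i ε)

theorem two_t_lt_axis_len (a : Bool) (i : ι) (ε : Bool) : 2 * D.t < (D.axis a).len i ε := by
  cases a
  · exact D.swap.two_t_lt_len i ε
  · exact D.two_t_lt_len i ε

/-- Two points of half-tiles coincide in the join if and only if their block coordinates are
glued. -/
theorem joinEq_iff_blockRel {a a' : Bool} {i j : ι} {ε ε' : Bool} {p p' : ℝ × ℝ × ℝ × ℝ}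
    (h : p ∈ D.piece a i ε) (h' : p' ∈ D.piece a' j ε') :
    JoinEq (D.piecePos a i ε p) (D.piecePos a' j ε' p') ↔
      D.BlockRel (D.pieceBlock a i ε p) (D.pieceBlock a' j ε' p') := by
  cases a <;> cases a'
  · simp only [piecePos, pieceBlock, Bool.false_eq_true, if_false]
    rw [joinEq_joinSwap, ← D.blockRel_blockSwap, blockSwap_blockSwap, blockSwap_blockSwap]
    exact ⟨D.swap.blockRel_of_joinEq h h', D.swap.joinEq_of_blockRel h h'⟩
  · simp only [piecePos, pieceBlock, Bool.false_eq_true, if_false, if_true]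
    exact ⟨fun hj => (D.blockRel_of_joinEq_swap h' h hj.symm).symm,
      fun hb => (D.joinEq_of_blockRel_swap h' h hb.symm).symm⟩
  · simp only [piecePos, pieceBlock, Bool.false_eq_true, if_false, if_true]
    exact ⟨D.blockRel_of_joinEq_swap h h', D.joinEq_of_blockRel_swap h h'⟩
  · simp only [piecePos, pieceBlock, if_true]
    exact ⟨D.blockRel_of_joinEq h h', D.joinEq_of_blockRel h h'⟩

theorem piecePos_mem {a : Bool} {i : ι} {ε : Bool} {p : ℝ × ℝ × ℝ × ℝ} (h : p ∈ D.piece a i ε) :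
    (D.piecePos a i ε p).2.2 ∈ Icc (0 : ℝ) 1 := by
  have h1 : 0 ≤ p.2.2.2 := InTri.τ_nonneg h
  have h2 : p.2.2.2 ≤ 1 := InTri.τ_le h
  cases a
  · exact ⟨sub_nonneg.2 h2, by change 1 - p.2.2.2 ≤ 1; linarith⟩
  · exact ⟨h1, h2⟩

theorem pieceBlock_mem {a : Bool} {i : ι} {ε : Bool} {p : ℝ × ℝ × ℝ × ℝ}
    (h : p ∈ D.piece a i ε) : (D.pieceBlock a i ε p).2.1 ∈ Icc (0 : ℝ) 1 := by
  have h1 := InTri.coreParam_mem h (D.two_t_lt_axis_len a i ε)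
  cases a
  · exact ⟨sub_nonneg.2 h1.2, (sub_le_self_iff _).2 h1.1⟩
  · exact h1

/-- The norm `|z₁| + |z₂|` of the block coordinates is the radius. -/
theorem pieceBlock_norm {a : Bool} {i : ι} {ε : Bool} {p : ℝ × ℝ × ℝ × ℝ}
    (h : p ∈ D.piece a i ε) :
    |(D.pieceBlock a i ε p).2.2.1| + |(D.pieceBlock a i ε p).2.2.2| = p.1 := by
  have key : ∀ D : EdgeData ι, p ∈ triSet D.t (D.len i ε) →
      |(D.block i ε p).2.2.1| + |(D.block i ε p).2.2.2| = p.1 := by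
    intro D h
    have hL := D.two_t_lt_len i ε
    have h1 := InTri.coreParam_mem h hL
    simp only [block]
    rw [abs_sgn_mul, abs_of_nonneg (sub_coreParam_mul_nonneg hL h), abs_mul,
      abs_of_nonneg (sub_nonneg.2 h1.2)]
    ring
  cases a
  · change |(D.swap.block i ε p).2.2.2| + |(D.swap.block i ε p).2.2.1| = p.1
    rw [add_comm]
    exact key D.swap h
  · exact key D h

theorem continuous_piecePos (a : Bool) (i : ι) (ε : Bool) : Continuous (D.piecePos a i ε) := by
  have hc : Continuous fun r : ℝ => (r : S1) := AddCircle.continuous_mk' _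
  have key : ∀ D : EdgeData ι, Continuous (D.pos i ε) := by
    intro D
    refine (continuous_const.add (hc.comp (by fun_prop))).prodMk
      ((continuous_const.add (hc.comp (by fun_prop))).prodMk (by fun_prop))
  cases a
  · have hj : Continuous joinSwap := by unfold joinSwap; fun_prop
    exact hj.comp (key D.swap)
  · exact key D

theorem continuousOn_frame_pieceBlock (c : ι → Bool) (a : Bool) (i : ι) (ε : Bool) :
    ContinuousOn (fun p => D.frame c (D.pieceBlock a i ε p)) (D.piece a i ε) := by
  have key : ∀ D : EdgeData ι, ContinuousOn (fun p => (D.block i ε p).2)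
      (triSet D.t (D.len i ε)) := by
    intro D
    have h1 := continuousOn_coreParam (D.two_t_lt_len i ε)
    simp only [block]
    have h2 : ContinuousOn (fun p : ℝ × ℝ × ℝ × ℝ => 1 - coreParam (D.len i ε) p.1 p.2.2.1 p.2.2.2)
      (triSet D.t (D.len i ε)) := continuousOn_const.sub h1
    refine h1.prodMk (ContinuousOn.prodMk ?_ ?_)
    · exact continuousOn_const.mul
        (ContinuousOn.sub (by fun_prop) (h2.mul (by fun_prop)))
    · exact h2.mul (by fun_prop)
  cases a
  · have hs : Continuous fun q : ℝ × ℝ × ℝ => (1 - q.1, q.2.2, q.2.1) := by fun_prop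
    exact (D.continuous_frame c i).comp_continuousOn (hs.comp_continuousOn (key D.swap))
  · exact (D.continuous_frame c i).comp_continuousOn (key D)

/-- The union of the arcs `v̂` over the vertices of the diagram. -/
def core : Set S3 := ⋃ i, hatPoint (D.θ i, D.φ i)

/-- The union of the half-tiles whose radii belong to `S`. -/
def shell (S : Set ℝ) : Set S3 :=
  {q | ∃ a i ε, ∃ p ∈ D.piece a i ε, p.1 ∈ S ∧ joinMk (D.piecePos a i ε p) = q}

/-- Every block coordinate of norm at most `t` is attained on some half-tile. -/
theorem exists_pieceBlock_eq {i : ι} {σ z₁ z₂ : ℝ} (hσ : σ ∈ Icc (0 : ℝ) 1)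
    (hz : |z₁| + |z₂| ≤ D.t) :
    ∃ a ε, ∃ p ∈ D.piece a i ε, D.pieceBlock a i ε p = (i, σ, z₁, z₂) := by
  have key : ∀ (D : EdgeData ι) (σ z₁ z₂ : ℝ), σ ∈ Icc (0 : ℝ) 1 → |z₁| + |z₂| ≤ D.t →
      |z₂| ≤ (1 - σ) * (|z₁| + |z₂|) →
      ∃ ε, ∃ p ∈ triSet D.t (D.len i ε), D.block i ε p = (i, σ, z₁, z₂) := by
    intro D σ z₁ z₂ hσ hz hle
    obtain ⟨ε, hε⟩ : ∃ ε, sgn ε * |z₁| = z₁ := by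
      rcases le_total 0 z₁ with h | h
      · exact ⟨true, by rw [sgn_true, one_mul, abs_of_nonneg h]⟩
      · exact ⟨false, by rw [sgn_false, abs_of_nonpos h]; ring⟩
    set s := |z₁| + |z₂| with hs
    have hs0 : 0 ≤ s := by positivity
    have hL := D.two_t_lt_len i ε
    have hL' : 2 * s < D.len i ε := by linarith
    obtain ⟨y, hy, hyz⟩ : ∃ y, |y| ≤ s ∧ (1 - σ) * y = z₂ := by
      rcases hσ.2.eq_or_lt with h1 | h1
      · refine ⟨0, by simpa using hs0, ?_⟩
        rw [h1, sub_self, zero_mul] at hle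
        rw [mul_zero, abs_nonpos_iff.1 hle]
      · have h2 : 0 < 1 - σ := by linarith
        refine ⟨z₂ / (1 - σ), ?_, by field_simp⟩
        rw [abs_div, abs_of_pos h2, div_le_iff₀ h2]
        linarith
    set k := edgeHeight (D.len i ε) s (D.len i ε / 2) y with hk
    have hk1 : k < 1 := mid_lt_one hs0 hL' hy
    have hk0 : 0 ≤ k := (edgeHeight_mem _ _ _ _).1
    set τ := σ + (1 - σ) * k with hτ
    have hτ0 : k ≤ τ := by
      have := mul_nonneg hσ.1 (sub_nonneg.2 hk1.le)
      rw [hτ]; linarith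
    have hτ1 : τ ≤ 1 := by
      have := mul_nonneg (sub_nonneg.2 hσ.2) (sub_nonneg.2 hk1.le)
      rw [hτ]; linarith
    have hcore : coreParam (D.len i ε) s y τ = σ := by
      rw [coreParam, ← hk, div_eq_iff (by linarith), hτ]
      ring
    obtain ⟨x, hx1, hx2, hx3⟩ : ∃ x, s ≤ x ∧ x ≤ D.len i ε / 2 ∧
        ((x = s ∧ |y| = s) ∨ τ = edgeHeight (D.len i ε) s x y) := by
      rcases hy.eq_or_lt with h1 | h1
      · exact ⟨s, le_rfl, by linarith, Or.inl ⟨rfl, h1⟩⟩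
      · have hcont : ContinuousOn (fun x => edgeHeight (D.len i ε) s x y)
            (Icc s (D.len i ε / 2)) := by
          refine (continuousOn_edgeHeight (D.len i ε)).comp
            (f := fun x : ℝ => (s, x, y)) (by fun_prop) ?_
          intro x hx
          exact ⟨hs0, hL', ⟨hx.1, by simp only; linarith [hx.2]⟩, hy, fun h => h1.ne h.2⟩
        have hivt := intermediate_value_Icc' (by linarith : s ≤ D.len i ε / 2) hcont
        rw [edgeHeight_eq_one hL' h1, ← hk] at hivt
        obtain ⟨x, hx, hxe⟩ := hivt ⟨hτ0, hτ1⟩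
        exact ⟨x, hx.1, hx.2, Or.inr hxe.symm⟩
    refine ⟨ε, (s, x, y, τ), ⟨hs0, hz, hx1, hx2, hy, hk0.trans hτ0, hτ1, hx3⟩, ?_⟩
    simp only [block, hcore]
    rw [hyz]
    have h2 : (1 - σ) * |y| = |z₂| := by
      rw [← abs_of_nonneg (sub_nonneg.2 hσ.2), ← abs_mul, hyz]
    rw [h2, hs, add_sub_cancel_right, hε]
  by_cases hle : |z₂| ≤ (1 - σ) * (|z₁| + |z₂|)
  · obtain ⟨ε, p, hp, he⟩ := key D σ z₁ z₂ hσ hz hle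
    exact ⟨true, ε, p, hp, he⟩
  · obtain ⟨ε, p, hp, he⟩ := key D.swap (1 - σ) z₂ z₁ ⟨by linarith [hσ.2], by linarith [hσ.1]⟩
      (by rw [add_comm]; exact hz) (by
        rw [sub_sub_cancel, add_comm |z₂|]
        linarith)
    refine ⟨false, ε, p, hp, ?_⟩
    simp only [pieceBlock, Bool.false_eq_true, if_false, he, blockSwap, sub_sub_cancel]

end EdgeData

/-! ### The embedding of the solid tori -/

namespace EdgeData

variable {ι : Type} (D : EdgeData ι)

theorem joinMk_mem_core (i : ι) (σ : ℝ) : joinMk (D.θ i, D.φ i, σ) ∈ D.core :=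
  mem_iUnion.2 ⟨i, mem_range_self _⟩

theorem exists_of_mem_core {q : S3} (hq : q ∈ D.core) :
    ∃ i, ∃ σ ∈ Icc (0 : ℝ) 1, joinMk (D.θ i, D.φ i, σ) = q := by
  obtain ⟨i, τ, rfl⟩ := mem_iUnion.1 hq
  exact ⟨i, τ, τ.2, (mk_eq_joinMk _ _ _).symm⟩

theorem norm_frame_pieceBlock (c : ι → Bool) {a : Bool} {i : ι} {ε : Bool} {p : ℝ × ℝ × ℝ × ℝ}
    (h : p ∈ D.piece a i ε) : ‖(D.frame c (D.pieceBlock a i ε p)).2‖ = p.1 / D.t := by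
  rw [frame, norm_twist, norm_roundOut, abs_div, abs_div, abs_of_pos D.t_pos, ← add_div,
    D.pieceBlock_norm h]

/-- On a half-tile of radius `0` the block coordinates are those of a point of the link. -/
theorem joinMk_piecePos_of_radius_eq_zero (c : ι → Bool) {a : Bool} {i : ι} {ε : Bool}
    {p : ℝ × ℝ × ℝ × ℝ} (h : p ∈ D.piece a i ε) (h0 : p.1 = 0) :
    joinMk (D.piecePos a i ε p) = (D.frame c (D.pieceBlock a i ε p)).1 := by
  obtain ⟨s, x, y, τ⟩ := p
  obtain ⟨h1, h2, h3⟩ := InTri.of_s_eq_zero h (D.two_t_lt_axis_len a i ε) h0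
  have hm := D.piecePos_mem h
  have hb := D.pieceBlock_mem h
  simp only at h1 h2 h3
  rw [frame, joinMk_eq_iff hm hb]
  cases a
  · simp only [axis, Bool.false_eq_true, if_false] at h2
    simp only [piecePos, pieceBlock, Bool.false_eq_true, if_false, joinSwap, blockSwap, pos,
      block, JoinEq, h1]
    rw [h1] at h2
    refine ⟨by rw [h2], Or.inl ?_, ?_⟩
    · change D.θ i + _ = D.θ i
      simp
    · rcases h3 with h3 | h3
      · right; rw [h3, sub_zero]
      · left
        change D.φ i + _ = D.φ i
        rw [h3]; simp
  · simp only [axis, if_true] at h2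
    simp only [piecePos, pieceBlock, if_true, pos, block, JoinEq, h1]
    rw [h1] at h2
    refine ⟨by rw [h2], ?_, Or.inl (by simp)⟩
    rcases h3 with h3 | h3
    · exact Or.inr h3
    · left; rw [h3]; simp

/-- The framed block coordinates and the position in the join are two quotient maps of the disjoint
union of the half-tiles with the same fibres, and so they differ by an embedding of the product of
the link and the disc. It takes the circles of radius `s / t` to the half-tiles of radius `s`. -/
theorem exists_embedding [Finite ι] :
    ∃ e : D.core × Metric.closedBall (0 : ℂ) 1 → S3, IsEmbedding e ∧
      (∀ p, (p.2 : ℂ) = 0 → e p = p.1) ∧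
      ∀ S : Set ℝ, e '' {p | D.t * ‖(p.2 : ℂ)‖ ∈ S} = D.shell S := by
  obtain ⟨c, hh, hv⟩ := exists_coloring D.h D.v D.h_h D.v_v
    (fun i h => D.θ_h_ne i (by rw [h])) (fun i h => D.φ_v_ne i (by rw [h]))
  have ht := D.t_pos
  -- `f` is the framed block coordinates, and `g` the position in the join
  let M := Σ k : Bool × ι × Bool, D.piece k.1 k.2.1 k.2.2
  have : ∀ k : Bool × ι × Bool, CompactSpace (D.piece k.1 k.2.1 k.2.2) := fun k =>
    isCompact_iff_compactSpace.1 (isCompact_triSet (D.two_t_lt_axis_len _ _ _))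
  let F : M → S3 × ℂ := fun m => D.frame c (D.pieceBlock m.1.1 m.1.2.1 m.1.2.2 m.2)
  let g : M → S3 := fun m => joinMk (D.piecePos m.1.1 m.1.2.1 m.1.2.2 m.2)
  have hFn : ∀ m : M, D.t * ‖(F m).2‖ = m.2.1.1 := by
    intro m
    rw [D.norm_frame_pieceBlock c m.2.2]
    field_simp
  have hFball : ∀ m : M, (F m).2 ∈ Metric.closedBall (0 : ℂ) 1 := by
    intro m
    rw [mem_closedBall_zero_iff, D.norm_frame_pieceBlock c m.2.2, div_le_one ht]
    exact InTri.s_le m.2.2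
  let f : M → D.core × Metric.closedBall (0 : ℂ) 1 := fun m =>
    (⟨(F m).1, D.joinMk_mem_core _ _⟩, ⟨(F m).2, hFball m⟩)
  have hFc : Continuous F := continuous_sigma fun k =>
    (D.continuousOn_frame_pieceBlock c k.1 k.2.1 k.2.2).domRestrict
  have hfc : Continuous f :=
    (hFc.fst.subtype_mk _).prodMk (hFc.snd.subtype_mk _)
  have hgc : Continuous g := continuous_sigma fun k =>
    continuous_joinMk.comp ((D.continuous_piecePos k.1 k.2.1 k.2.2).comp continuous_subtype_val)
  have hfg : ∀ m m', f m = f m' ↔ g m = g m' := by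
    intro m m'
    have h1 : f m = f m' ↔ F m = F m' := by
      simp only [f, Prod.ext_iff, Subtype.ext_iff]
    rw [h1, D.frame_eq_iff hh hv (D.pieceBlock_mem m.2.2) (D.pieceBlock_mem m'.2.2),
      joinMk_eq_iff (D.piecePos_mem m.2.2) (D.piecePos_mem m'.2.2),
      D.joinEq_iff_blockRel m.2.2 m'.2.2]
  have hfs : Function.Surjective f := by
    rintro ⟨⟨q, hq⟩, ⟨w, hw⟩⟩
    obtain ⟨i, σ, hσ, rfl⟩ := D.exists_of_mem_core hq
    obtain ⟨w', hw'⟩ := twist_surjective (c i) σ w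
    obtain ⟨z₁, z₂, hz⟩ := roundOut_surjective w'
    have hle : |D.t * z₁| + |D.t * z₂| ≤ D.t := by
      have h1 : |z₁| + |z₂| ≤ 1 := by
        rw [← norm_roundOut, hz, ← norm_twist (c i) σ, hw']
        exact mem_closedBall_zero_iff.1 hw
      rw [abs_mul, abs_mul, abs_of_pos ht, ← mul_add]
      exact mul_le_of_le_one_right ht.le h1
    obtain ⟨a, ε, p, hp, he⟩ := D.exists_pieceBlock_eq (i := i) hσ hle
    refine ⟨⟨(a, i, ε), p, hp⟩, ?_⟩
    have hF : F ⟨(a, i, ε), p, hp⟩ = (joinMk (D.θ i, D.φ i, σ), w) := by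
      change D.frame c (D.pieceBlock a i ε p) = _
      rw [he, frame]
      simp only [mul_div_cancel_left₀ _ ht.ne', hz, hw']
    refine Prod.ext (Subtype.ext ?_) (Subtype.ext ?_)
    · exact congrArg Prod.fst hF
    · exact congrArg Prod.snd hF
  have hfq : IsQuotientMap f := hfc.isClosedMap.isQuotientMap hfc hfs
  let e : D.core × Metric.closedBall (0 : ℂ) 1 → S3 := fun p => g (Function.surjInv hfs p)
  have hef : ∀ m, e (f m) = g m := fun m =>
    (hfg _ _).1 (Function.surjInv_eq hfs (f m))
  have hec : Continuous e := by
    rw [hfq.continuous_iff]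
    exact hgc.congr fun m => (hef m).symm
  have hei : Function.Injective e := by
    intro p q h
    obtain ⟨m, rfl⟩ := hfs p
    obtain ⟨m', rfl⟩ := hfs q
    rw [hef, hef] at h
    exact (hfg _ _).2 h
  have : CompactSpace (D.core × Metric.closedBall (0 : ℂ) 1) := hfs.compactSpace hfc
  refine ⟨e, (hec.isClosedEmbedding hei).isEmbedding, ?_, ?_⟩
  · intro p h0
    obtain ⟨m, rfl⟩ := hfs p
    rw [hef]
    refine D.joinMk_piecePos_of_radius_eq_zero c m.2.2 ?_
    rw [← hFn m]
    change (F m).2 = 0 at h0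
    rw [h0, norm_zero, mul_zero]
  · intro S
    ext q
    constructor
    · rintro ⟨p, hp, rfl⟩
      obtain ⟨m, rfl⟩ := hfs p
      change D.t * ‖(F m).2‖ ∈ S at hp
      rw [hFn] at hp
      exact ⟨m.1.1, m.1.2.1, m.1.2.2, m.2.1, m.2.2, hp, (hef m).symm⟩
    · rintro ⟨a, i, ε, p, hp, hS, rfl⟩
      refine ⟨f ⟨(a, i, ε), p, hp⟩, ?_, hef _⟩
      change D.t * ‖(F ⟨(a, i, ε), p, hp⟩).2‖ ∈ S
      rwa [hFn]

/-- If the open tube is open, it is a tubular neighbourhood of the link. -/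
theorem isTubularNeighborhood_of_isOpen [Finite ι] (ho : IsOpen (D.shell (Iio D.t))) :
    IsTubularNeighborhood D.core (D.shell (Iio D.t)) (D.shell {D.t}) := by
  obtain ⟨e, he, h0, hS⟩ := D.exists_embedding
  have ht := D.t_pos
  have h1 : {p : D.core × Metric.closedBall (0 : ℂ) 1 | ‖(p.2 : ℂ)‖ < 1} =
      {p | D.t * ‖(p.2 : ℂ)‖ ∈ Iio D.t} := by
    ext p
    exact (mul_lt_iff_lt_one_right ht).symm
  have h2 : {p : D.core × Metric.closedBall (0 : ℂ) 1 | ‖(p.2 : ℂ)‖ = 1} =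
      {p | D.t * ‖(p.2 : ℂ)‖ ∈ ({D.t} : Set ℝ)} := by
    ext p
    exact (mul_eq_left₀ ht.ne').symm
  have h3 := hS (Iio D.t)
  have h4 := hS {D.t}
  rw [← h1] at h3
  rw [← h2] at h4
  refine ⟨ho, ?_, e, he, h0, h3, h4⟩
  have hcore : CompactSpace D.core := isCompact_iff_compactSpace.1 (isCompact_iUnion fun i =>
    isCompact_range (continuous_mk.comp (f := fun τ => (D.θ i, D.φ i, τ)) (by fun_prop)))
  have hcl : IsClosed (range e) := (isCompact_range he.continuous).isClosed
  have hN : ∀ p, e p ∈ D.shell (Iio D.t) ↔ ‖(p.2 : ℂ)‖ < 1 := by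
    intro p
    rw [← h3]
    exact he.injective.mem_set_image
  have hle : ∀ p : D.core × Metric.closedBall (0 : ℂ) 1, ‖(p.2 : ℂ)‖ ≤ 1 := fun p =>
    mem_closedBall_zero_iff.1 p.2.2
  rw [ho.frontier_eq, ← h4]
  apply Subset.antisymm
  · rintro q ⟨hq, hqN⟩
    have h5 : closure (D.shell (Iio D.t)) ⊆ range e :=
      closure_minimal (by rw [← h3]; exact image_subset_range _ _) hcl
    obtain ⟨p, rfl⟩ := h5 hq
    rw [hN] at hqN
    exact ⟨p, le_antisymm (hle p) (not_lt.1 hqN), rfl⟩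
  · rintro _ ⟨p, hp, rfl⟩
    refine ⟨?_, fun h => ((hN p).1 h).ne hp⟩
    -- a radius of the disc ending at `p`
    let γ : ℝ → D.core × Metric.closedBall (0 : ℂ) 1 := fun r =>
      (p.1, ⟨((projIcc 0 1 zero_le_one r : ℝ) : ℂ) * p.2, by
        rw [mem_closedBall_zero_iff, norm_mul, Complex.norm_real,
          Real.norm_of_nonneg (projIcc 0 1 zero_le_one r).2.1, hp, mul_one]
        exact (projIcc 0 1 zero_le_one r).2.2⟩)
    have hγ : Continuous γ := by
      have : Continuous (projIcc (0 : ℝ) 1 zero_le_one) := continuous_projIcc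
      refine continuous_const.prodMk (Continuous.subtype_mk ?_ _)
      fun_prop
    have hγ1 : γ 1 = p := by
      refine Prod.ext rfl (Subtype.ext ?_)
      simp only [γ, projIcc_right]
      simp
    have h5 : (1 : ℝ) ∈ closure (Iio 1) := by rw [closure_Iio]; exact self_mem_Iic
    have h6 := map_mem_closure (he.continuous.comp hγ) h5 (t := D.shell (Iio D.t)) (by
      intro r hr
      rw [Function.comp_apply, hN]
      simp only [γ, norm_mul, Complex.norm_real]
      rw [Real.norm_of_nonneg (projIcc 0 1 zero_le_one r).2.1, coe_projIcc,
        show ‖(p.2 : ℂ)‖ = 1 from hp, mul_one]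
      exact max_lt one_pos (min_lt_of_right_lt (mem_Iio.1 hr)))
    rwa [Function.comp_apply, hγ1] at h6

end EdgeData

/-! ### The open tube -/

theorem joinMk_joinSwap_eq_iff {p q : S1 × S1 × ℝ} (hp : p.2.2 ∈ Icc (0 : ℝ) 1)
    (hq : q.2.2 ∈ Icc (0 : ℝ) 1) : joinMk (joinSwap p) = joinMk (joinSwap q) ↔
      joinMk p = joinMk q := by
  have h : ∀ {p : S1 × S1 × ℝ}, p.2.2 ∈ Icc (0 : ℝ) 1 → (joinSwap p).2.2 ∈ Icc (0 : ℝ) 1 :=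
    fun h => ⟨sub_nonneg.2 h.2, (sub_le_self_iff _).2 h.1⟩
  rw [joinMk_eq_iff (h hp) (h hq), joinMk_eq_iff hp hq, joinEq_joinSwap]

namespace EdgeData

variable {ι : Type} (D : EdgeData ι)

theorem piece_swap (a : Bool) (i : ι) (ε : Bool) : D.swap.piece a i ε = D.piece (!a) i ε := by
  cases a <;> rfl

theorem piecePos_swap (a : Bool) (i : ι) (ε : Bool) (p : ℝ × ℝ × ℝ × ℝ) :
    D.swap.piecePos a i ε p = joinSwap (D.piecePos (!a) i ε p) := by
  cases a
  · rfl
  · exact (joinSwap_joinSwap _).symm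

theorem joinMk_mem_shell_swap {S : Set ℝ} {q : S1 × S1 × ℝ} (hq : q.2.2 ∈ Icc (0 : ℝ) 1) :
    joinMk (joinSwap q) ∈ D.swap.shell S ↔ joinMk q ∈ D.shell S := by
  constructor
  · rintro ⟨a, i, ε, p, hp, hS, he⟩
    rw [piece_swap] at hp
    rw [piecePos_swap, joinMk_joinSwap_eq_iff (D.piecePos_mem hp) hq] at he
    exact ⟨!a, i, ε, p, hp, hS, he⟩
  · rintro ⟨a, i, ε, p, hp, hS, he⟩
    refine ⟨!a, i, ε, p, ?_, hS, ?_⟩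
    · rwa [piece_swap, Bool.not_not]
    · rw [piecePos_swap, Bool.not_not, joinMk_joinSwap_eq_iff (D.piecePos_mem hp) hq, he]

theorem joinMk_pos_mem_shell {S : Set ℝ} {i : ι} {ε : Bool} {s x y τ : ℝ}
    (h : InTri D.t (D.len i ε) s x y τ) (hS : s ∈ S) :
    joinMk (D.pos i ε (s, x, y, τ)) ∈ D.shell S :=
  ⟨true, i, ε, (s, x, y, τ), h, hS, rfl⟩

end EdgeData

/-- The half-tiles over half an edge fill the region under the half-tile of radius `t`. -/
theorem exists_inTri {t L x y τ : ℝ} (hL : 2 * t < L) (hyx : |y| < x) (hx : x ≤ L / 2)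
    (hyt : |y| < t) (hτ : τ ∈ Icc (0 : ℝ) 1) (h : x < t ∨ t ≤ x ∧ τ < edgeHeight L t x y) :
    ∃ s < t, InTri t L s x y τ := by
  have hy0 := abs_nonneg y
  set m := min x t with hm
  have hmx : m ≤ x := min_le_left _ _
  have hmt : m ≤ t := min_le_right _ _
  have hym : |y| < m := lt_min hyx hyt
  have hcont : ContinuousOn (fun s => edgeHeight L s x y) (Icc |y| m) := by
    refine (continuousOn_edgeHeight L).comp (f := fun s : ℝ => (s, x, y)) (by fun_prop) ?_
    intro s hs
    refine ⟨hy0.trans hs.1, by simp only; linarith [hs.2], ⟨hs.2.trans hmx, by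
      simp only; linarith [hs.2]⟩, hs.1, ?_⟩
    rintro ⟨h1 | h1, h2⟩ <;> simp only at h1 h2 <;> linarith [hs.2]
  have h0 : edgeHeight L |y| x y = 0 :=
    edgeHeight_eq_zero hy0 ⟨hyx.le, by linarith⟩ rfl
  have hτm : τ ≤ edgeHeight L m x y := by
    rcases h with h | h
    · have : m = x := min_eq_left h.le
      rw [this, edgeHeight_eq_one (by linarith) hyx]
      exact hτ.2
    · rw [hm, min_eq_right h.1]
      exact h.2.le
  have hivt := intermediate_value_Icc hym.le hcont
  simp only [h0] at hivt
  obtain ⟨s, hs, hse⟩ := hivt ⟨hτ.1, hτm⟩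
  refine ⟨s, ?_, hy0.trans hs.1, hs.2.trans hmt, hs.2.trans hmx, hx, hs.1, hτ.1, hτ.2,
    Or.inr hse.symm⟩
  rcases h with h | h
  · exact (hs.2.trans hmx).trans_lt h
  · refine lt_of_le_of_ne (hs.2.trans hmt) ?_
    rintro rfl
    exact h.2.ne hse.symm

namespace EdgeData

variable {ι : Type} (D : EdgeData ι)

/-- The open tube contains the whole segment over a point near a vertex of the diagram. -/
theorem joinMk_mem_shell_of_abs_lt {i : ι} {x y τ : ℝ} (hx : |x| < D.t) (hy : |y| < D.t)
    (hτ : τ ∈ Icc (0 : ℝ) 1) :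
    joinMk (D.θ i + (x : S1), D.φ i + (y : S1), τ) ∈ D.shell (Iio D.t) := by
  have key : ∀ (D : EdgeData ι) {x y τ : ℝ}, |x| < D.t → |y| < D.t → τ ∈ Icc (0 : ℝ) 1 →
      |y| ≤ |x| → joinMk (D.θ i + (x : S1), D.φ i + (y : S1), τ) ∈ D.shell (Iio D.t) := by
    intro D x y τ hx hy hτ hyx
    obtain ⟨ε, hε⟩ : ∃ ε, sgn ε * |x| = x := by
      rcases le_total 0 x with h | h
      · exact ⟨true, by rw [sgn_true, one_mul, abs_of_nonneg h]⟩
      · exact ⟨false, by rw [sgn_false, abs_of_nonpos h]; ring⟩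
    have hL := D.two_t_lt_len i ε
    obtain ⟨s, hs, h⟩ : ∃ s < D.t, InTri D.t (D.len i ε) s |x| y τ := by
      rcases hyx.eq_or_lt with h | h
      · exact ⟨|x|, hx, abs_nonneg x, hx.le, le_rfl, by linarith, hyx, hτ.1, hτ.2,
          Or.inl ⟨rfl, h⟩⟩
      · exact exists_inTri hL h (by linarith) hy hτ (Or.inl hx)
    have := D.joinMk_pos_mem_shell h (S := Iio D.t) hs
    rwa [pos, hε] at this
  rcases le_total |y| |x| with h | h
  · exact key D hx hy hτ h
  · have h1 := key D.swap hy hx (τ := 1 - τ) ⟨by linarith [hτ.2], by linarith [hτ.1]⟩ h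
    exact (D.joinMk_mem_shell_swap (q := (D.θ i + (x : S1), D.φ i + (y : S1), τ)) hτ).1 h1

/-- In the coordinates at the vertex `i` in the direction `ε`: the square around the vertex, with
all heights, and the region under the tile of radius `t`. The maximum extends the height by its
value `1` at the short side. -/
def under (i : ι) (ε : Bool) : Set (ℝ × ℝ × unitInterval) :=
  {p | |p.1| < D.t ∧ |p.2.1| < D.t} ∪
    {p | (0 < p.1 ∧ p.1 < D.len i ε - D.t) ∧ |p.2.1| < D.t ∧
      (p.2.2 : ℝ) < edgeHeight (D.len i ε) D.t (max p.1 D.t) p.2.1}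

/-- The coordinates at the vertex `i` in the direction `ε`. -/
def chart (i : ι) (ε : Bool) (p : ℝ × ℝ × unitInterval) : S1 × S1 × unitInterval :=
  (D.θ i + ((sgn ε * p.1 : ℝ) : S1), D.φ i + (p.2.1 : S1), p.2.2)

theorem isOpenMap_chart (i : ι) (ε : Bool) : IsOpenMap (D.chart i ε) := by
  have h1 : IsOpenMap fun r : ℝ => (r : S1) := QuotientAddGroup.isOpenMap_coe
  have h2 : sgn ε ≠ 0 := by cases ε <;> simp
  have h3 : IsOpenMap fun r : ℝ => D.θ i + ((sgn ε * r : ℝ) : S1) :=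
    (isOpenMap_add_left _).comp (h1.comp ((Homeomorph.mulLeft₀ _ h2).isOpenMap))
  have h4 : IsOpenMap fun r : ℝ => D.φ i + (r : S1) := (isOpenMap_add_left _).comp h1
  exact h3.prodMap (h4.prodMap IsOpenMap.id)

theorem isOpen_under (i : ι) (ε : Bool) : IsOpen (D.under i ε) := by
  have hL := D.two_t_lt_len i ε
  have ht := D.t_pos
  refine IsOpen.union ?_ ?_
  · exact (isOpen_lt (f := fun p : ℝ × ℝ × unitInterval => |p.1|) (by fun_prop) (by fun_prop)).inter
      (isOpen_lt (f := fun p : ℝ × ℝ × unitInterval => |p.2.1|) (by fun_prop) (by fun_prop))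
  · let A : Set (ℝ × ℝ × unitInterval) :=
      {p | (0 < p.1 ∧ p.1 < D.len i ε - D.t) ∧ |p.2.1| < D.t}
    have hA : IsOpen A :=
      ((isOpen_lt (g := fun p : ℝ × ℝ × unitInterval => p.1) (by fun_prop) (by fun_prop)).inter
        (isOpen_lt (f := fun p : ℝ × ℝ × unitInterval => p.1) (by fun_prop) (by fun_prop))).inter
      (isOpen_lt (f := fun p : ℝ × ℝ × unitInterval => |p.2.1|) (by fun_prop) (by fun_prop))
    have hc : ContinuousOn (fun p : ℝ × ℝ × unitInterval =>
        edgeHeight (D.len i ε) D.t (max p.1 D.t) p.2.1 - (p.2.2 : ℝ)) A := by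
      refine ContinuousOn.sub ?_ (by fun_prop)
      refine (continuousOn_edgeHeight (D.len i ε)).comp
        (f := fun p : ℝ × ℝ × unitInterval => (D.t, max p.1 D.t, p.2.1)) (by fun_prop) ?_
      rintro p ⟨⟨h1, h2⟩, h3⟩
      exact ⟨ht.le, hL, ⟨le_max_right _ _, max_le h2.le (by linarith)⟩, h3.le,
        fun h => h3.ne h.2⟩
    have := hc.isOpen_inter_preimage hA isOpen_Ioi (t := Ioi 0)
    convert this using 1
    ext p
    simp only [A, mem_ofPred_eq, mem_inter_iff, mem_preimage, mem_Ioi, sub_pos, and_assoc]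

theorem joinMk_mem_shell_of_mem_under {i : ι} {ε : Bool} {p : ℝ × ℝ × unitInterval}
    (h : p ∈ D.under i ε) :
    joinMk (D.θ i + ((sgn ε * p.1 : ℝ) : S1), D.φ i + (p.2.1 : S1), p.2.2) ∈
      D.shell (Iio D.t) := by
  obtain ⟨x, y, τ⟩ := p
  have hL := D.two_t_lt_len i ε
  have key : ∀ {i : ι} {ε : Bool} {x : ℝ}, D.t ≤ x → x ≤ D.len i ε / 2 → |y| < D.t →
      (τ : ℝ) < edgeHeight (D.len i ε) D.t x y →
      joinMk (D.θ i + ((sgn ε * x : ℝ) : S1), D.φ i + (y : S1), τ) ∈ D.shell (Iio D.t) := by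
    intro i ε x h1 h2 h3 h4
    obtain ⟨s, hs, h⟩ := exists_inTri (D.two_t_lt_len i ε) (h3.trans_le h1) h2 h3 τ.2
      (Or.inr ⟨h1, h4⟩)
    exact D.joinMk_pos_mem_shell h (S := Iio D.t) hs
  by_cases hx : |x| < D.t ∧ |y| < D.t
  · exact D.joinMk_mem_shell_of_abs_lt (by rw [abs_sgn_mul]; exact hx.1) hx.2 τ.2
  obtain ⟨⟨h1, h2⟩, h3, h4⟩ := h.resolve_left hx
  simp only at h1 h2 h3 h4 hx ⊢
  have h5 : D.t ≤ x := by
    by_contra h5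
    exact hx ⟨by rw [abs_of_pos h1]; exact not_le.1 h5, h3⟩
  rw [max_eq_left h5] at h4
  rcases le_total x (D.len i ε / 2) with h6 | h6
  · exact key h5 h6 h3 h4
  · have h7 := key (i := D.h i) (ε := !ε) (x := D.len i ε - x) (by linarith)
      (by rw [D.len_h]; linarith) h3 (by rw [D.len_h, edgeHeight_reflect]; exact h4)
    rw [D.φ_h, ← D.θ_h i ε, sgn_not, add_assoc, ← AddCircle.coe_add] at h7
    convert h7 using 5
    ring

/-- At height `0` the tube contains the circles of all longitudes near a longitude of the
diagram. -/
theorem exists_mem_under_of_eq_zero {i : ι} {y : ℝ} (hy : |y| < D.t) (θ : S1) :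
    ∃ j ε, ∃ p ∈ D.under j ε, D.chart j ε p = (θ, D.φ i + (y : S1), 0) := by
  have key : ∀ {i : ι} {ε : Bool} {x : ℝ}, 0 ≤ x → x ≤ D.len i ε / 2 →
      ((x, y, 0) : ℝ × ℝ × unitInterval) ∈ D.under i ε := by
    intro i ε x h1 h2
    have hL := D.two_t_lt_len i ε
    rcases lt_or_ge x D.t with h3 | h3
    · exact Or.inl ⟨by rwa [abs_of_nonneg h1], hy⟩
    · refine Or.inr ⟨⟨D.t_pos.trans_le h3, by simp only; linarith⟩, hy, ?_⟩
      simp only [max_eq_left h3]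
      exact edgeHeight_pos hL ⟨h3, by linarith⟩ hy
  obtain ⟨ε, r, hr0, hr, rfl⟩ := D.exists_θ_eq i θ
  rcases le_total r (D.len i ε / 2) with h6 | h6
  · exact ⟨i, ε, (r, y, 0), key hr0 h6, rfl⟩
  · refine ⟨D.h i, !ε, (D.len i ε - r, y, 0), key (by linarith) (by rw [D.len_h]; linarith), ?_⟩
    rw [chart, D.φ_h, ← D.θ_h i ε, sgn_not, add_assoc, ← AddCircle.coe_add]
    simp only
    congr 3
    ring

/-- The part of the torus times the interval under the tiles over the horizontal edges. -/
def underTiles : Set (S1 × S1 × unitInterval) := ⋃ i, ⋃ ε, D.chart i ε '' D.under i ε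

theorem isOpen_underTiles : IsOpen D.underTiles :=
  isOpen_iUnion fun i => isOpen_iUnion fun ε => D.isOpenMap_chart i ε _ (D.isOpen_under i ε)

/-- Exchange of the two circles of the join, before passing to the quotient. -/
def tripleSwap (q : S1 × S1 × unitInterval) : S1 × S1 × unitInterval :=
  (q.2.1, q.1, unitInterval.symm q.2.2)

/-- A point of a half-tile of radius less than `t` lies below the tile of radius `t`; at height `1`
the coordinate `φ` is forgotten, and it lies over a tile along a vertical edge. -/
theorem mem_underTiles_or {i : ι} {ε : Bool} {s x y τ : ℝ}
    (h : InTri D.t (D.len i ε) s x y τ) (hs : s < D.t) {q : S1 × S1 × unitInterval}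
    (hq : JoinEq (q.1, q.2.1, q.2.2) (D.pos i ε (s, x, y, τ))) :
    q ∈ D.underTiles ∨ tripleSwap q ∈ D.swap.underTiles := by
  obtain ⟨θ, φ, σ⟩ := q
  obtain ⟨h1, h2, h3⟩ := hq
  simp only [pos] at h1 h2 h3
  have hL := D.two_t_lt_len i ε
  have hx0 := h.s_nonneg.trans h.s_le_x
  have hyt : |y| < D.t := h.y_le.trans_lt hs
  by_cases hσ1 : σ = 1
  · right
    have hτ : τ = 1 := by rw [← h1, hσ1]; rfl
    have hx := h.x_eq_of_τ_eq_one hL hτ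
    have hσ0 : (σ : ℝ) ≠ 0 := by rw [hσ1]; exact one_ne_zero
    obtain ⟨j, ε', p, hp, he⟩ := D.swap.exists_mem_under_of_eq_zero (i := i) (y := sgn ε * x)
      (by rw [abs_sgn_mul, abs_of_nonneg hx0, hx]; exact hs) φ
    refine mem_iUnion₂.2 ⟨j, ε', p, hp, he.trans ?_⟩
    rw [tripleSwap, hσ1, h2.resolve_right hσ0]
    simp [swap]
  have hφ := h3.resolve_right fun h => hσ1 (Subtype.ext h)
  left
  by_cases hσ0 : σ = 0
  · obtain ⟨j, ε', p, hp, he⟩ := D.exists_mem_under_of_eq_zero (i := i) hyt θ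
    exact mem_iUnion₂.2 ⟨j, ε', p, hp, he.trans (by rw [hφ, hσ0])⟩
  have hθ := h2.resolve_right fun h => hσ0 (Subtype.ext h)
  refine mem_iUnion₂.2 ⟨i, ε, (x, y, σ), ?_, by rw [chart, hφ, hθ]⟩
  rcases lt_or_ge x D.t with hx | hx
  · exact Or.inl ⟨by rwa [abs_of_nonneg hx0], hyt⟩
  · refine Or.inr ⟨⟨D.t_pos.trans_le hx, by simp only; linarith [h.x_le]⟩, hyt, ?_⟩
    simp only [max_eq_left hx]
    have h4 : τ = edgeHeight (D.len i ε) s x y := by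
      rcases h.corner_or with h4 | h4
      · linarith [h4.1]
      · exact h4
    rw [h1, h4]
    exact edgeHeight_strictMono h.s_nonneg hs hL ⟨hx, by linarith [h.x_le]⟩ h.y_le

/-- The open tube consists of the points below the tiles along horizontal edges and above the tiles
along vertical edges. -/
theorem isOpen_shell : IsOpen (D.shell (Iio D.t)) := by
  have hswap : Continuous tripleSwap := by unfold tripleSwap; fun_prop
  have hU := D.isOpen_underTiles.union (D.swap.isOpen_underTiles.preimage hswap)
  have hsub : ∀ (D : EdgeData ι) {q : S1 × S1 × unitInterval}, q ∈ D.underTiles →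
      joinMk (q.1, q.2.1, q.2.2) ∈ D.shell (Iio D.t) := by
    intro D q hq
    obtain ⟨i, ε, p, hp, rfl⟩ := mem_iUnion₂.1 hq
    exact D.joinMk_mem_shell_of_mem_under hp
  refine (isQuotientMap_quotient_mk' (s := joinSetoid)).isOpen_preimage.1 ?_
  convert hU using 1
  ext q
  change S3.mk q.1 q.2.1 q.2.2 ∈ D.shell (Iio D.t) ↔ _
  rw [mk_eq_joinMk]
  constructor
  · rintro ⟨a, i, ε, ⟨s, x, y, τ⟩, hp, hs, he⟩
    have hj := ((joinMk_eq_iff (D.piecePos_mem hp) q.2.2.2).1 he).symm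
    cases a
    · have h1 := D.swap.mem_underTiles_or hp hs (q := tripleSwap q) (by
        have := joinEq_joinSwap.2 hj
        rwa [piecePos, if_neg Bool.false_ne_true, joinSwap_joinSwap] at this)
      rw [or_comm] at h1
      have h2 : tripleSwap (tripleSwap q) = q := by simp [tripleSwap]
      rwa [h2] at h1
    · exact D.mem_underTiles_or hp hs hj
  · rintro (h | h)
    · exact hsub D h
    · exact (D.joinMk_mem_shell_swap q.2.2.2).1 (hsub D.swap h)

end EdgeData

/-! ### Tiles of the tube -/

/-- The coordinates `(x, y)` along and across an edge of length `L` on the tile of radius `t`,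
without the vertices. -/
def tileDomain (t L : ℝ) : Set (ℝ × ℝ) :=
  {p | p.1 ∈ Icc t (L - t) ∧ |p.2| ≤ t ∧ ¬ ((p.1 = t ∨ p.1 = L - t) ∧ |p.2| = t)}

/-- Every height is the limit of heights of the tile near the corner `(t, ±t)`, since short segments
cutting the corner connect height `1` to height `0`. -/
theorem corner_mem_closure {t L y τ : ℝ} (ht : 0 < t) (hL : 2 * t < L) (hy : |y| = t)
    (hτ : τ ∈ Icc (0 : ℝ) 1) :
    ((t, y) : ℝ × ℝ) ∈ closure {p | p ∈ tileDomain t L ∧ edgeHeight L t p.1 p.2 = τ} := by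
  obtain ⟨e, he, rfl⟩ : ∃ e : ℝ, |e| = 1 ∧ e * t = y := by
    refine ⟨y / t, ?_, by field_simp⟩
    rw [abs_div, hy, abs_of_pos ht, div_self ht.ne']
  rw [Metric.mem_closure_iff]
  intro δ hδ
  -- the segment runs from `(t, ±(t - η))` to `(t + η, ±t)`
  obtain ⟨η, hη, hηδ, hηt, hηL⟩ : ∃ η : ℝ, 0 < η ∧ η < δ ∧ η < t ∧ η < L - 2 * t := by
    obtain ⟨η, h1, h2⟩ := exists_between (lt_min hδ (lt_min ht (sub_pos.2 hL)))
    exact ⟨η, h1, h2.trans_le (min_le_left _ _),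
      h2.trans_le ((min_le_right _ _).trans (min_le_left _ _)),
      h2.trans_le ((min_le_right _ _).trans (min_le_right _ _))⟩
  have habs : ∀ u ∈ Icc 0 η, |e * (t - η + u)| = t - η + u := by
    intro u hu
    rw [abs_mul, he, one_mul, abs_of_nonneg (by linarith [hu.1])]
  have hdom : ∀ u ∈ Icc 0 η, ((t + u, e * (t - η + u)) : ℝ × ℝ) ∈ tileDomain t L := by
    intro u hu
    have h1 := habs u hu
    refine ⟨⟨by simp only; linarith [hu.1], by simp only; linarith [hu.2]⟩, ?_, ?_⟩
    · simp only [h1]; linarith [hu.2]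
    · rintro ⟨h2, h3⟩
      simp only [h1] at h2 h3
      rcases h2 with h2 | h2 <;> linarith [hu.2]
  have hcont : ContinuousOn (fun u => edgeHeight L t (t + u) (e * (t - η + u))) (Icc 0 η) := by
    refine (continuousOn_edgeHeight L).comp
      (f := fun u : ℝ => (t, t + u, e * (t - η + u))) (by fun_prop) ?_
    intro u hu
    obtain ⟨h1, h2, h3⟩ := hdom u hu
    exact ⟨ht.le, hL, h1, h2, h3⟩
  have h0 : edgeHeight L t (t + 0) (e * (t - η + 0)) = 1 := by
    rw [add_zero]
    refine edgeHeight_eq_one hL ?_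
    rw [habs 0 ⟨le_rfl, hη.le⟩]
    linarith
  have h1 : edgeHeight L t (t + η) (e * (t - η + η)) = 0 := by
    refine edgeHeight_eq_zero ht.le ⟨by linarith, by linarith⟩ ?_
    rw [habs η ⟨hη.le, le_rfl⟩]
    linarith
  have hivt := intermediate_value_Icc' hη.le hcont
  simp only [h0, h1] at hivt
  obtain ⟨u, hu, hue⟩ := hivt hτ
  refine ⟨(t + u, e * (t - η + u)), ⟨hdom u hu, hue⟩, ?_⟩
  rw [Prod.dist_eq, Real.dist_eq, Real.dist_eq]
  refine max_lt ?_ ?_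
  · rw [sub_add_cancel_left, abs_neg, abs_of_nonneg hu.1]
    linarith [hu.2]
  · rw [← mul_sub, abs_mul, he, one_mul, abs_of_nonneg (by linarith [hu.2])]
    linarith [hu.1]

namespace EdgeData

variable {ι : Type} (D : EdgeData ι)

/-- The half-tile of radius `t` over the half-edge at `i` in the direction `ε`. -/
def halfTile (i : ι) (ε : Bool) : Set (S1 × S1 × ℝ) :=
  D.pos i ε '' {p | p ∈ triSet D.t (D.len i ε) ∧ p.1 = D.t}

/-- The graph of the height over the tile of radius `t` at the edge from `i` to `h i`. -/
def tileGraph (i : ι) : Set (S1 × S1 × ℝ) :=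
  (fun p : ℝ × ℝ => (D.θ i + (p.1 : S1), D.φ i + (p.2 : S1),
    edgeHeight (D.len i true) D.t p.1 p.2)) '' tileDomain D.t (D.len i true)

theorem isCompact_halfTile (i : ι) (ε : Bool) : IsCompact (D.halfTile i ε) := by
  refine ((isCompact_triSet (D.two_t_lt_len i ε)).inter_right
    (isClosed_eq continuous_fst continuous_const)).image ?_
  exact D.continuous_piecePos true i ε

/-- The graph seen from the other end of the edge. -/
theorem tileGraph_h_subset (i : ι) (x y : ℝ)
    (hp : ((x, y) : ℝ × ℝ) ∈ tileDomain D.t (D.len i true)) :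
    (D.θ (D.h i) + ((sgn false * (D.len i true - x) : ℝ) : S1), D.φ (D.h i) + (y : S1),
      edgeHeight (D.len i true) D.t (D.len i true - x) y) ∈ D.tileGraph i := by
  refine ⟨(x, y), hp, ?_⟩
  rw [edgeHeight_reflect, D.φ_h, ← D.θ_h i true, add_assoc, ← AddCircle.coe_add]
  simp only [sgn_true, sgn_false]
  congr 3
  ring

/-- A tile with corners blown up consists of two half-tiles. -/
theorem closure_image_tileGraph {m : S1 × S1 × ℝ → S3} (hm : Continuous m) (i : ι) :
    closure (m '' D.tileGraph i) =
      m '' (D.halfTile i true ∪ D.halfTile (D.h i) false) := by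
  have ht := D.t_pos
  have hL := D.two_t_lt_len i true
  have hlen : D.len (D.h i) false = D.len i true := D.len_h i true
  apply Subset.antisymm
  · refine closure_minimal (image_mono ?_)
      (((D.isCompact_halfTile i true).union (D.isCompact_halfTile (D.h i) false)).image
        hm).isClosed
    rintro _ ⟨⟨x, y⟩, ⟨h1, h2, h3⟩, rfl⟩
    simp only at h1 h2 h3
    have hk := edgeHeight_mem (D.len i true) D.t x y
    rcases le_total x (D.len i true / 2) with h4 | h4
    · left
      refine ⟨(D.t, x, y, edgeHeight (D.len i true) D.t x y),
        ⟨⟨ht.le, le_rfl, h1.1, h4, h2, hk.1, hk.2, Or.inr rfl⟩, rfl⟩, ?_⟩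
      simp [pos]
    · right
      refine ⟨(D.t, D.len i true - x, y, edgeHeight (D.len i true) D.t x y),
        ⟨⟨ht.le, le_rfl, ?_, ?_, h2, hk.1, hk.2, Or.inr ?_⟩, rfl⟩, ?_⟩
      · simp only; linarith [h1.2]
      · simp only [hlen]; linarith
      · simp only [hlen, edgeHeight_reflect]
      · simp only [pos, sgn_false]
        rw [D.φ_h, ← D.θ_h i true, add_assoc, ← AddCircle.coe_add]
        simp only [sgn_true]
        congr 3
        ring
  · have key : ∀ (j : ι) (ε : Bool), D.len j ε = D.len i true →
        (∀ p ∈ tileDomain D.t (D.len i true), (D.θ j + ((sgn ε * p.1 : ℝ) : S1),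
          D.φ j + (p.2 : S1), edgeHeight (D.len i true) D.t p.1 p.2) ∈ D.tileGraph i) →
        m '' D.halfTile j ε ⊆ closure (m '' D.tileGraph i) := by
      rintro j ε hlen hG _ ⟨_, ⟨⟨s, x, y, τ⟩, ⟨h, rfl⟩, rfl⟩, rfl⟩
      simp only [triSet, mem_ofPred_eq, hlen] at h
      have hτ : τ ∈ Icc (0 : ℝ) 1 := ⟨h.τ_nonneg, h.τ_le⟩
      by_cases hc : x = D.t ∧ |y| = D.t
      · obtain ⟨rfl, hy⟩ := hc
        have h1 := corner_mem_closure ht hL hy hτ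
        have hc : Continuous fun r : ℝ => (r : S1) := AddCircle.continuous_mk' _
        let F : ℝ × ℝ → S3 := fun p =>
          m (D.θ j + ((sgn ε * p.1 : ℝ) : S1), D.φ j + (p.2 : S1), τ)
        have hF : Continuous F := hm.comp ((continuous_const.add (hc.comp (by fun_prop))).prodMk
          ((continuous_const.add (hc.comp (by fun_prop))).prodMk (by fun_prop)))
        have h2 : MapsTo F {p | p ∈ tileDomain D.t (D.len i true) ∧
            edgeHeight (D.len i true) D.t p.1 p.2 = τ} (m '' D.tileGraph i) := by
          rintro p ⟨hp, rfl⟩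
          exact mem_image_of_mem m (hG p hp)
        have h3 := map_mem_closure hF h1 h2
        exact h3
      · refine subset_closure (mem_image_of_mem m ?_)
        have h1 := h.corner_or.resolve_left hc
        rw [pos, h1]
        refine hG (x, y) ⟨h.mem_Icc hL, h.y_le, ?_⟩
        rintro ⟨h2 | h2, h3⟩
        · exact hc ⟨h2, h3⟩
        · simp only at h2
          linarith [h.x_le]
    rw [image_union]
    refine union_subset (key i true rfl ?_) (key (D.h i) false hlen ?_)
    · intro p hp
      rw [sgn_true, one_mul]
      exact mem_image_of_mem _ hp
    · rintro ⟨x, y⟩ ⟨h1, h2, h3⟩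
      have := D.tileGraph_h_subset i (D.len i true - x) y
        ⟨⟨by simp only; linarith [h1.2], by simp only; linarith [h1.1]⟩, h2, ?_⟩
      · rwa [sub_sub_cancel] at this
      · rintro ⟨h4, h5⟩
        refine h3 ⟨h4.symm.imp (fun h => ?_) (fun h => ?_), h5⟩ <;> simp only at h ⊢ <;> linarith

/-- The rectangle of the tube along the horizontal edge from `i` to `h i`. -/
def rectH (i : ι) : Rectangle :=
  ⟨D.θ i + (D.t : S1), D.θ (D.h i) - (D.t : S1), D.φ i - (D.t : S1), D.φ i + (D.t : S1)⟩

/-- The rectangle of the tube along the vertical edge from `i` to `v i`. -/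
def rectV (i : ι) : Rectangle :=
  ⟨D.θ i - (D.t : S1), D.θ i + (D.t : S1), D.φ i + (D.t : S1), D.φ (D.v i) - (D.t : S1)⟩

/-- The diagram of the tube. -/
def diagram : Set Rectangle := ⋃ i, {D.rectH i, D.rectV i}

theorem arcLength_long (i : ι) :
    arcLength (D.θ i + (D.t : S1)) (D.θ (D.h i) - (D.t : S1)) = D.len i true - 2 * D.t := by
  have h1 := D.two_t_lt_len i true
  have h2 := D.len_lt i true
  have h3 := D.t_pos
  have h4 : D.θ (D.h i) - (D.t : S1) =
      D.θ i + (D.t : S1) + ((D.len i true - 2 * D.t : ℝ) : S1) := by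
    rw [← D.θ_h i true, sgn_true, one_mul, two_mul D.t, AddCircle.coe_sub, AddCircle.coe_add]
    abel
  rw [h4, arcLength_add (by linarith) (by linarith)]

theorem arcLength_short (i : ι) (x : S1) :
    arcLength (x - (D.t : S1)) (x + (D.t : S1)) = 2 * D.t := by
  have h3 := D.t_pos
  have h4 : x + (D.t : S1) = x - (D.t : S1) + ((2 * D.t : ℝ) : S1) := by
    rw [two_mul D.t, AddCircle.coe_add]
    abel
  have h5 := D.two_t_lt_pi i
  rw [h4, arcLength_add (by linarith) (by linarith [Real.pi_pos])]

theorem tile_rectH (i : ι) :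
    tile (D.rectH i) = joinMk '' (D.halfTile i true ∪ D.halfTile (D.h i) false) := by
  rw [← D.closure_image_tileGraph continuous_joinMk, tile]
  have hL := D.two_t_lt_len i true
  simp only [rectH, D.arcLength_long, D.arcLength_short i]
  congr 1
  have hval : ∀ z ∈ puncturedRect (D.len i true - 2 * D.t) (2 * D.t),
      S3.mk (D.θ i + (D.t : S1) + (z.re : S1)) (D.φ i - (D.t : S1) + (z.im : S1))
        (zeta (tileHarmonic (D.len i true - 2 * D.t) (2 * D.t) z)) =
      joinMk (D.θ i + ((z.re + D.t : ℝ) : S1), D.φ i + ((z.im - D.t : ℝ) : S1),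
        edgeHeight (D.len i true) D.t (z.re + D.t) (z.im - D.t)) := by
    intro z hz
    rw [mk_eq_joinMk, zeta_tileHarmonic_horizontal D.t_pos hL hz, AddCircle.coe_add,
      AddCircle.coe_sub, add_right_comm, add_assoc, sub_add_eq_add_sub, add_sub_assoc]
  ext q
  constructor
  · rintro ⟨z, hz, rfl⟩
    simp only
    rw [hval z hz]
    refine mem_image_of_mem _ ⟨(z.re + D.t, z.im - D.t), ?_, rfl⟩
    obtain ⟨h1, h2, h3⟩ := hz
    refine ⟨⟨by simp only; linarith [h1.1], by simp only; linarith [h1.2]⟩,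
      abs_le.2 ⟨by simp only; linarith [h2.1], by simp only; linarith [h2.2]⟩, ?_⟩
    rintro ⟨h4, h5⟩
    refine h3 ⟨h4.imp (fun h => ?_) (fun h => ?_), ?_⟩
    · simp only at h; linarith
    · simp only at h; linarith
    · rcases eq_or_eq_neg_of_abs_eq h5 with h | h <;> simp only at h
      · right; linarith
      · left; linarith
  · rintro ⟨_, ⟨⟨x, y⟩, ⟨h1, h2, h3⟩, rfl⟩, rfl⟩
    have h2' := abs_le.1 h2
    simp only at h1 h2 h3 h2' ⊢
    have hz : (⟨x - D.t, y + D.t⟩ : ℂ) ∈ puncturedRect (D.len i true - 2 * D.t) (2 * D.t) := by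
      refine ⟨⟨by simp only; linarith [h1.1], by simp only; linarith [h1.2]⟩,
        ⟨by simp only; linarith [h2'.1], by simp only; linarith [h2'.2]⟩, ?_⟩
      rintro ⟨h4, h5⟩
      refine h3 ⟨h4.imp (fun h => ?_) (fun h => ?_), ?_⟩
      · simp only at h; linarith
      · simp only at h; linarith
      · rw [abs_eq D.t_pos.le]
        rcases h5 with h | h <;> simp only at h
        · right; linarith
        · left; linarith
    refine ⟨_, hz, ?_⟩
    simp only
    rw [hval _ hz]
    simp only [sub_add_cancel, add_sub_cancel_right]

theorem tile_rectV (i : ι) :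
    tile (D.rectV i) =
      joinMk '' (joinSwap '' (D.swap.halfTile i true ∪ D.swap.halfTile (D.v i) false)) := by
  have hjs : Continuous joinSwap := by unfold joinSwap; fun_prop
  have hcl := D.swap.closure_image_tileGraph (continuous_joinMk.comp hjs) i
  rw [image_comp, image_comp] at hcl
  refine Eq.trans ?_ hcl
  have hL : 2 * D.t < D.swap.len i true := D.swap.two_t_lt_len i true
  have hlong : arcLength (D.φ i + (D.t : S1)) (D.φ (D.v i) - (D.t : S1)) =
    D.swap.len i true - 2 * D.t := D.swap.arcLength_long i
  rw [tile]
  simp only [rectV, hlong, D.arcLength_short i]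
  congr 1
  have hval : ∀ z ∈ puncturedRect (2 * D.t) (D.swap.len i true - 2 * D.t),
      S3.mk (D.θ i - (D.t : S1) + (z.re : S1)) (D.φ i + (D.t : S1) + (z.im : S1))
        (zeta (tileHarmonic (2 * D.t) (D.swap.len i true - 2 * D.t) z)) =
      joinMk (joinSwap (D.φ i + ((z.im + D.t : ℝ) : S1), D.θ i + ((z.re - D.t : ℝ) : S1),
        edgeHeight (D.swap.len i true) D.t (z.im + D.t) (z.re - D.t))) := by
    intro z hz
    rw [mk_eq_joinMk, zeta_tileHarmonic_vertical D.t_pos hL hz, AddCircle.coe_add,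
      AddCircle.coe_sub, joinSwap, add_right_comm, add_assoc, sub_add_eq_add_sub, add_sub_assoc]
  ext q
  constructor
  · rintro ⟨z, hz, rfl⟩
    simp only
    rw [hval z hz]
    refine mem_image_of_mem _ (mem_image_of_mem _ ⟨(z.im + D.t, z.re - D.t), ?_, rfl⟩)
    obtain ⟨h2, h1, h3⟩ := hz
    change _ ∈ tileDomain D.t _
    refine ⟨⟨by simp only; linarith [h1.1], by simp only; linarith [h1.2]⟩,
      abs_le.2 ⟨by simp only; linarith [h2.1], by simp only; linarith [h2.2]⟩, ?_⟩
    rintro ⟨h4, h5⟩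
    refine h3 ⟨?_, h4.imp (fun h => ?_) (fun h => ?_)⟩
    · rcases eq_or_eq_neg_of_abs_eq h5 with h | h <;> simp only at h
      · right; linarith
      · left; linarith
    · simp only at h; linarith
    · simp only at h; linarith
  · rintro ⟨_, ⟨_, ⟨⟨x, y⟩, ⟨h1, h2, h3⟩, rfl⟩, rfl⟩, rfl⟩
    have h2' := abs_le.1 h2
    simp only at h1 h2 h3 h2' ⊢
    change x ∈ Icc D.t (_ - D.t) at h1
    change |y| ≤ D.t at h2
    change -D.t ≤ y ∧ y ≤ D.t at h2'
    change ¬ ((x = D.t ∨ x = _ - D.t) ∧ |y| = D.t) at h3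
    have hz : (⟨y + D.t, x - D.t⟩ : ℂ) ∈
        puncturedRect (2 * D.t) (D.swap.len i true - 2 * D.t) := by
      refine ⟨⟨by simp only; linarith [h2'.1], by simp only; linarith [h2'.2]⟩,
        ⟨by simp only; linarith [h1.1], by simp only; linarith [h1.2]⟩, ?_⟩
      rintro ⟨h5, h4⟩
      refine h3 ⟨h4.imp (fun h => ?_) (fun h => ?_), ?_⟩
      · simp only at h; linarith
      · simp only at h; linarith
      · rw [abs_eq D.t_pos.le]
        rcases h5 with h | h <;> simp only at h
        · right; linarith
        · left; linarith
    refine ⟨_, hz, ?_⟩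
    simp only
    rw [hval _ hz]
    simp only [sub_add_cancel, add_sub_cancel_right]
    rfl

/-- The surface of the diagram of radius `t` consists of the half-tiles of radius `t`. -/
theorem hatSurface_diagram : hatSurface D.diagram = D.shell {D.t} := by
  have h1 : hatSurface D.diagram = ⋃ i, (tile (D.rectH i) ∪ tile (D.rectV i)) := by
    simp only [hatSurface, diagram, biUnion_iUnion, biUnion_pair]
  rw [h1]
  have h2 : ∀ {a i ε p}, p ∈ D.piece a i ε → p.1 = D.t →
      joinMk (D.piecePos a i ε p) ∈ D.shell {D.t} := fun {a i ε p} hp ht =>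
    ⟨a, i, ε, p, hp, ht, rfl⟩
  apply Subset.antisymm
  · refine iUnion_subset fun i => union_subset ?_ ?_
    · rw [tile_rectH]
      rintro _ ⟨_, ⟨p, hp, rfl⟩ | ⟨p, hp, rfl⟩, rfl⟩
      · exact h2 (a := true) hp.1 hp.2
      · exact h2 (a := true) hp.1 hp.2
    · rw [tile_rectV]
      rintro _ ⟨_, ⟨_, ⟨p, hp, rfl⟩ | ⟨p, hp, rfl⟩, rfl⟩, rfl⟩
      · exact h2 (a := false) hp.1 hp.2
      · exact h2 (a := false) hp.1 hp.2
  · rintro _ ⟨a, i, ε, p, hp, ht, rfl⟩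
    cases a
    · cases ε
      · refine mem_iUnion.2 ⟨D.v i, Or.inr ?_⟩
        rw [tile_rectV, D.v_v]
        exact mem_image_of_mem _ (mem_image_of_mem _ (Or.inr ⟨p, ⟨hp, ht⟩, rfl⟩))
      · refine mem_iUnion.2 ⟨i, Or.inr ?_⟩
        rw [tile_rectV]
        exact mem_image_of_mem _ (mem_image_of_mem _ (Or.inl ⟨p, ⟨hp, ht⟩, rfl⟩))
    · cases ε
      · refine mem_iUnion.2 ⟨D.h i, Or.inl ?_⟩
        rw [tile_rectH, D.h_h]
        exact mem_image_of_mem _ (Or.inr ⟨p, ⟨hp, ht⟩, rfl⟩)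
      · refine mem_iUnion.2 ⟨i, Or.inl ?_⟩
        rw [tile_rectH]
        exact mem_image_of_mem _ (Or.inl ⟨p, ⟨hp, ht⟩, rfl⟩)

theorem shell_withRadius {s : ℝ} (hs : 0 < s) (hst : s ≤ D.t) :
    (D.withRadius s hs hst).shell {s} = D.shell {s} := by
  have key : ∀ {L x y τ : ℝ}, InTri s L s x y τ ↔ InTri D.t L s x y τ := fun {L x y τ} =>
    ⟨fun h => { h with s_le := hst }, fun h => { h with s_le := le_rfl }⟩
  have hpiece : ∀ a i ε {x y τ : ℝ}, ((s, x, y, τ) : ℝ × ℝ × ℝ × ℝ) ∈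
      (D.withRadius s hs hst).piece a i ε ↔ (s, x, y, τ) ∈ D.piece a i ε := by
    intro a i ε x y τ
    cases a <;> exact key
  have hpos : ∀ a i ε p, (D.withRadius s hs hst).piecePos a i ε p = D.piecePos a i ε p := by
    intro a i ε p
    cases a <;> rfl
  ext q
  constructor
  · rintro ⟨a, i, ε, ⟨_, x, y, τ⟩, hp, rfl, rfl⟩
    exact ⟨a, i, ε, _, (hpiece a i ε).1 hp, rfl, by rw [hpos]⟩
  · rintro ⟨a, i, ε, ⟨_, x, y, τ⟩, hp, rfl, rfl⟩
    exact ⟨a, i, ε, _, (hpiece a i ε).2 hp, rfl, by rw [hpos]⟩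

theorem shell_zero : D.shell {0} = D.core := by
  apply Subset.antisymm
  · rintro _ ⟨a, i, ε, p, hp, h0, rfl⟩
    rw [D.joinMk_piecePos_of_radius_eq_zero (fun _ => true) hp h0]
    exact D.joinMk_mem_core _ _
  · intro q hq
    obtain ⟨i, σ, hσ, rfl⟩ := D.exists_of_mem_core hq
    have hL := D.two_t_lt_len i true
    have ht := D.t_pos
    have h : InTri D.t (D.len i true) 0 0 0 σ :=
      ⟨le_rfl, ht.le, le_rfl, by linarith, by simp, hσ.1, hσ.2, Or.inl ⟨rfl, abs_zero⟩⟩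
    have := D.joinMk_pos_mem_shell h (S := {0}) rfl
    simpa [pos] using this

/-- The open tube is filled by the link and by the surfaces of smaller radii. -/
theorem shell_Iio : D.shell (Iio D.t) = D.core ∪ ⋃ s ∈ Ioo 0 D.t, D.shell {s} := by
  rw [← shell_zero]
  ext q
  simp only [mem_union, mem_iUnion, exists_prop]
  constructor
  · rintro ⟨a, i, ε, p, hp, hs, rfl⟩
    rcases (InTri.s_nonneg hp).eq_or_lt with h0 | h0
    · exact Or.inl ⟨a, i, ε, p, hp, h0.symm, rfl⟩
    · exact Or.inr ⟨p.1, ⟨h0, hs⟩, a, i, ε, p, hp, rfl, rfl⟩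
  · rintro (⟨a, i, ε, p, hp, hs, rfl⟩ | ⟨s, hs, a, i, ε, p, hp, hps, rfl⟩)
    · exact ⟨a, i, ε, p, hp, mem_Iio.2 ((mem_singleton_iff.1 hs).trans_lt D.t_pos), rfl⟩
    · exact ⟨a, i, ε, p, hp, mem_Iio.2 ((mem_singleton_iff.1 hps).trans_lt hs.2), rfl⟩

end EdgeData

/-! ### The diagram of the tube -/

theorem Rectangle.Compatible.symm {r₁ r₂ : Rectangle} (h : r₁.Compatible r₂) :
    r₂.Compatible r₁ := by
  simpa only [Rectangle.Compatible, inter_comm r₂.toSet, inter_comm r₂.vertices,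
    union_comm r₂.vertices] using h

theorem Rectangle.mem_vertices_iff {r : Rectangle} {x y : S1} :
    (x, y) ∈ r.vertices ↔ (x = r.θm ∨ x = r.θp) ∧ (y = r.φm ∨ y = r.φp) := by
  simp only [Rectangle.vertices, mem_insert_iff, mem_singleton_iff, Prod.mk_inj]
  tauto

theorem mem_arc_iff {x y z : S1} {a b : ℝ} (h : arcLength (x + (a : S1)) y = b - a) :
    z ∈ arc (x + (a : S1)) y ↔ ∃ r ∈ Icc a b, z = x + (r : S1) := by
  rw [arc, h]
  constructor
  · rintro ⟨s, hs, rfl⟩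
    exact ⟨a + s, ⟨by linarith [hs.1], by linarith [hs.2]⟩, by
      simp only [AddCircle.coe_add, add_assoc]⟩
  · rintro ⟨r, hr, rfl⟩
    refine ⟨r - a, ⟨by linarith [hr.1], by linarith [hr.2]⟩, ?_⟩
    simp only
    rw [AddCircle.coe_sub, add_assoc, add_sub_cancel]

namespace EdgeData

variable {ι : Type} (D : EdgeData ι)

/-- The short side of the rectangles around the point `x`. -/
def shortArc (x : S1) : Set S1 := arc (x - (D.t : S1)) (x + (D.t : S1))

/-- The long side of the rectangle along the edge from `i` to `h i`. -/
def longArc (i : ι) : Set S1 := arc (D.θ i + (D.t : S1)) (D.θ (D.h i) - (D.t : S1))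

theorem mem_longArc {i : ι} {z : S1} :
    z ∈ D.longArc i ↔ ∃ r ∈ Icc D.t (D.len i true - D.t), z = D.θ i + (r : S1) :=
  mem_arc_iff (by rw [D.arcLength_long]; ring)

theorem mem_shortArc (i : ι) {x z : S1} :
    z ∈ D.shortArc x ↔ ∃ u, |u| ≤ D.t ∧ z = x + (u : S1) := by
  have h : x - (D.t : S1) = x + ((-D.t : ℝ) : S1) := by rw [AddCircle.coe_neg, sub_eq_add_neg]
  have h2 := D.arcLength_short i x
  rw [shortArc, h]
  rw [h] at h2
  rw [mem_arc_iff (b := D.t) (by rw [h2]; ring)]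
  simp only [mem_Icc, abs_le]

theorem toSet_rectH (i : ι) : (D.rectH i).toSet = D.longArc i ×ˢ D.shortArc (D.φ i) := rfl

theorem toSet_rectV (i : ι) : (D.rectV i).toSet = D.shortArc (D.θ i) ×ˢ D.swap.longArc i := rfl

theorem θ_eq_of_mem_shortArc {i j : ι} {z : S1} (h : z ∈ D.shortArc (D.θ i))
    (h' : z ∈ D.shortArc (D.θ j)) : D.θ i = D.θ j := by
  obtain ⟨u, hu, rfl⟩ := (D.mem_shortArc i).1 h
  obtain ⟨u', hu', h2⟩ := (D.mem_shortArc j).1 h'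
  refine (D.θ_eq_of_add_eq h2 ?_).1
  have h3 := abs_le.1 hu
  have h4 := abs_le.1 hu'
  rw [abs_le]
  constructor <;> linarith

theorem add_t_mem_shortArc (i : ι) (x : S1) : x + (D.t : S1) ∈ D.shortArc x :=
  (D.mem_shortArc i).2 ⟨D.t, (abs_of_pos D.t_pos).le, rfl⟩

theorem sub_t_mem_shortArc (i : ι) (x : S1) : x - (D.t : S1) ∈ D.shortArc x :=
  (D.mem_shortArc i).2 ⟨-D.t, by rw [abs_neg, abs_of_pos D.t_pos],
    by rw [AddCircle.coe_neg, sub_eq_add_neg]⟩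

/-- The long sides over the two edges of a longitude are disjoint. -/
theorem notMem_longArc_h {i : ι} {z : S1} (h : z ∈ D.longArc i) : z ∉ D.longArc (D.h i) := by
  intro h'
  obtain ⟨r, hr, rfl⟩ := D.mem_longArc.1 h
  obtain ⟨r', hr', h2⟩ := D.mem_longArc.1 h'
  have h3 := D.len_add_len i true
  have h4 : D.len (D.h i) true = D.len i false := D.len_h i false
  have ht := D.t_pos
  rw [h4] at hr'
  rw [← D.θ_h i true, add_assoc, ← AddCircle.coe_add, sgn_true, one_mul] at h2
  simp only [Bool.not_true] at h3
  have h5 := coe_inj_of_abs_lt (add_left_cancel h2) (by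
    rw [abs_lt]; constructor <;> linarith [hr.1, hr.2, hr'.1, hr'.2])
  linarith [hr.1, hr.2, hr'.1, hr'.2]

/-- The long side over an edge meets the short side over a meridian in an endpoint, if the edge
has an end on the meridian, or contains the short side. -/
theorem longArc_inter_shortArc {i j : ι} (hne : (D.longArc i ∩ D.shortArc (D.θ j)).Nonempty) :
    (D.θ j = D.θ i ∧ D.longArc i ∩ D.shortArc (D.θ j) ⊆ {D.θ i + (D.t : S1)}) ∨
    (D.θ j = D.θ (D.h i) ∧
      D.longArc i ∩ D.shortArc (D.θ j) ⊆ {D.θ (D.h i) - (D.t : S1)}) ∨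
    (D.θ j ≠ D.θ i ∧ D.θ j ≠ D.θ (D.h i) ∧
      D.longArc i ∩ D.shortArc (D.θ j) = D.shortArc (D.θ j)) := by
  have ht := D.t_pos
  have hL := D.two_t_lt_len i true
  have hL' := D.len_lt i true
  by_cases h1 : D.θ j = D.θ i
  · refine Or.inl ⟨h1, ?_⟩
    rintro z ⟨hz, hz'⟩
    obtain ⟨r, hr, rfl⟩ := D.mem_longArc.1 hz
    obtain ⟨u, hu, h2⟩ := (D.mem_shortArc j).1 hz'
    have hu' := abs_le.1 hu
    rw [h1] at h2
    have h3 := coe_inj_of_abs_lt (add_left_cancel h2) (by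
      rw [abs_lt]; constructor <;> linarith [hr.1, hr.2])
    have h4 : r = D.t := by linarith [hr.1]
    rw [h4, mem_singleton_iff]
  by_cases h1' : D.θ j = D.θ (D.h i)
  · refine Or.inr (Or.inl ⟨h1', ?_⟩)
    rintro z ⟨hz, hz'⟩
    obtain ⟨r, hr, rfl⟩ := D.mem_longArc.1 hz
    obtain ⟨u, hu, h2⟩ := (D.mem_shortArc j).1 hz'
    have hu' := abs_le.1 hu
    rw [h1', ← D.θ_h i true, add_assoc, ← AddCircle.coe_add, sgn_true, one_mul] at h2
    have h3 := coe_inj_of_abs_lt (add_left_cancel h2) (by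
      rw [abs_lt]; constructor <;> linarith [hr.1, hr.2])
    have h4 : r = D.len i true - D.t := by linarith [hr.2]
    rw [h4, mem_singleton_iff, ← D.θ_h i true, sgn_true, one_mul, AddCircle.coe_sub,
      add_sub_assoc]
  · refine Or.inr (Or.inr ⟨h1, h1', inter_eq_right.2 ?_⟩)
    obtain ⟨z, hz, hz'⟩ := hne
    obtain ⟨r, hr, rfl⟩ := D.mem_longArc.1 hz
    obtain ⟨u, hu, h2⟩ := (D.mem_shortArc j).1 hz'
    have hu' := abs_le.1 hu
    have e1 : D.θ i + ((r - u : ℝ) : S1) = D.θ j := by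
      rw [AddCircle.coe_sub, ← add_sub_assoc, h2, add_sub_cancel_right]
    have e2 : D.θ (D.h i) + ((r - u - D.len i true : ℝ) : S1) = D.θ j := by
      rw [← e1, ← D.θ_h i true, add_assoc, ← AddCircle.coe_add]
      congr 2
      rw [sgn_true]
      ring
    have d1 := (D.θ_sep _ _ (Ne.symm h1)).trans_le (dist_le_of_add_eq e1)
    have d2 := (D.θ_sep _ _ (Ne.symm h1')).trans_le (dist_le_of_add_eq e2)
    rw [abs_of_nonneg (by linarith [hr.1])] at d1
    rw [abs_of_nonpos (by linarith [hr.2])] at d2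
    intro w hw
    obtain ⟨b, hb, rfl⟩ := (D.mem_shortArc j).1 hw
    have hb' := abs_le.1 hb
    refine D.mem_longArc.2 ⟨r - u + b, ⟨by linarith, by linarith⟩, ?_⟩
    rw [AddCircle.coe_add, ← add_assoc, e1]

theorem compatible_rectH_rectH {i j : ι} (hij : j ≠ i) :
    (D.rectH i).Compatible (D.rectH j) := by
  left
  rw [toSet_rectH, toSet_rectH, eq_empty_iff_forall_notMem]
  rintro ⟨z, w⟩ ⟨⟨h1, h2⟩, h3, h4⟩
  have h5 := (D.eq_of_φ_eq i j (D.swap.θ_eq_of_mem_shortArc h2 h4)).resolve_left hij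
  subst h5
  exact D.notMem_longArc_h h1 h3

theorem compatible_rectV_rectV {i j : ι} (hij : j ≠ i) :
    (D.rectV i).Compatible (D.rectV j) := by
  left
  rw [toSet_rectV, toSet_rectV, eq_empty_iff_forall_notMem]
  rintro ⟨z, w⟩ ⟨⟨h1, h2⟩, h3, h4⟩
  have h5 := (D.eq_of_θ_eq i j (D.θ_eq_of_mem_shortArc h1 h3)).resolve_left hij
  subst h5
  exact D.swap.notMem_longArc_h h2 h4

theorem sub_t_ne_add_t (i : ι) (x : S1) : x - (D.t : S1) ≠ x + (D.t : S1) := by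
  intro h
  have h1 := D.arcLength_short i x
  rw [h] at h1
  have h2 := arcLength_add (x := x + (D.t : S1)) le_rfl Real.two_pi_pos
  rw [AddCircle.coe_zero, add_zero] at h2
  linarith [D.t_pos]

/-- A rectangle along a horizontal edge and a rectangle along a vertical edge share a vertex if the
edges do; otherwise they are disjoint or cross in a square. -/
theorem compatible_rectH_rectV (i j : ι) : (D.rectH i).Compatible (D.rectV j) := by
  rw [Rectangle.Compatible, toSet_rectH, toSet_rectV, prod_inter_prod]
  rcases eq_empty_or_nonempty ((D.longArc i ∩ D.shortArc (D.θ j)) ×ˢ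
    (D.shortArc (D.φ i) ∩ D.swap.longArc j)) with h0 | h0
  · exact Or.inl h0
  right
  obtain ⟨hθ, hφ⟩ := prod_nonempty_iff.1 h0
  rw [inter_comm (D.shortArc (D.φ i))] at hφ ⊢
  have h1 := D.longArc_inter_shortArc hθ
  have h2 : (D.φ i = D.φ j ∧ D.swap.longArc j ∩ D.shortArc (D.φ i) ⊆ {D.φ j + (D.t : S1)}) ∨
      (D.φ i = D.φ (D.v j) ∧
        D.swap.longArc j ∩ D.shortArc (D.φ i) ⊆ {D.φ (D.v j) - (D.t : S1)}) ∨
      (D.φ i ≠ D.φ j ∧ D.φ i ≠ D.φ (D.v j) ∧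
        D.swap.longArc j ∩ D.shortArc (D.φ i) = D.shortArc (D.φ i)) :=
    D.swap.longArc_inter_shortArc hφ
  have hθφ : D.θ j = D.θ i ∨ D.θ j = D.θ (D.h i) → D.φ i = D.φ j ∨ D.φ i = D.φ (D.v j) := by
    rintro (h | h)
    · rcases D.eq_of_θ_eq _ _ h with h | h
      · exact Or.inl (by rw [h])
      · exact Or.inr (by rw [h])
    · rcases D.eq_of_θ_eq _ _ h with h | h
      · exact Or.inl (by rw [← h, D.φ_h])
      · exact Or.inr (by rw [← h, D.φ_h])
  have hφθ : D.φ i = D.φ j ∨ D.φ i = D.φ (D.v j) → D.θ j = D.θ i ∨ D.θ j = D.θ (D.h i) := by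
    rintro (h | h)
    · rcases D.eq_of_φ_eq _ _ h with h | h
      · exact Or.inl (by rw [h])
      · exact Or.inr (by rw [h])
    · rcases D.eq_of_φ_eq _ _ h with h | h
      · exact Or.inl (by rw [← h, D.θ_v])
      · exact Or.inr (by rw [← h, D.θ_v])
  by_cases hs : D.θ j = D.θ i ∨ D.θ j = D.θ (D.h i)
  · left
    have h1' : ∃ x, (x = D.θ i + (D.t : S1) ∨ x = D.θ (D.h i) - (D.t : S1)) ∧
        (x = D.θ j - (D.t : S1) ∨ x = D.θ j + (D.t : S1)) ∧
        D.longArc i ∩ D.shortArc (D.θ j) ⊆ {x} := by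
      rcases h1 with h | h | h
      · exact ⟨_, Or.inl rfl, Or.inr (by rw [h.1]), h.2⟩
      · exact ⟨_, Or.inr rfl, Or.inl (by rw [h.1]), h.2⟩
      · exact absurd hs (not_or.2 ⟨h.1, h.2.1⟩)
    have h2' : ∃ y, (y = D.φ j + (D.t : S1) ∨ y = D.φ (D.v j) - (D.t : S1)) ∧
        (y = D.φ i - (D.t : S1) ∨ y = D.φ i + (D.t : S1)) ∧
        D.swap.longArc j ∩ D.shortArc (D.φ i) ⊆ {y} := by
      rcases h2 with h | h | h
      · exact ⟨_, Or.inl rfl, Or.inr (by rw [h.1]), h.2⟩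
      · exact ⟨_, Or.inr rfl, Or.inl (by rw [h.1]), h.2⟩
      · exact absurd (hθφ hs) (not_or.2 ⟨h.1, h.2.1⟩)
    obtain ⟨x, hx1, hx2, hx⟩ := h1'
    obtain ⟨y, hy1, hy2, hy⟩ := h2'
    rintro ⟨z, w⟩ ⟨hz, hw⟩
    have hzx : z = x := hx hz
    have hwy : w = y := hy hw
    rw [hzx, hwy]
    exact ⟨Rectangle.mem_vertices_iff.2 ⟨hx1, hy2⟩, Rectangle.mem_vertices_iff.2 ⟨hx2, hy1⟩⟩
  · right
    obtain ⟨h3, h4, h5⟩ := (h1.resolve_left fun h => hs (Or.inl h.1)).resolve_left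
      fun h => hs (Or.inr h.1)
    obtain ⟨h6, h7, h8⟩ := (h2.resolve_left fun h => hs (hφθ (Or.inl h.1))).resolve_left
      fun h => hs (hφθ (Or.inr h.1))
    refine ⟨⟨D.θ j - (D.t : S1), D.θ j + (D.t : S1), D.φ i - (D.t : S1), D.φ i + (D.t : S1)⟩,
      ⟨D.sub_t_ne_add_t i _, D.sub_t_ne_add_t i _⟩, by rw [h5, h8]; rfl, ?_⟩
    rw [disjoint_left]
    rintro ⟨z, w⟩ ⟨hz, hw⟩ hv
    change z ∈ D.shortArc (D.θ j) at hz
    change w ∈ D.shortArc (D.φ i) at hw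
    have a1 : z ≠ D.θ i + (D.t : S1) := by
      rintro rfl
      exact h3 (D.θ_eq_of_mem_shortArc hz (D.add_t_mem_shortArc i _))
    have a2 : z ≠ D.θ (D.h i) - (D.t : S1) := by
      rintro rfl
      exact h4 (D.θ_eq_of_mem_shortArc hz (D.sub_t_mem_shortArc i _))
    have b1 : w ≠ D.φ j + (D.t : S1) := by
      rintro rfl
      exact h6 (D.swap.θ_eq_of_mem_shortArc hw (D.add_t_mem_shortArc i _))
    have b2 : w ≠ D.φ (D.v j) - (D.t : S1) := by
      rintro rfl
      exact h7 (D.swap.θ_eq_of_mem_shortArc hw (D.sub_t_mem_shortArc i _))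
    rcases hv with hv | hv
    · exact (Rectangle.mem_vertices_iff.1 hv).1.elim a1 a2
    · exact (Rectangle.mem_vertices_iff.1 hv).2.elim b1 b2

theorem mem_diagram {r : Rectangle} :
    r ∈ D.diagram ↔ ∃ i, r = D.rectH i ∨ r = D.rectV i := by
  simp only [diagram, mem_iUnion, mem_insert_iff, mem_singleton_iff]

theorem θ_add_ne_sub {i j : ι} : D.θ i + (D.t : S1) ≠ D.θ j - (D.t : S1) := by
  intro h
  rw [sub_eq_add_neg, ← AddCircle.coe_neg] at h
  have ht := D.t_pos
  have := (D.θ_eq_of_add_eq h (by rw [sub_neg_eq_add, ← two_mul, abs_of_pos (by linarith)])).2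
  linarith

theorem finite_diagram [Finite ι] : D.diagram.Finite :=
  finite_iUnion fun _ => (finite_singleton _).insert _

theorem isQuasiSurfaceDiagram_diagram [Finite ι] : IsQuasiSurfaceDiagram D.diagram where
  proper := by
    intro r hr
    obtain ⟨i, rfl | rfl⟩ := D.mem_diagram.1 hr
    · exact ⟨D.θ_add_ne_sub, D.sub_t_ne_add_t i _⟩
    · exact ⟨D.sub_t_ne_add_t i _, D.swap.θ_add_ne_sub⟩
  countable := D.finite_diagram.countable
  compatible := by
    intro r hr r' hr' hne
    obtain ⟨i, rfl | rfl⟩ := D.mem_diagram.1 hr <;> obtain ⟨j, rfl | rfl⟩ := D.mem_diagram.1 hr'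
    · exact D.compatible_rectH_rectH fun h => hne (by rw [h])
    · exact D.compatible_rectH_rectV i j
    · exact (D.compatible_rectH_rectV j i).symm
    · exact D.compatible_rectV_rectV fun h => hne (by rw [h])
  discrete_theta := by
    have : Finite (thetaSet D.diagram) :=
      (D.finite_diagram.biUnion fun _ _ => (finite_singleton _).insert _).to_subtype
    infer_instance
  discrete_phi := by
    have : Finite (phiSet D.diagram) :=
      (D.finite_diagram.biUnion fun _ _ => (finite_singleton _).insert _).to_subtype
    infer_instance
  locallyFinite := fun _ => D.finite_diagram.subset fun _ h => h.1

theorem rectH_ne_rectV (i j : ι) : D.rectH i ≠ D.rectV j := fun h =>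
  D.θ_add_ne_sub (congrArg Rectangle.θm h)

/-- Every vertex of a rectangle along a horizontal edge is a vertex of a rectangle along a vertical
edge, and conversely. -/
theorem diagramBoundary_diagram : diagramBoundary D.diagram = ∅ := by
  rw [eq_empty_iff_forall_notMem]
  rintro p ⟨r, ⟨hr, hp⟩, huniq⟩
  have hH : ∀ i, D.rectH i ∈ D.diagram := fun i => D.mem_diagram.2 ⟨i, Or.inl rfl⟩
  have hV : ∀ i, D.rectV i ∈ D.diagram := fun i => D.mem_diagram.2 ⟨i, Or.inr rfl⟩
  have key : ∀ i j, p ∈ (D.rectH i).vertices → p ∈ (D.rectV j).vertices → False := by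
    intro i j h1 h2
    exact D.rectH_ne_rectV i j
      ((huniq _ ⟨hH i, h1⟩).trans (huniq _ ⟨hV j, h2⟩).symm)
  obtain ⟨i, rfl | rfl⟩ := D.mem_diagram.1 hr
  · have hp' := hp
    simp only [Rectangle.vertices, rectH, mem_insert_iff, mem_singleton_iff] at hp'
    rcases hp' with h | h | h | h
    · refine key i (D.v i) hp ?_
      rw [h]
      simp [Rectangle.vertices, rectV, D.v_v, D.θ_v]
    · refine key i i hp ?_
      rw [h]
      simp [Rectangle.vertices, rectV]
    · refine key i (D.v (D.h i)) hp ?_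
      rw [h]
      simp [Rectangle.vertices, rectV, D.v_v, D.θ_v, D.φ_h]
    · refine key i (D.h i) hp ?_
      rw [h]
      simp [Rectangle.vertices, rectV, D.φ_h]
  · have hp' := hp
    simp only [Rectangle.vertices, rectV, mem_insert_iff, mem_singleton_iff] at hp'
    rcases hp' with h | h | h | h
    · refine key (D.h i) i ?_ hp
      rw [h]
      simp [Rectangle.vertices, rectH, D.h_h, D.φ_h]
    · refine key (D.h (D.v i)) i ?_ hp
      rw [h]
      simp [Rectangle.vertices, rectH, D.h_h, D.φ_h, D.θ_v]
    · refine key i i ?_ hp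
      rw [h]
      simp [Rectangle.vertices, rectH]
    · refine key (D.v i) i ?_ hp
      rw [h]
      simp [Rectangle.vertices, rectH, D.θ_v]

theorem isSurfaceDiagram_diagram [Finite ι] : IsSurfaceDiagram D.diagram where
  quasi := D.isQuasiSurfaceDiagram_diagram
  boundary := by
    rw [D.diagramBoundary_diagram]
    exact ⟨finite_empty, fun _ => Or.inl (by simp), fun _ => Or.inl (by simp)⟩

end EdgeData

/-! ### Rectangular diagrams of links -/

theorem eq_or_eq_of_encard_eq_two {α : Type*} {s : Set α} (hs : s.encard = 0 ∨ s.encard = 2)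
    {a b c : α} (ha : a ∈ s) (hb : b ∈ s) (hc : c ∈ s) (hab : a ≠ b) : c = a ∨ c = b := by
  rcases hs with hs | hs
  · rw [encard_eq_zero] at hs
    rw [hs] at ha
    exact absurd ha (notMem_empty a)
  · obtain ⟨x, y, -, rfl⟩ := encard_eq_two.1 hs
    simp only [mem_insert_iff, mem_singleton_iff] at ha hb hc
    rcases ha with rfl | rfl <;> rcases hb with rfl | rfl <;> rcases hc with rfl | rfl <;> simp_all

theorem eq_or_eq_of_isVerticalEdge {R : Set Torus} (hR : IsLinkDiagram R) {a b c : R}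
    (hab : IsVerticalEdge R a b) (hc : (a : Torus).1 = (c : Torus).1) : c = a ∨ c = b := by
  obtain ⟨ha, hb, hne, h⟩ := hab
  have := eq_or_eq_of_encard_eq_two (hR.meridian (a : Torus).1) ⟨ha, rfl⟩ ⟨hb, h.symm⟩
    ⟨c.2, hc.symm⟩ hne
  exact this.imp Subtype.ext Subtype.ext

theorem eq_or_eq_of_isHorizontalEdge {R : Set Torus} (hR : IsLinkDiagram R) {a b c : R}
    (hab : IsHorizontalEdge R a b) (hc : (a : Torus).2 = (c : Torus).2) : c = a ∨ c = b := by
  obtain ⟨ha, hb, hne, h⟩ := hab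
  have := eq_or_eq_of_encard_eq_two (hR.longitude (a : Torus).2) ⟨ha, rfl⟩ ⟨hb, h.symm⟩
    ⟨c.2, hc.symm⟩ hne
  exact this.imp Subtype.ext Subtype.ext

/-- The combinatorial data of a rectangular diagram of a link. -/
def edgeData {R : Set Torus} (hR : IsLinkDiagram R) {d : ℝ} (hd : IsLeast (edgeDistances R) d)
    {𝔳 𝔥 : Equiv.Perm R} (h𝔳 : ∀ v : R, IsVerticalEdge R v (𝔳 v))
    (h𝔥 : ∀ v : R, IsHorizontalEdge R v (𝔥 v)) {t : ℝ} (ht : t ∈ Ioo 0 (d / 2)) :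
    EdgeData R where
  θ v := v.1.1
  φ v := v.1.2
  h := 𝔥
  v := 𝔳
  t := t
  h_h i := ((eq_or_eq_of_isHorizontalEdge hR (h𝔥 i) ((h𝔥 i).2.2.2.trans
    (h𝔥 (𝔥 i)).2.2.2)).resolve_right fun h => (h𝔥 (𝔥 i)).2.2.1 (congrArg _ h.symm))
  v_v i := ((eq_or_eq_of_isVerticalEdge hR (h𝔳 i) ((h𝔳 i).2.2.2.trans
    (h𝔳 (𝔳 i)).2.2.2)).resolve_right fun h => (h𝔳 (𝔳 i)).2.2.1 (congrArg _ h.symm))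
  φ_h i := (h𝔥 i).2.2.2.symm
  θ_v i := (h𝔳 i).2.2.2.symm
  θ_h_ne i h := (h𝔥 i).2.2.1 (Prod.ext h.symm (h𝔥 i).2.2.2)
  φ_v_ne i h := (h𝔳 i).2.2.1 (Prod.ext (h𝔳 i).2.2.2 h.symm)
  eq_of_θ_eq i _ h := eq_or_eq_of_isVerticalEdge hR (h𝔳 i) h
  eq_of_φ_eq i _ h := eq_or_eq_of_isHorizontalEdge hR (h𝔥 i) h
  t_pos := ht.1
  θ_sep i j h := by
    have := hd.2 (Or.inl ⟨i.1, i.2, j.1, j.2, h, rfl⟩)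
    linarith [ht.2]
  φ_sep i j h := by
    have := hd.2 (Or.inr ⟨i.1, i.2, j.1, j.2, h, rfl⟩)
    linarith [ht.2]

end RectDiagram

end


open RectDiagram
theorem mainTheorem8 (R : Set Torus) (hR : IsLinkDiagram R)
    (d : ℝ) (hd : IsLeast (edgeDistances R) d)
    (𝔳 𝔥 : Equiv.Perm R)
    (h𝔳 : ∀ v : R, IsVerticalEdge R v (𝔳 v))
    (h𝔥 : ∀ v : R, IsHorizontalEdge R v (𝔥 v))
    (t : ℝ) (ht : t ∈ Set.Ioo 0 (d / 2)) :
    IsSurfaceDiagram (tubeDiagram R 𝔳 𝔥 t) ∧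
      IsTubularNeighborhood (hatLink R) (tube R 𝔳 𝔥 t)
        (hatSurface (tubeDiagram R 𝔳 𝔥 t)) := by
  let D := edgeData hR hd h𝔳 h𝔥 ht
  have : Finite R := hR.finite.to_subtype
  have hdiag : tubeDiagram R 𝔳 𝔥 t = D.diagram := rfl
  have hcore : hatLink R = D.core := biUnion_eq_iUnion R fun v _ => hatPoint v
  have htube : tube R 𝔳 𝔥 t = D.shell (Iio D.t) := by
    rw [tube, D.shell_Iio, hcore]
    congr 1
    refine iUnion₂_congr fun s hs => ?_
    rw [← D.shell_withRadius hs.1 (le_of_lt hs.2)]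
    exact (D.withRadius s hs.1 (le_of_lt hs.2)).hatSurface_diagram
  rw [htube, hcore, hdiag, D.hatSurface_diagram]
  exact ⟨D.isSurfaceDiagram_diagram, D.isTubularNeighborhood_of_isOpen D.isOpen_shell⟩
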